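/- Let $D(K)$ be a prime, twist-reduced diagram of a link $K\subset S^3$ with at least two twist regions $R_1,\dots,R_t$ (maximal rows of bigons arranged end to end; a crossing adjacent to no bigon is also a twist region). Let $a_i$ be the number of crossings of $R_i$. Let $J$ be the augmented link obtained by adding to $K$ a crossing circle $C_i$ around each twist region $R_i$ and then removing full twists, so that $r_i\in\{0,\pm1\}$ signed crossings with $r_i\equiv a_i \pmod 2$ remain at $C_i$ (for a twist region consisting of a single crossing, either of the two directions may be chosen for the crossing circle). The exterior $E(J)$ is decomposed into two right-angled ideal polyhedra $P_1,P_2$: cut along the projection plane and along the halves of the twice-punctured disks bounded by the crossing circles. Truncating the ideal vertices tiles every torus of $\partial E(J)$ by rectangles. For an admissible (immersed) disk $D$ in a truncated polyhedron $P\in\{P_1,P_2\}$, let $$a(D)=\tfrac{\pi}{2}\,\#\{\text{interior edges crossed by }\partial D\}+\pi\,|\partial D\cap\partial E(J)|-2\pi+3\pi\,|\partial D\setminus\partial P|,$$ and let $\ell(\gamma,D)=a(D)/|\partial D\cap\partial E(J)|$ for each segment $\gamma$ of $\partial D$ in a boundary rectangle. The combinatorial length of a closed simplicial curve $\gamma\subset\partial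 E(J)$ made of segments $\gamma_1,\dots,\gamma_m$ is the infimum of $\sum_i\ell(\gamma_i,D_i)$ over all inward extensions of $\gamma$, i.e. all cyclic sequences of admissible disks $D_i$ with $\gamma_i\subset\partial D_i$ whose boundaries agree on the shared faces of consecutive polyhedra. The combinatorial length $\ell_{\rm comb}(s)$ of a slope $s$ is the infimum of the combinatorial lengths of the closed simplicial curves that represent non-zero multiples of $s$. Then: (1) If $T$ is the boundary torus coming from a component $K_j$ of $K$, and $n$ is the number of twist regions visited by $K_j$, counted with multiplicity, then every slope $s$ on $T$ other than the meridian satisfies $$\ell_{\rm comb}(s)\ge \frac{n\pi}{3}.$$ (2) If $T$ is the boundary torus of a crossing circle $C_i$, and $s$ is the surgery slope $1/q$ on $C_i$ ($q\in\mathbb Z$; one meridian and $q$ longitudes), whose filling leaves $n=|r_i+2q|$ crossings in the twist region, then $$\ell_{\rm comb}(s)> \frac{n\pi}{3}.$$ In particular, when the crossings of $R_i$ all twist in the same direction, the slope on $C_i$ that recovers $R_i$ has combinatorial length strictly greater than $a_i\pi/3$. -/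

import Mathlib

/-!
Conventions.  Planar diagrams and polyhedra are given by combinatorial maps.  All pictures are
drawn with the counterclockwise orientation.
-/

noncomputable section

open Classical

namespace AugLink

/-! ## Graphs on the sphere and truncated ideal polyhedra -/

/-- A combinatorial map: `X` is the set of darts (half-edges, pointing away from their vertex),
`σ` sends a dart to the next dart counterclockwise around the same vertex, and `α` sends a dart to
the other dart of the same edge.  The *corner* `x` is the corner between the darts `x` and `σ x`. -/
structure CombMap (X : Type*) where
  σ : Equiv.Perm X
  α : Equiv.Perm X
  α_invol : ∀ x, α (α x) = x
  α_ne : ∀ x, α x ≠ x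

namespace CombMap

variable {X : Type*} (M : CombMap X)

/-- The face permutation: the next dart along the boundary of the face to the left of `x`.
That face contains the corners `x, φ x, φ (φ x), …`. -/
def φ : Equiv.Perm X := M.σ⁻¹ * M.α

/-- `x` and `y` leave the same vertex. -/
def SameVertex (x y : X) : Prop := M.σ.SameCycle x y

/-- The corners `x` and `y` lie in the same face. -/
def SameFace (x y : X) : Prop := M.φ.SameCycle x y

/-- The set of vertices. -/
abbrev Vertex : Type _ := Quotient (Equiv.Perm.SameCycle.setoid M.σ)

/-- The set of edges. -/
abbrev Edge : Type _ := Quotient (Equiv.Perm.SameCycle.setoid M.α)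

/-- The set of faces. -/
abbrev Face : Type _ := Quotient (Equiv.Perm.SameCycle.setoid M.φ)

/-- The graph is connected. -/
def Connected : Prop := ∀ x y : X, Relation.EqvGen (fun u v => v = M.σ u ∨ v = M.α u) x y

/-- The surface carrying the (connected) graph is a sphere. -/
def Spherical : Prop :=
  Nat.card M.Vertex + Nat.card M.Face = Nat.card M.Edge + 2

end CombMap

/-- The sides of the faces of a truncated ideal polyhedron.
* `edge x`: the interior edge carrying the dart `x`, seen from the interior face to its left;
* `corner x`: the boundary edge that truncates the corner `x`, seen from the interior face
  containing that corner;
* `bdry x`: the same boundary edge, seen from the boundary face at the vertex of `x`. -/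
inductive Side (X : Type*)
  | edge (x : X)
  | corner (x : X)
  | bdry (x : X)

/-- The side belongs to an interior face. -/
def Side.Interior {X : Type*} : Side X → Prop
  | .edge _ => True
  | .corner _ => True
  | .bdry _ => False

namespace CombMap

variable {X : Type*} (M : CombMap X)

/-- The same edge of the truncated polyhedron, seen from the face on the other side. -/
def flip : Side X → Side X
  | .edge x => .edge (M.α x)
  | .corner x => .bdry x
  | .bdry x => .corner x

/-- Two sides belong to the same face of the truncated polyhedron. -/
def OnFace : Side X → Side X → Prop
  | .edge x, .edge y => M.SameFace x y
  | .edge x, .corner y => M.SameFace x y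
  | .corner x, .edge y => M.SameFace x y
  | .corner x, .corner y => M.SameFace x y
  | .bdry x, .bdry y => M.SameVertex x y
  | _, _ => False

/-- An interior edge and a boundary edge that share an endpoint. -/
def Adjacent : Side X → Side X → Prop
  | .edge x, .corner y =>
      y = x ∨ y = M.σ⁻¹ x ∨ y = M.α x ∨ y = M.σ⁻¹ (M.α x)
  | _, _ => False

/-- A segment inside one face, running from the side `s` to the side `t`, whose endpoints are
neither on the same edge nor on an interior edge and an adjacent boundary edge. -/
def IsSegment (s t : Side X) : Prop :=
  M.OnFace s t ∧ t ≠ s ∧ t ≠ M.flip s ∧ ¬ M.Adjacent s t ∧ ¬ M.Adjacent t s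

/-- Compatibility of two consecutive steps of the boundary of an admissible disk.  A step `some s`
crosses an edge of the truncated polyhedron, leaving a face through its side `s`; a step `none`
leaves the surface of the polyhedron at an interior point of an interior face, runs through the
interior of the polyhedron, and comes back at an interior point of an interior face. -/
def Follows : Option (Side X) → Option (Side X) → Prop
  | some s, some t => M.IsSegment (M.flip s) t
  | some s, none => (M.flip s).Interior
  | none, some t => t.Interior
  | none, none => True

/-- An admissible disk in the truncated ideal polyhedron, recorded through its oriented boundary
`∂D`: the cyclic sequence of the edges that `∂D` crosses and of the arcs of `∂D` that run through
the interior of the polyhedron.  The curve may be merely immersed: edges and faces may be visited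
repeatedly. -/
structure AdmDisk where
  k : ℕ
  step : Fin (k + 1) → Option (Side X)
  follows : ∀ i, M.Follows (step i) (step (i + 1))

namespace AdmDisk

variable {M}
variable (D : M.AdmDisk)

/-- The number of interior edges crossed by `∂D`, with multiplicity. -/
def numEdges : ℕ :=
  (Finset.univ.filter fun i : Fin (D.k + 1) => ∃ x, D.step i = some (.edge x)).card

/-- The number of segments of `∂D` in boundary faces, i.e. of components of `∂D ∩ ∂M`; each is
entered exactly once. -/
def numBdry : ℕ :=
  (Finset.univ.filter fun i : Fin (D.k + 1) => ∃ x, D.step i = some (.corner x)).card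

/-- The number of components of `∂D \ ∂P`. -/
def numFree : ℕ :=
  (Finset.univ.filter fun i : Fin (D.k + 1) => D.step i = none).card

/-- The combinatorial area, for a right-angled polyhedron: every external dihedral angle
is `π / 2`. -/
def area : ℝ :=
  D.numEdges * (Real.pi / 2) + Real.pi * D.numBdry - 2 * Real.pi + 3 * Real.pi * D.numFree

/-- The length, relative to `D`, of any one of the boundary segments of `∂D`. -/
def relLength : ℝ := D.area / D.numBdry

/-- Suppose that `∂D` enters a boundary face at step `p`.  This is the other end of the segment of
`∂D` that leads there, as a side of its interior face (`none`: an interior point of the face). -/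
def before (p : Fin (D.k + 1)) : Option (Side X) := (D.step (p - 1)).map M.flip

/-- Suppose that `∂D` enters a boundary face at step `p`, and so leaves it at step `p + 1`.  This
is the other end of the segment of `∂D` that follows, as a side of its interior face
(`none`: an interior point of the face). -/
def after (p : Fin (D.k + 1)) : Option (Side X) := D.step (p + 1 + 1)

end AdmDisk

end CombMap

/-! ## Link diagrams -/

/-- A link diagram on the sphere: a connected 4-valent graph with over-under information.
`isOver d` says that the strand through the dart `d` is the upper one at its crossing. -/
structure LinkDiagram (D : Type*) extends CombMap D where
  four : ∀ d, σ (σ (σ (σ d))) = d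
  two_ne : ∀ d, σ (σ d) ≠ d
  connected : toCombMap.Connected
  spherical : toCombMap.Spherical
  isOver : D → Prop
  over_next : ∀ d, isOver (σ d) ↔ ¬ isOver d

namespace LinkDiagram

variable {D : Type*} (L : LinkDiagram D)

/-- The face to the left of `d` is a bigon. -/
def IsBigon (d : D) : Prop := L.φ (L.φ d) = d ∧ L.φ d ≠ d

/-- The edge of `d` is not on the boundary of any bigon. -/
def External (d : D) : Prop := ¬ L.IsBigon d ∧ ¬ L.IsBigon (L.α d)

/-- The diagram is prime.  A simple closed curve that meets the graph transversely in two points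
crosses the edges of two darts `d` and `d'` that have the same face on their left and the same face
on their right.  If these edges are distinct, there are crossings on both sides of the curve;
if they coincide, one side contains only a piece of that edge. -/
def IsPrime : Prop :=
  ∀ d d', L.SameFace d d' → L.SameFace (L.α d) (L.α d') → d = d'

/-- Pass from the bigon at the corner `d` through the crossing at its other end, to the opposite
corner there. -/
def nextInRow (d : D) : D := L.σ (L.σ (L.φ d))

/-- The corner `d` starts a row of bigons arranged end to end that leads to the crossing
of `d'`. -/
def BigonRow (d d' : D) : Prop :=
  ∃ k : ℕ, (∀ i ≤ k, L.IsBigon (L.nextInRow^[i] d)) ∧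
    L.SameVertex (L.φ (L.nextInRow^[k] d)) d'

/-- The diagram is twist-reduced.  A simple closed curve that crosses the edges of `d` and `σ d`
next to one crossing, and the edges of `d'` and `σ d'` next to another one, exists when the faces
between these two pairs of points agree; then the two crossings are joined by a row of bigons,
which starts at the corner `d` or at the opposite corner.  (Replacing `d'` by `σ (σ d')` gives the
curves that pass the two crossings on different sides.) -/
def IsTwistReduced : Prop :=
  ∀ d d', ¬ L.SameVertex d d' →
    L.SameFace (L.σ⁻¹ d) (L.σ d') → L.SameFace (L.σ d) (L.σ⁻¹ d') →
    L.BigonRow d d' ∨ L.BigonRow (L.σ (L.σ d)) d'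

/-- The crossings of `d` and `d'` are in the same twist region: they are connected through
bigons. -/
def SameRegion : D → D → Prop :=
  Relation.EqvGen fun u v => v = L.σ u ∨ (L.IsBigon u ∧ v = L.α u)

/-- There are at least two twist regions. -/
def TwoRegions : Prop := ∃ d d', ¬ L.SameRegion d d'

/-- The number of crossings in the twist region of `d`. -/
def crossings (d : D) : ℕ :=
  Set.ncard ((Quotient.mk (Equiv.Perm.SameCycle.setoid L.σ)) '' {d' | L.SameRegion d d'})

/-- Follow a component of the link: along the edge of `d`, then straight through the crossing. -/
def walk : Equiv.Perm D := L.σ * L.σ * L.α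

/-- The number of twist regions visited, with multiplicity, by the component of the link through
the edge of `d`.  In one turn around the component, every visit ends with its leaving the twist
region along an edge that is on no bigon, and it passes each of its edges once. -/
def visits (d : D) : ℕ := Set.ncard {d' | L.walk.SameCycle d d' ∧ L.External d'}

/-- The direction of every twist region: `ends` is the set of the corners that face the two ends
of the twist region.  At each crossing these are two opposite corners, and they contain all bigons,
so there is a choice only at a crossing adjacent to no bigons.  The crossing circle passes through
the faces at the two other corners, and encircles the two strands that leave through one end. -/
structure Direction where
  ends : Set D
  ends_next : ∀ d, L.σ d ∈ ends ↔ d ∉ ends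
  bigon_mem : ∀ d, L.IsBigon d → d ∈ ends

theorem bigon_face {d : D} (h : L.IsBigon d) : L.IsBigon (L.φ d) :=
  ⟨by rw [h.1], by rw [h.1]; exact h.2.symm⟩

theorem α_eq (d : D) : L.α d = L.σ (L.φ d) := by
  simp [CombMap.φ]

/-- Cross a bigon to the opposite corner of the bigon; other corners are fixed. -/
def crossBigon : Equiv.Perm D :=
  Function.Involutive.toPerm (fun d => if L.IsBigon d then L.φ d else d) (by
    intro d
    by_cases h : L.IsBigon d
    · have h' := L.bigon_face h
      simp [h, h', h.1]
    · simp [h])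

end LinkDiagram

/-! ## First return maps -/

/-- The first point after `c` of the `g`-orbit of `c` at which `S` holds. -/
def firstReturn {X : Type*} [Finite X] (g : Equiv.Perm X) (S : X → Prop) (c : {c // S c}) :
    {c // S c} :=
  have h : ∃ k, 0 < k ∧ S ((g ^ k) c.1) :=
    ⟨orderOf g, orderOf_pos g, by rw [pow_orderOf_eq_one]; exact c.2⟩
  ⟨(g ^ Nat.find h) c.1, (Nat.find_spec h).2⟩

theorem firstReturn_spec {X : Type*} [Finite X] (g : Equiv.Perm X) (S : X → Prop)
    (c : {c // S c}) : ∃ k, 0 < k ∧ (firstReturn g S c).1 = (g ^ k) c.1 ∧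
      ∀ j, 0 < j → j < k → ¬ S ((g ^ j) c.1) := by
  have h : ∃ k, 0 < k ∧ S ((g ^ k) c.1) :=
    ⟨orderOf g, orderOf_pos g, by rw [pow_orderOf_eq_one]; exact c.2⟩
  exact ⟨Nat.find h, (Nat.find_spec h).1, rfl, fun j hj hlt hS => Nat.find_min h hlt ⟨hj, hS⟩⟩

theorem firstReturn_injective {X : Type*} [Finite X] (g : Equiv.Perm X) (S : X → Prop) :
    Function.Injective (firstReturn g S) := by
  have key : ∀ (a b : {c // S c}) (k l : ℕ), k ≤ l → 0 < k → (g ^ k) a.1 = (g ^ l) b.1 →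
      (∀ j, 0 < j → j < l → ¬ S ((g ^ j) b.1)) → a = b := by
    intro a b k l hkl hk he hmin
    obtain ⟨m, rfl⟩ := Nat.exists_eq_add_of_le hkl
    have h1 : a.1 = (g ^ m) b.1 := by
      apply (g ^ k).injective
      rw [he, pow_add]; rfl
    rcases Nat.eq_zero_or_pos m with h0 | h0
    · subst h0; exact Subtype.ext (by simpa using h1)
    · exact absurd (h1 ▸ a.2) (hmin m h0 (by omega))
  intro a b hab
  obtain ⟨k, hk, hka, hkm⟩ := firstReturn_spec g S a
  obtain ⟨l, hl, hlb, hlm⟩ := firstReturn_spec g S b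
  have he : (g ^ k) a.1 = (g ^ l) b.1 := by rw [← hka, ← hlb, hab]
  rcases le_total k l with h | h
  · exact key a b k l h hk he hlm
  · exact (key b a l k h hl he.symm hkm).symm

/-! ## The polyhedron of the augmented link -/

/-- The three ideal vertices of a shaded triangle: the crossing circle and two strands. -/
inductive Pos
  | circ
  | fst
  | snd

/-- Counterclockwise rotation of a shaded triangle. -/
def Pos.next : Pos → Pos
  | .circ => .fst
  | .fst => .snd
  | .snd => .circ

/-- Clockwise rotation of a shaded triangle. -/
def Pos.prev : Pos → Pos
  | .circ => .snd
  | .fst => .circ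
  | .snd => .fst

/-- The reflection of a shaded triangle that fixes the crossing circle. -/
def Pos.mirror : Pos → Pos
  | .circ => .circ
  | .fst => .snd
  | .snd => .fst

namespace LinkDiagram

namespace Direction

variable {D : Type*} {L : LinkDiagram D} (A : L.Direction)

/-- The outer end of a twist region, at the corner `c`. -/
def IsTip (c : D) : Prop := c ∈ A.ends ∧ ¬ L.IsBigon c

/-- The outer ends of the twist regions, two for each of them.  They index the shaded triangles:
the half of the crossing disk above the projection plane gives one shaded triangle for each of its
two sides, one facing each end of the twist region. -/
abbrev Tip : Type _ := {c : D // A.IsTip c}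

/-- The corners of the shaded triangles. -/
abbrev Shaded : Type _ := A.Tip × Pos

/-- The other end of the same twist region: walk along the row of bigons. -/
def otherTip [Finite D] : Equiv.Perm A.Tip :=
  Equiv.ofBijective (firstReturn (L.σ * L.σ * L.crossBigon) A.IsTip)
    (Finite.injective_iff_bijective.mp (firstReturn_injective _ _))

/-- The dart on which a strand vertex of a shaded triangle lies (junk at crossing circles). -/
def dartOf : A.Shaded → D
  | (c, .circ) => c.1
  | (c, .fst) => c.1
  | (c, .snd) => L.σ c.1

theorem not_bigon_of_not_mem {d : D} (h : d ∉ A.ends) : ¬ L.IsBigon d :=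
  fun hb => h (A.bigon_mem d hb)

theorem bigon_prev_iff (d : D) : L.IsBigon (L.σ⁻¹ d) ↔ L.IsBigon (L.α d) := by
  have h : L.φ (L.α d) = L.σ⁻¹ d := by
    simp [CombMap.φ, L.α_invol]
  constructor
  · intro hb
    rw [← h] at hb
    have h1 := hb.1
    have h2 : L.φ (L.φ (L.α d)) = L.α d := L.φ.injective h1
    refine ⟨h2, fun h3 => hb.2 ?_⟩
    rw [h3, h3]
  · intro hb
    rw [← h]
    exact L.bigon_face hb

theorem external_dartOf (q : A.Shaded) : L.External (A.dartOf q) := by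
  obtain ⟨⟨c, hc⟩, p⟩ := q
  have hfst : L.External c := by
    refine ⟨hc.2, fun hb => ?_⟩
    have h1 := A.bigon_mem _ ((bigon_prev_iff c).mpr hb)
    have h2 := (A.ends_next (L.σ⁻¹ c)).mp (by simpa using hc.1)
    exact h2 h1
  cases p
  · exact hfst
  · exact hfst
  · refine ⟨fun hb => ?_, fun hb => ?_⟩
    · exact (A.ends_next c).mp (A.bigon_mem _ hb) hc.1
    · have h1 := (bigon_prev_iff (L.σ c)).mpr hb
      exact hc.2 (by simpa using h1)

/-- The strand vertex of a shaded triangle that lies on an external dart. -/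
def locate (d : D) (hd : L.External d) : A.Shaded :=
  if h : d ∈ A.ends then (⟨d, h, hd.1⟩, .fst)
  else (⟨L.σ⁻¹ d, by
    constructor
    · by_contra h'
      exact h (by simpa using (A.ends_next (L.σ⁻¹ d)).mpr h')
    · exact fun hb => hd.2 ((bigon_prev_iff d).mp hb)⟩, .snd)

theorem external_α {d : D} (h : L.External d) : L.External (L.α d) :=
  ⟨h.2, by rw [L.α_invol]; exact h.1⟩

theorem dartOf_locate (d : D) (hd : L.External d) : A.dartOf (A.locate d hd) = d := by
  unfold locate
  split_ifs <;> simp [dartOf]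

theorem locate_ne_circ (d : D) (hd : L.External d) : (A.locate d hd).2 ≠ .circ := by
  unfold locate
  split_ifs <;> simp

/-- The shaded corner on the other side of the same ideal vertex: at a crossing circle, the
corner of the triangle at the other end of the twist region; at a strand, the corner at the other
end of the same edge of the diagram. -/
def oppositeFun [Finite D] : A.Shaded → A.Shaded
  | (c, .circ) => (A.otherTip c, .circ)
  | (c, .fst) => A.locate (L.α c.1) (external_α (A.external_dartOf (c, .fst)))
  | (c, .snd) => A.locate (L.α (L.σ c.1)) (external_α (A.external_dartOf (c, .snd)))

theorem oppositeFun_injective [Finite D] : Function.Injective A.oppositeFun := by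
  have hloc : ∀ d d' hd hd', A.locate (L.α d) hd = A.locate (L.α d') hd' → d = d' := by
    intro d d' hd hd' h
    have := congrArg A.dartOf h
    rw [dartOf_locate, dartOf_locate] at this
    exact L.α.injective this
  rintro ⟨c, p⟩ ⟨c', p'⟩ h
  cases p <;> cases p' <;> simp only [oppositeFun] at h
  · have := (Prod.ext_iff.mp h).1
    rw [A.otherTip.injective this]
  · exact absurd (congrArg Prod.snd h).symm (A.locate_ne_circ _ _)
  · exact absurd (congrArg Prod.snd h).symm (A.locate_ne_circ _ _)
  · exact absurd (congrArg Prod.snd h) (A.locate_ne_circ _ _)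
  · rw [Subtype.ext (hloc _ _ _ _ h)]
  · have h1 := hloc _ _ _ _ h
    exact absurd c'.2.1 ((A.ends_next c'.1).mp (h1 ▸ c.2.1))
  · exact absurd (congrArg Prod.snd h) (A.locate_ne_circ _ _)
  · have h1 := hloc _ _ _ _ h
    exact absurd c.2.1 ((A.ends_next c.1).mp (h1 ▸ c'.2.1))
  · rw [Subtype.ext (L.σ.injective (hloc _ _ _ _ h))]

/-- `oppositeFun` as a permutation. -/
def opposite [Finite D] : Equiv.Perm A.Shaded :=
  haveI : Finite Pos :=
    Finite.of_injective (β := Fin 3)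
      (fun p => match p with | .circ => 0 | .fst => 1 | .snd => 2)
      (by intro a b; cases a <;> cases b <;> simp)
  Equiv.ofBijective A.oppositeFun
    (Finite.injective_iff_bijective.mp A.oppositeFun_injective)

/-- The darts of the polyhedron.  At its ideal vertex, the corner `q` of a shaded triangle lies
between the darts `(q, false)` and `(q, true)`, in counterclockwise order.  So the corner
`(q, false)` of the polyhedron is the shaded corner `q`, and the corner `(q, true)` is the white
corner that comes next at this ideal vertex. -/
abbrev Dart : Type _ := A.Shaded × Bool

/-- The ideal polyhedron `P₁` above the projection plane (`P₂` is its mirror image).  Its shaded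
faces are triangles.  Every edge is a side of exactly one of them; the dart `(q, false)` runs along
the side from the corner `q` to the next corner of the triangle.  Around an ideal vertex, shaded
and white corners alternate. -/
def poly [Finite D] : CombMap A.Dart where
  σ :=
    { toFun := fun x => match x with
        | (q, false) => (q, true)
        | (q, true) => (A.opposite q, false)
      invFun := fun x => match x with
        | (q, true) => (q, false)
        | (q, false) => (A.opposite.symm q, true)
      left_inv := by rintro ⟨q, _ | _⟩ <;> simp
      right_inv := by rintro ⟨q, _ | _⟩ <;> simp }
  α :=
    Function.Involutive.toPerm
      (fun x => match x with
        | ((c, p), false) => ((c, p.next), true)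
        | ((c, p), true) => ((c, p.prev), false))
      (by rintro ⟨⟨c, _ | _ | _⟩, _ | _⟩ <;> rfl)
  α_invol := by rintro ⟨⟨c, _ | _ | _⟩, _ | _⟩ <;> rfl
  α_ne := by rintro ⟨⟨c, _ | _ | _⟩, _ | _⟩ <;> simp [Function.Involutive.toPerm]

/-! ## Gluing the two polyhedra to the exterior of the augmented link

The levels `true` and `false` stand for `P₁` and `P₂`; both use the labels of `P₁`. -/

/-- In `J` there is a half-twist (a single crossing) at the crossing circle. -/
def HalfTwist (c : A.Tip) : Prop := Odd (L.crossings c.1)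

/-- The gluing of the sides of interior faces, as far as the labels are concerned.  White faces are
glued by the identity.  The shaded triangle at one end of a twist region is glued to the one at the
other end, matching the crossing circles: without a half-twist by the reflection that joins the
strands running along the same side of the twist region, with a half-twist by the rotation that
joins strands at opposite corners of the twist region. -/
def glueSide [Finite D] : Side A.Dart → Side A.Dart
  | .edge ((c, p), false) =>
      if A.HalfTwist c then .edge ((A.otherTip c, p), false)
      else .edge ((A.otherTip c, p.next.mirror), false)
  | .corner ((c, p), false) =>
      if A.HalfTwist c then .corner ((A.otherTip c, p), false)
      else .corner ((A.otherTip c, p.mirror), false)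
  | .bdry ((c, p), false) =>
      if A.HalfTwist c then .bdry ((A.otherTip c, p), false)
      else .bdry ((A.otherTip c, p.mirror), false)
  | s => s

/-- The gluing of the boundary edges of the truncated polyhedra, with their levels.  White faces of
one polyhedron are glued to white faces of the other one; shaded faces are glued within one
polyhedron, except at half-twists. -/
def glue [Finite D] : A.Dart × Bool → A.Dart × Bool
  | (((c, p), false), l) =>
      if A.HalfTwist c then (((A.otherTip c, p), false), !l)
      else (((A.otherTip c, p.mirror), false), l)
  | ((q, true), l) => ((q, true), !l)

/-- The edges `x` and `y` of boundary faces (with their levels) lie on the same boundary torus of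
the exterior of `J`. -/
def SameTorus [Finite D] : A.Dart × Bool → A.Dart × Bool → Prop :=
  Relation.EqvGen fun x y => y = (A.poly.σ x.1, x.2) ∨ y = A.glue x

/-! ## Curves on the boundary tori -/

/-- A segment in a boundary face: it runs in the polyhedron `level` from the boundary edge that
truncates the corner `enter` to the one that truncates the corner `exit`. -/
structure Seg where
  level : Bool
  enter : A.Dart
  exit : A.Dart

/-- A cyclic sequence of segments in boundary faces. -/
structure Curve where
  m : ℕ
  seg : Fin (m + 1) → A.Seg

/-- The segments fit together to a closed simplicial curve. -/
def IsSimplicial [Finite D] (γ : A.Curve) : Prop :=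
  ∀ i, A.poly.IsSegment (.bdry (γ.seg i).enter) (.bdry (γ.seg i).exit) ∧
    A.glue ((γ.seg i).exit, (γ.seg i).level)
      = ((γ.seg (i + 1)).enter, (γ.seg (i + 1)).level)

/-- The curve lies on the boundary torus that contains the boundary face edge `z`. -/
def OnTorus [Finite D] (z : A.Dart × Bool) (γ : A.Curve) : Prop :=
  ∀ i, A.SameTorus z ((γ.seg i).enter, (γ.seg i).level)

/-- The change of direction along a segment, in quarter turns to the left.  The four sides of a
boundary rectangle of `P₁` are in counterclockwise order, those of `P₂` in clockwise order. -/
def turn [Finite D] (g : A.Seg) : ZMod 4 :=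
  (if g.exit = A.poly.σ g.enter then -1 else if g.exit = A.poly.σ⁻¹ g.enter then 1 else 0) *
    (if g.level then 1 else -1)

/-- The unit steps of the square lattice with basis `𝐬 = (1, 0)`, `𝐰 = (0, 1)`, in the directions
`𝐰`, `𝐬`, `-𝐰`, `-𝐬`. -/
def unitStep (e : ZMod 4) : ℤ × ℤ :=
  if e = 0 then (0, 1) else if e = 1 then (1, 0) else if e = 2 then (0, -1) else (-1, 0)

/-- The direction in which the lift of the curve to the universal cover enters its first
rectangle: `𝐰` if it crosses an edge on a shaded face, `𝐬` if it crosses an edge on a white face. -/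
def startDir (γ : A.Curve) : ZMod 4 := if (γ.seg 0).enter.2 then 1 else 0

/-- The translation `(a, b) = a 𝐬 + b 𝐰` of the universal cover of the torus that belongs to the
closed curve, where `𝐬` is a step parallel to a shaded face (from one white face to the next) and
`𝐰` is a step parallel to a white face.  The lift of the curve runs through a square lattice, and
each time it leaves a rectangle it takes a unit step.  (As the directions of `𝐬` and `𝐰` are
fixed by the beginning of the curve, `(a, b)` depends on the free homotopy class only up to a
common sign.) -/
def disp [Finite D] (γ : A.Curve) : ℤ × ℤ :=
  ∑ i, unitStep (A.startDir γ + ∑ j ∈ Finset.univ.filter (· ≤ i), A.turn (γ.seg j))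

/-- The fundamental group of a boundary torus, as a group of translations `a 𝐬 + b 𝐰` of its
universal cover. -/
def lattice [Finite D] (z : A.Dart × Bool) : Set (ℤ × ℤ) :=
  {x | ∃ γ, A.IsSimplicial γ ∧ A.OnTorus z γ ∧ (A.disp γ = x ∨ A.disp γ = -x)}

/-- A slope on a boundary torus: a primitive element of the fundamental group (up to sign). -/
def IsSlope [Finite D] (z : A.Dart × Bool) (x : ℤ × ℤ) : Prop :=
  x ∈ A.lattice z ∧ x ≠ 0 ∧ ∀ y ∈ A.lattice z, ∀ k : ℤ, x = k • y → k = 1 ∨ k = -1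

/-! ## Combinatorial length -/

/-- An inward extension of a closed simplicial curve: for every segment of the curve an admissible
disk whose boundary contains the segment (entering the boundary face at step `pos i`), such that
the boundaries of consecutive disks agree on the shared face. -/
structure InwardExtension [Finite D] (γ : A.Curve) where
  disk : Fin (γ.m + 1) → A.poly.AdmDisk
  pos : ∀ i, Fin ((disk i).k + 1)
  enter : ∀ i, (disk i).step (pos i) = some (.corner (γ.seg i).enter)
  exit : ∀ i, (disk i).step (pos i + 1) = some (.bdry (γ.seg i).exit)
  agree : ∀ i, (disk (i + 1)).before (pos (i + 1))
    = ((disk i).after (pos i)).map A.glueSide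

/-- The combinatorial length of a closed simplicial curve. -/
def curveLength [Finite D] (γ : A.Curve) : ℝ :=
  sInf {r | ∃ H : A.InwardExtension γ, r = ∑ i, (H.disk i).relLength}

/-- The combinatorial length of a slope: the infimum over all closed simplicial curves that
represent non-zero multiples of the slope. -/
def slopeLength [Finite D] (z : A.Dart × Bool) (x : ℤ × ℤ) : ℝ :=
  sInf {r | ∃ γ, A.IsSimplicial γ ∧ A.OnTorus z γ ∧
    (∃ k : ℤ, k ≠ 0 ∧ A.disp γ = k • x) ∧ r = A.curveLength γ}

/-! ## Meridians, longitudes and surgery slopes -/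

/-- A place on the torus around the strand of the link that contains the external dart `d`. -/
def strandTorus (d : D) (hd : L.External d) : A.Dart × Bool := ((A.locate d hd, true), true)

/-- The meridian of this strand: it crosses the boundary face of `P₁` at the edge of `d` from one
white face to the other one, and comes back through `P₂`. -/
def strandMeridian [Finite D] (d : D) (hd : L.External d) : A.Curve where
  m := 1
  seg := ![⟨true, (A.locate d hd, true), (A.opposite (A.locate d hd), true)⟩,
    ⟨false, (A.opposite (A.locate d hd), true), (A.locate d hd, true)⟩]

/-- A non-trivial surgery slope on this torus: any slope other than the meridian. -/
def IsNontrivialSlope [Finite D] (d : D) (hd : L.External d) (x : ℤ × ℤ) : Prop :=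
  A.IsSlope (A.strandTorus d hd) x ∧
    x ≠ A.disp (A.strandMeridian d hd) ∧ x ≠ -A.disp (A.strandMeridian d hd)

/-- A place on the torus of the crossing circle around the twist region with the end `c`. -/
def circleTorus (c : A.Tip) : A.Dart × Bool := (((c, .circ), true), true)

/-- The longitude of the crossing circle: once along the circle, through `P₁` and `P₂`. -/
def circleLongitude [Finite D] (c : A.Tip) : A.Curve where
  m := 1
  seg := ![⟨true, ((c, .circ), true), ((A.otherTip c, .circ), true)⟩,
    ⟨false, ((A.otherTip c, .circ), true), ((c, .circ), true)⟩]

/-- The signed number of crossings of `J` at the crossing circle: `0` without a half-twist, and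
otherwise `1` or `-1` according to the direction of the twist.  (Draw the twist region horizontally
with `c` at its left end, so that the dart `c` points to the upper left.  The sign is `-1` if the
strand that runs to the upper left is the upper one at its crossing.) -/
def residue (c : A.Tip) : ℤ :=
  if A.HalfTwist c then (if L.isOver c.1 then -1 else 1) else 0

/-- The meridian of the crossing circle in `J`.  It passes once through the crossing disk.  With a
half-twist, passing through the crossing disk changes between `P₁` and `P₂`, and the loop closes up
after running along half of the crossing circle, in the direction given by the twist. -/
def circleMeridian [Finite D] (c : A.Tip) : A.Curve :=
  if A.HalfTwist c then
    if L.isOver c.1 then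
      { m := 1
        seg := ![⟨false, ((A.otherTip c, .circ), false), ((c, .circ), true)⟩,
          ⟨true, ((c, .circ), true), ((c, .circ), false)⟩] }
    else
      { m := 1
        seg := ![⟨false, ((A.otherTip c, .circ), false), ((A.otherTip c, .circ), true)⟩,
          ⟨true, ((A.otherTip c, .circ), true), ((c, .circ), false)⟩] }
  else
    { m := 0
      seg := ![⟨true, ((A.otherTip c, .circ), false), ((c, .circ), false)⟩] }

/-- The surgery slope `1 / q` on the crossing circle: one meridian and `q` longitudes. -/
def circleSlope [Finite D] (c : A.Tip) (q : ℤ) : ℤ × ℤ :=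
  A.disp (A.circleMeridian c) + q • A.disp (A.circleLongitude c)

/-- The number of crossings in the twist region after surgery along the slope `1 / q` on the
crossing circle, which inserts `q` full twists, i.e. `2 q` signed crossings. -/
def crossingsAfter (c : A.Tip) (q : ℤ) : ℕ := (A.residue c + 2 * q).natAbs

/-- Some surgery slope `1 / q` restores the number of crossings of the diagram. -/
theorem exists_crossingsAfter (c : A.Tip) : ∃ q, A.crossingsAfter c q = L.crossings c.1 := by
  unfold crossingsAfter residue HalfTwist
  rcases Nat.even_or_odd' (L.crossings c.1) with ⟨k, hk | hk⟩
  · refine ⟨k, ?_⟩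
    rw [hk, if_neg (Nat.not_odd_iff_even.mpr (even_two_mul k))]
    omega
  · by_cases ho : L.isOver c.1
    · refine ⟨-k, ?_⟩
      rw [hk, if_pos ⟨k, rfl⟩, if_pos ho]
      omega
    · refine ⟨k, ?_⟩
      rw [hk, if_pos ⟨k, rfl⟩, if_neg ho]
      omega

end Direction

end LinkDiagram

end AugLink

end

/-!
An admissible disk is an ideal digon, of relative length `0`, an ideal triangle, of relative length
`π / 3`, or it has relative length at least `π / 2`. Given an inward extension of a closed curve,
mark on every side of a rectangle that the curve crosses the end towards which the disk heads
through the adjacent face, or the midpoint. Consecutive disks agree on the shared face, so the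
marked points fit together to a path homotopic to the curve. Across its rectangle, a disk moves the
marked point by at most one rectangle in each direction; an ideal digon does not move it, and an
ideal triangle moves it by some `(u, v)` with `2 |u| + |v| ≤ 2`. Hence a curve of displacement
`(a, b)` has length at least `|a| π / 3 + |b| π / 6` and at least `|b| π / 3`.

On a crossing circle the surgery slope is `(r + 2 q, 1)`, so the first bound exceeds `n π / 3`. On a
strand of the link, every crossing of a shaded triangle leads to the next edge of the diagram that
is on no bigon. So a closed curve that is not homotopic to a multiple of the meridian goes around
the whole component: `|b| ≥ n`, and the second bound applies.
-/

noncomputable section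

namespace AugLink

theorem mk_sameCycle_apply {X : Type*} (π : Equiv.Perm X) (x : X) :
    Quotient.mk (Equiv.Perm.SameCycle.setoid π) (π x) = Quotient.mk _ x :=
  Quotient.sound (Equiv.Perm.sameCycle_apply_left.mpr (Equiv.Perm.SameCycle.refl _ _))

theorem eq_of_sameCycle {X β : Type*} {π : Equiv.Perm X} {f : X → β} (hf : ∀ x, f (π x) = f x)
    {x y : X} (h : π.SameCycle x y) : f x = f y := by
  have hinv : ∀ z, f (π⁻¹ z) = f z := fun z => by simpa using (hf (π⁻¹ z)).symm
  obtain ⟨k, rfl⟩ := h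
  induction k using Int.induction_on with
  | zero => rfl
  | succ n ih => rwa [add_comm, zpow_add, zpow_one, Equiv.Perm.mul_apply, hf]
  | pred n ih => rwa [sub_eq_add_neg, add_comm, zpow_add, zpow_neg_one, Equiv.Perm.mul_apply, hinv]

theorem firstReturn_eq {X : Type*} [Finite X] (g : Equiv.Perm X) (S : X → Prop) (c : {c // S c})
    {k : ℕ} (hk : 0 < k) (hS : S ((g ^ k) c.1)) (hlt : ∀ j, 0 < j → j < k → ¬ S ((g ^ j) c.1)) :
    (firstReturn g S c).1 = (g ^ k) c.1 := by
  obtain ⟨l, hl, he, hmin⟩ := firstReturn_spec g S c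
  obtain rfl : l = k := by
    rcases lt_trichotomy l k with h | h | h
    · exact absurd (he ▸ (firstReturn g S c).2) (hlt l hl h)
    · exact h
    · exact absurd hS (hmin k hk h)
  exact he

namespace CombMap

variable {X : Type*} (M : CombMap X)

theorem φ_α (x : X) : M.φ (M.α x) = M.σ⁻¹ x := by
  simp [CombMap.φ, M.α_invol]

theorem α_σ_eq_of_φ_φ {x : X} (h : M.φ (M.φ x) = x) : M.α (M.σ x) = M.φ x := by
  rw [← M.φ.injective.eq_iff, M.φ_α, h, Equiv.Perm.inv_def, Equiv.symm_apply_apply]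

theorem eq_or_eq_α_of_sameCycle {x y : X} (h : M.α.SameCycle x y) : y = x ∨ y = M.α x := by
  have hf : ∀ z, ({M.α z, M.α (M.α z)} : Set X) = {z, M.α z} := fun z => by
    rw [M.α_invol, Set.pair_comm]
  have hy : y ∈ ({y, M.α y} : Set X) := Set.mem_insert _ _
  rwa [← eq_of_sameCycle (f := fun z => ({z, M.α z} : Set X)) hf h] at hy

theorem Connected.eq_of_invariant {M : CombMap X} (h : M.Connected) {β : Type*} {f : X → β}
    (hσ : ∀ x, f (M.σ x) = f x) (hα : ∀ x, f (M.α x) = f x) (x y : X) : f x = f y := by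
  induction h x y with
  | rel x y h => rcases h with rfl | rfl <;> simp only [hσ, hα]
  | refl x => rfl
  | symm x y _ ih => exact ih.symm
  | trans x y z _ _ ih₁ ih₂ => exact ih₁.trans ih₂

/-- The vertex that a dart leaves. -/
def vertex (x : X) : M.Vertex := Quotient.mk _ x

/-- The edge that carries a dart. -/
def edge (x : X) : M.Edge := Quotient.mk _ x

/-- The face to the left of a dart. -/
def face (x : X) : M.Face := Quotient.mk _ x

theorem vertex_eq_of_sameVertex {x y : X} (h : M.SameVertex x y) : M.vertex x = M.vertex y :=
  Quotient.sound h

theorem vertex_σ (x : X) : M.vertex (M.σ x) = M.vertex x := mk_sameCycle_apply _ _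

theorem edge_α (x : X) : M.edge (M.α x) = M.edge x := mk_sameCycle_apply _ _

theorem face_eq_iff {x y : X} : M.face x = M.face y ↔ M.SameFace x y :=
  Quotient.eq (r := Equiv.Perm.SameCycle.setoid M.φ)

theorem face_φ (x : X) : M.face (M.φ x) = M.face x := mk_sameCycle_apply _ _

theorem face_α (x : X) : M.face (M.α x) = M.face (M.σ⁻¹ x) := by
  rw [← M.φ_α, face_φ]

theorem face_α_σ (x : X) : M.face (M.α (M.σ x)) = M.face x := by
  rw [face_α, Equiv.Perm.inv_def, Equiv.symm_apply_apply]

theorem edge_eq_iff {x y : X} : M.edge x = M.edge y ↔ x = y ∨ x = M.α y := by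
  constructor
  · exact fun h => M.eq_or_eq_α_of_sameCycle
      (Quotient.exact (s := Equiv.Perm.SameCycle.setoid M.α) h).symm
  · rintro (rfl | rfl)
    · rfl
    · exact M.edge_α y

/-! ### Checkerboard colourings -/

section Checkerboard

variable {V : Type*}

/-- The coboundary over `ℤ/2` of a function on the vertices or on the faces of the graph, which are
given by the map `p` that sends a dart to its vertex or to the face to its left: its value on an
edge is the sum of the two values at the ends, or on the two sides, of that edge. -/
def coboundary (p : X → V) : (V → ZMod 2) →ₗ[ZMod 2] (M.Edge → ZMod 2) where
  toFun f := Quotient.lift (fun x => f (p x) + f (p (M.α x))) fun x y hxy => by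
    rcases M.eq_or_eq_α_of_sameCycle hxy with rfl | rfl
    · rfl
    · rw [M.α_invol, add_comm]
  map_add' f g := by
    ext ⟨x⟩
    exact add_add_add_comm _ _ _ _
  map_smul' c f := by
    ext ⟨x⟩
    exact (mul_add _ _ _).symm

theorem coboundary_edge (p : X → V) (f : V → ZMod 2) (x : X) :
    M.coboundary p f (M.edge x) = f (p x) + f (p (M.α x)) := rfl

variable {M}

theorem Connected.finrank_ker_coboundary_le_one (hc : M.Connected) {p : X → V}
    (hp : Function.Surjective p)
    (hσ : ∀ f : V → ZMod 2, (∀ x, f (p (M.α x)) = f (p x)) → ∀ x, f (p (M.σ x)) = f (p x)) :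
    Module.finrank (ZMod 2) (LinearMap.ker (M.coboundary p)) ≤ 1 := by
  have hconst : ∀ f ∈ LinearMap.ker (M.coboundary p), ∀ x y, f (p x) = f (p y) := by
    intro f hf
    have hα : ∀ x, f (p (M.α x)) = f (p x) := fun x => by
      have hx := congrFun hf (M.edge x)
      rw [coboundary_edge] at hx
      exact (CharTwo.add_eq_zero.mp hx).symm
    exact hc.eq_of_invariant (f := f ∘ p) (hσ f hα) hα
  have hle : LinearMap.ker (M.coboundary p) ≤ Submodule.span (ZMod 2) {fun _ => 1} := by
    intro f hf
    rw [Submodule.mem_span_singleton]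
    rcases isEmpty_or_nonempty X with _ | ⟨⟨x₀⟩⟩
    · exact ⟨0, funext fun v => isEmptyElim (hp v).choose⟩
    · refine ⟨f (p x₀), funext fun v => ?_⟩
      obtain ⟨x, rfl⟩ := hp v
      simpa using hconst f hf x₀ x
  exact (Submodule.finrank_mono hle).trans
    (by simpa using finrank_span_le_card (R := ZMod 2) ({fun _ => 1} : Set (V → ZMod 2)))

theorem Connected.card_le_finrank_range_coboundary_add_one [Finite V] (hc : M.Connected)
    {p : X → V} (hp : Function.Surjective p)
    (hσ : ∀ f : V → ZMod 2, (∀ x, f (p (M.α x)) = f (p x)) → ∀ x, f (p (M.σ x)) = f (p x)) :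
    Nat.card V ≤ Module.finrank (ZMod 2) (LinearMap.range (M.coboundary p)) + 1 := by
  have := Fintype.ofFinite V
  have hrank := LinearMap.finrank_range_add_finrank_ker (M.coboundary p)
  rw [Module.finrank_fintype_fun_eq_card] at hrank
  have hker := hc.finrank_ker_coboundary_le_one hp hσ
  rw [Nat.card_eq_fintype_card]
  omega

variable (M)

theorem sum_edge_eq_sum_dart [Fintype X] [Fintype M.Edge] (f : X → ZMod 2) (g : M.Edge → ZMod 2)
    (h : ∀ x, g (M.edge x) = f x + f (M.α x)) : ∑ e, g e = ∑ x, f x := by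
  classical
  rw [← Finset.sum_fiberwise (s := Finset.univ) (g := M.edge)]
  refine Finset.sum_congr rfl fun e _ => ?_
  obtain ⟨x, rfl⟩ : ∃ x, M.edge x = e := Quotient.exists_rep e
  have hfiber : (Finset.univ.filter fun y : X => M.edge y = M.edge x) = {x, M.α x} := by
    ext y
    simp only [Finset.mem_filter, Finset.mem_univ, true_and, Finset.mem_insert,
      Finset.mem_singleton, edge_eq_iff]
  rw [hfiber, Finset.sum_pair (M.α_ne x).symm, h]

theorem coboundary_dotProduct [Fintype X] [Fintype M.Edge] (p : X → V) (f : V → ZMod 2)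
    (g : M.Edge → ZMod 2) :
    M.coboundary p f ⬝ᵥ g = ∑ x, f (p x) * g (M.edge x) :=
  M.sum_edge_eq_sum_dart (fun x => f (p x) * g (M.edge x)) _ fun x => by
    rw [coboundary_edge, edge_α, add_mul]

theorem coboundary_vertex_dotProduct_coboundary_face [Finite X] [Fintype M.Edge]
    (f : M.Vertex → ZMod 2) (g : M.Face → ZMod 2) :
    M.coboundary M.vertex f ⬝ᵥ M.coboundary M.face g = 0 := by
  have := Fintype.ofFinite X
  rw [coboundary_dotProduct]
  have hshift : ∑ x, f (M.vertex x) * g (M.face (M.α x)) = ∑ x, f (M.vertex x) * g (M.face x) := by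
    rw [← Equiv.sum_comp M.σ]
    simp only [vertex_σ, face_α_σ]
  simp only [coboundary_edge, mul_add, Finset.sum_add_distrib, hshift]
  exact CharTwo.add_self_eq_zero _

variable {M}

-- The coboundaries of the vertices span the cut space and those of the faces lie in its orthogonal
-- complement, the cycle space; by Euler's formula the dimensions agree.
theorem Spherical.mem_range_coboundary_face [Finite X] [Fintype M.Edge] (hs : M.Spherical)
    (hc : M.Connected) {g : M.Edge → ZMod 2}
    (hg : ∀ f, M.coboundary M.vertex f ⬝ᵥ g = 0) :
    g ∈ LinearMap.range (M.coboundary M.face) := by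
  let B : LinearMap.BilinForm (ZMod 2) (M.Edge → ZMod 2) := dotProductBilin (ZMod 2) (ZMod 2)
  have hB : B.Nondegenerate :=
    ⟨fun v hv => dotProduct_eq_zero_iff.mp hv,
      fun v hv => dotProduct_eq_zero_iff.mp fun w => dotProduct_comm v w ▸ hv w⟩
  have hle : LinearMap.range (M.coboundary M.face)
      ≤ B.orthogonal (LinearMap.range (M.coboundary M.vertex)) := by
    rintro _ ⟨f, rfl⟩ _ ⟨h, rfl⟩
    exact M.coboundary_vertex_dotProduct_coboundary_face h f
  have hvertex := hc.card_le_finrank_range_coboundary_add_one (p := M.vertex)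
    Quotient.mk_surjective fun f _ x => congrArg f (M.vertex_σ x)
  have hface := hc.card_le_finrank_range_coboundary_add_one (p := M.face)
    Quotient.mk_surjective fun f hf x => by rw [← hf, face_α_σ]
  have hrank := LinearMap.BilinForm.finrank_orthogonal hB
    (LinearMap.range (M.coboundary M.vertex))
  rw [Module.finrank_fintype_fun_eq_card] at hrank
  have heuler : Nat.card M.Vertex + Nat.card M.Face = Nat.card M.Edge + 2 := hs
  rw [Nat.card_eq_fintype_card (α := M.Edge)] at heuler
  rw [Submodule.eq_of_le_of_finrank_le hle (by omega)]
  rintro _ ⟨f, rfl⟩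
  exact hg f

/-- A checkerboard colouring of the faces: the two sides of every edge have different colours. -/
def IsCheckerboard (M : CombMap X) (ε : M.Face → ZMod 2) : Prop :=
  ∀ x, ε (M.face x) + ε (M.face (M.α x)) = 1

-- The all-one cochain is orthogonal to the coboundary of a vertex exactly if its degree is even;
-- the involution `ι` pairs the darts at each vertex.
theorem Spherical.exists_isCheckerboard [Finite X] (hs : M.Spherical) (hc : M.Connected)
    {ι : X → X} (hι : Function.Involutive ι) (hne : ∀ x, ι x ≠ x)
    (hv : ∀ x, M.SameVertex x (ι x)) : ∃ ε, M.IsCheckerboard ε := by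
  have := Fintype.ofFinite X
  have := Fintype.ofFinite M.Edge
  obtain ⟨ε, hε⟩ := hs.mem_range_coboundary_face hc (g := fun _ => 1) fun f => by
    rw [coboundary_dotProduct]
    refine Finset.sum_involution (fun x _ => ι x) (fun x _ => ?_) (fun x _ _ => hne x)
      (fun _ _ => Finset.mem_univ _) (fun x _ => hι x)
    rw [M.vertex_eq_of_sameVertex (hv x)]
    exact CharTwo.add_self_eq_zero _
  exact ⟨ε, fun x => congrFun hε (M.edge x)⟩

end Checkerboard

end CombMap

namespace LinkDiagram

variable {D : Type*} (L : LinkDiagram D)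

theorem σ_inv (d : D) : L.σ⁻¹ d = L.σ (L.σ (L.σ d)) := by
  rw [Equiv.Perm.inv_eq_iff_eq, L.four]

theorem σ_inv_σ (d : D) : L.σ⁻¹ (L.σ d) = d := L.σ.symm_apply_apply d

theorem sameVertex_σ (d : D) : L.SameVertex d (L.σ d) :=
  Equiv.Perm.sameCycle_apply_right.mpr (Equiv.Perm.SameCycle.refl _ _)

theorem sameVertex_σ_σ (d : D) : L.SameVertex d (L.σ (L.σ d)) :=
  (L.sameVertex_σ d).trans (L.sameVertex_σ _)

theorem sameVertex_σ_inv (d : D) : L.SameVertex d (L.σ⁻¹ d) :=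
  ⟨-1, zpow_neg_one L.σ ▸ rfl⟩

theorem sameVertex_cases {x y : D} (h : L.SameVertex x y) :
    y = x ∨ y = L.σ x ∨ y = L.σ (L.σ x) ∨ y = L.σ⁻¹ x := by
  have hrot : ∀ z, ({L.σ z, L.σ (L.σ z), L.σ (L.σ (L.σ z)), L.σ⁻¹ (L.σ z)} : Set D) =
      {z, L.σ z, L.σ (L.σ z), L.σ⁻¹ z} := fun z => by
    simp only [σ_inv, L.four]
    grind
  have hy : y ∈ ({y, L.σ y, L.σ (L.σ y), L.σ⁻¹ y} : Set D) := Set.mem_insert _ _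
  rwa [← eq_of_sameCycle (f := fun z => ({z, L.σ z, L.σ (L.σ z), L.σ⁻¹ z} : Set D)) hrot h] at hy

theorem sameRegion_of_sameVertex {x y : D} (h : L.SameVertex x y) : L.SameRegion x y := by
  have hσ : ∀ z, L.SameRegion x (L.σ z) = L.SameRegion x z := fun z => by
    have hz : L.SameRegion z (L.σ z) := .rel _ _ (.inl rfl)
    exact propext ⟨fun hx => hx.trans _ _ _ hz.symm, fun hx => hx.trans _ _ _ hz⟩
  exact eq_of_sameCycle hσ h ▸ .refl x

variable {L}

theorem TwoRegions.exists_not_sameVertex_α (ht : L.TwoRegions) (d : D) :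
    ∃ x, L.SameVertex d x ∧ ¬ L.SameVertex d (L.α x) := by
  by_contra! hα
  obtain ⟨a, b, hab⟩ := ht
  have hall : ∀ x, L.SameVertex d x := fun x =>
    L.connected.eq_of_invariant (f := L.SameVertex d)
      (fun y => propext Equiv.Perm.sameCycle_apply_right)
      (fun y => propext ⟨fun h => L.α_invol y ▸ hα _ h, hα y⟩) d x ▸ Equiv.Perm.SameCycle.refl _ _
  exact hab (L.sameRegion_of_sameVertex ((hall a).symm.trans (hall b)))

theorem IsPrime.eq_of_face_eq (hp : L.IsPrime) {d d' : D} (h : L.face d = L.face d')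
    (h' : L.face (L.α d) = L.face (L.α d')) : d = d' :=
  hp d d' (L.face_eq_iff.mp h) (L.face_eq_iff.mp h')

theorem IsPrime.face_ne_face_α (hp : L.IsPrime) (d : D) : L.face d ≠ L.face (L.α d) := fun h =>
  L.α_ne d (hp.eq_of_face_eq h (by rw [L.α_invol]; exact h.symm)).symm

-- If the faces agreed, primality would close up the four edges at the crossing pairwise into loops.
theorem IsPrime.face_σ_ne_face_σ_inv (hp : L.IsPrime) (ht : L.TwoRegions) (d : D) :
    L.face (L.σ d) ≠ L.face (L.σ⁻¹ d) := by
  intro h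
  have hloop : L.α (L.σ d) = d :=
    (hp.eq_of_face_eq (by rw [L.face_α_σ]) (by rw [L.α_invol, L.face_α, h])).symm
  have hloop' : L.α (L.σ⁻¹ d) = L.σ (L.σ d) := by
    rw [σ_inv]
    exact (hp.eq_of_face_eq (by rw [L.face_α_σ])
      (by rw [L.α_invol, L.face_α, σ_inv_σ, h, σ_inv])).symm
  obtain ⟨x, hx, hαx⟩ := ht.exists_not_sameVertex_α d
  refine hαx ?_
  rcases L.sameVertex_cases hx with rfl | rfl | rfl | rfl
  · exact (congrArg L.α hloop).symm.trans (L.α_invol _) ▸ L.sameVertex_σ _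
  · rw [hloop]; exact Equiv.Perm.SameCycle.refl _ _
  · rw [← hloop', L.α_invol]; exact L.sameVertex_σ_inv d
  · rw [hloop']; exact L.sameVertex_σ_σ d

theorem IsCheckerboard.color_σ_σ {ε : L.Face → ZMod 2} (hε : L.IsCheckerboard ε) (d : D) :
    ε (L.face (L.σ d)) = ε (L.face (L.σ⁻¹ d)) := by
  have h := hε d
  have h' := hε (L.σ d)
  rw [L.face_α_σ] at h'
  rw [L.face_α] at h
  grind

variable (L)

theorem exists_isCheckerboard [Finite D] : ∃ ε, L.IsCheckerboard ε :=
  L.spherical.exists_isCheckerboard L.connected (ι := fun d => L.σ (L.σ d)) L.four L.two_ne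
    L.sameVertex_σ_σ

theorem face_α_ne_face_σ [Finite D] {d c : D} (h : L.face d = L.face (L.σ⁻¹ c)) :
    L.face (L.α d) ≠ L.face (L.σ c) := by
  obtain ⟨ε, hε⟩ := L.exists_isCheckerboard
  intro h'
  have hd := hε d
  rw [h, h', IsCheckerboard.color_σ_σ hε, CharTwo.add_self_eq_zero] at hd
  exact zero_ne_one hd

/-! ### Rows of bigons -/

theorem crossBigon_of_isBigon {d : D} (h : L.IsBigon d) : L.crossBigon d = L.φ d := if_pos h

theorem crossBigon_of_not_isBigon {d : D} (h : ¬ L.IsBigon d) : L.crossBigon d = d := if_neg h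

theorem crossBigon_involutive : Function.Involutive L.crossBigon :=
  Function.Involutive.toPerm_involutive _

theorem isBigon_crossBigon {d : D} : L.IsBigon (L.crossBigon d) ↔ L.IsBigon d := by
  by_cases h : L.IsBigon d
  · rw [L.crossBigon_of_isBigon h]; exact ⟨fun _ => h, L.bigon_face⟩
  · rw [L.crossBigon_of_not_isBigon h]

/-- One step along a row of bigons: cross a bigon, or stay at a corner that is not one, and pass to
the opposite corner of the crossing there. -/
def row : Equiv.Perm D := L.σ * L.σ * L.crossBigon

theorem row_apply (d : D) : L.row d = L.σ (L.σ (L.crossBigon d)) := rfl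

theorem row_crossBigon_row (d : D) : L.row (L.crossBigon (L.row d)) = L.crossBigon d := by
  rw [row_apply, crossBigon_involutive, row_apply, L.four]

theorem row_pow_crossBigon_row_pow (k : ℕ) (d : D) :
    (L.row ^ k) (L.crossBigon ((L.row ^ k) d)) = L.crossBigon d := by
  induction k generalizing d with
  | zero => rfl
  | succ k ih =>
    rw [pow_succ', Equiv.Perm.mul_apply, Equiv.Perm.mul_apply]
    rw [← Equiv.Perm.mul_apply, ← pow_succ', pow_succ, Equiv.Perm.mul_apply, row_crossBigon_row, ih]

variable {L}

theorem face_row_pow {d : D} (hd : ¬ L.IsBigon d) {a : ℕ}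
    (h : ∀ j, 0 < j → j < a → L.IsBigon ((L.row ^ j) d)) {j : ℕ} (hj : 0 < j) (hja : j ≤ a) :
    L.face (L.σ ((L.row ^ j) d)) = L.face (L.σ⁻¹ d) ∧
      L.face (L.σ⁻¹ ((L.row ^ j) d)) = L.face (L.σ d) := by
  induction j, hj using Nat.le_induction with
  | base =>
    rw [pow_one, L.row_apply, L.crossBigon_of_not_isBigon hd, σ_inv_σ, σ_inv]
    exact ⟨rfl, rfl⟩
  | succ j hj ih =>
    obtain ⟨hσ, hσ_inv⟩ := ih (by omega)
    have hb := h j hj (by omega)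
    set x := (L.row ^ j) d
    have hx : (L.row ^ (j + 1)) d = L.σ (L.σ (L.φ x)) := by
      rw [pow_succ', Equiv.Perm.mul_apply, L.row_apply, L.crossBigon_of_isBigon hb]
    have hα : L.α (L.φ x) = L.σ x := by rw [L.α_eq, hb.1]
    constructor
    · rw [hx, ← hσ, ← hα, L.face_α, ← L.σ_inv]
    · rw [hx, L.σ_inv_σ, ← L.α_eq, L.face_α, hσ_inv]

end LinkDiagram

/-! ### Ends of twist regions -/

namespace LinkDiagram

variable {D : Type*}

namespace Direction

variable {L : LinkDiagram D} (A : L.Direction)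

theorem ends_next_next (d : D) : L.σ (L.σ d) ∈ A.ends ↔ d ∈ A.ends := by
  rw [A.ends_next, A.ends_next, not_not]

theorem eq_of_sameVertex {c c' : D} (hc : c ∈ A.ends) (hc' : c' ∈ A.ends)
    (h : L.SameVertex c c') : c' = c ∨ c' = L.σ (L.σ c) := by
  rcases L.sameVertex_cases h with rfl | rfl | rfl | rfl
  · exact .inl rfl
  · exact absurd hc ((A.ends_next _).mp hc')
  · exact .inr rfl
  · exact absurd hc' ((A.ends_next _).mp (by simpa using hc))

theorem row_mem {d : D} (h : d ∈ A.ends) : L.row d ∈ A.ends := by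
  rw [L.row_apply, A.ends_next_next]
  by_cases hb : L.IsBigon d
  · exact A.bigon_mem _ (L.isBigon_crossBigon.mpr hb)
  · rwa [L.crossBigon_of_not_isBigon hb]

theorem row_pow_mem {d : D} (h : d ∈ A.ends) (k : ℕ) : (L.row ^ k) d ∈ A.ends := by
  induction k with
  | zero => exact h
  | succ k ih => rw [pow_succ']; exact A.row_mem ih

/-- The next corner, counterclockwise, of the same shaded triangle. -/
def next (q : A.Shaded) : A.Shaded := (q.1, q.2.next)

/-- The previous corner, counterclockwise, of the same shaded triangle. -/
def prev (q : A.Shaded) : A.Shaded := (q.1, q.2.prev)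

/-- The white face that follows a shaded corner counterclockwise around its ideal vertex. White
faces of the polyhedron are identified with the faces of the diagram. -/
def white : A.Shaded → L.Face
  | (c, .circ) => L.face (L.σ c.1)
  | (c, .fst) => L.face (L.α c.1)
  | (c, .snd) => L.face c.1

@[elab_as_elim]
theorem shaded_cases {motive : A.Shaded → Prop} (circ : ∀ c, motive (c, .circ))
    (strand : ∀ q : A.Shaded, q.2 ≠ .circ → motive q) (q : A.Shaded) : motive q := by
  by_cases h : q.2 = .circ
  · obtain ⟨c, p⟩ := q
    obtain rfl : p = .circ := h
    exact circ c
  · exact strand q h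

theorem white_strand (q : A.Shaded) (h : q.2 ≠ .circ) :
    A.white q = L.face (L.α (A.dartOf q)) := by
  obtain ⟨c, _ | _ | _⟩ := q
  · exact absurd rfl h
  · rfl
  · exact (L.face_α_σ _).symm

theorem white_next_strand (q : A.Shaded) (h : q.2 ≠ .circ) :
    A.white (A.next q) = L.face (A.dartOf q) := by
  obtain ⟨c, _ | _ | _⟩ := q
  · exact absurd rfl h
  · rfl
  · rfl

theorem white_next_circ (c : A.Tip) : A.white (A.next (c, .circ)) = L.face (L.σ⁻¹ c.1) :=
  L.face_α _

theorem locate_dartOf (q : A.Shaded) (h : q.2 ≠ .circ) :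
    A.locate (A.dartOf q) (A.external_dartOf q) = q := by
  obtain ⟨⟨c, hc⟩, _ | _ | _⟩ := q
  · exact absurd rfl h
  · simp [locate, dartOf, hc.1]
  · have : L.σ c ∉ A.ends := fun h => (A.ends_next c).mp h hc.1
    simp [locate, dartOf, this]

theorem eq_of_dartOf_eq {q q' : A.Shaded} (h : q.2 ≠ .circ) (h' : q'.2 ≠ .circ)
    (hd : A.dartOf q = A.dartOf q') : q = q' := by
  rw [← A.locate_dartOf q h, ← A.locate_dartOf q' h']
  congr 1

theorem white_ne_white_next (hp : L.IsPrime) (ht : L.TwoRegions) (q : A.Shaded) :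
    A.white q ≠ A.white (A.next q) := by
  induction q using A.shaded_cases with
  | circ c =>
    rw [white_next_circ]
    exact hp.face_σ_ne_face_σ_inv ht c.1
  | strand q h =>
    rw [white_strand _ _ h, white_next_strand _ _ h]
    exact (hp.face_ne_face_α _).symm

variable [Finite D]

theorem exists_otherTip_eq_row_pow (c : A.Tip) : ∃ a : ℕ, 0 < a ∧
    (A.otherTip c).1 = (L.row ^ a) c.1 ∧ ∀ j, 0 < j → j < a → L.IsBigon ((L.row ^ j) c.1) := by
  obtain ⟨k, hk, he, hmin⟩ := firstReturn_spec L.row A.IsTip c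
  refine ⟨k, hk, he, fun j h0 h1 => ?_⟩
  by_contra hb
  exact hmin j h0 h1 ⟨A.row_pow_mem c.2.1 j, hb⟩

theorem otherTip_eq {c c' : A.Tip} {a : ℕ} (ha : 0 < a) (hc' : c'.1 = (L.row ^ a) c.1)
    (h : ∀ j, 0 < j → j < a → L.IsBigon ((L.row ^ j) c.1)) : A.otherTip c = c' :=
  Subtype.ext ((firstReturn_eq L.row A.IsTip c ha (hc' ▸ c'.2)
    (fun j h0 h1 ht => ht.2 (h j h0 h1))).trans hc'.symm)

theorem row_pow_otherTip {c : A.Tip} {i j : ℕ} (h : (A.otherTip c).1 = (L.row ^ (i + j)) c.1) :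
    (L.row ^ j) (A.otherTip c).1 = L.crossBigon ((L.row ^ i) c.1) := by
  have hrev := L.row_pow_crossBigon_row_pow j ((L.row ^ i) c.1)
  rwa [← Equiv.Perm.mul_apply (L.row ^ j) (L.row ^ i), ← pow_add, add_comm j i, ← h,
    L.crossBigon_of_not_isBigon (A.otherTip c).2.2] at hrev

theorem otherTip_otherTip (c : A.Tip) : A.otherTip (A.otherTip c) = c := by
  obtain ⟨a, ha, he, hb⟩ := A.exists_otherTip_eq_row_pow c
  refine A.otherTip_eq ha ?_ fun j h0 h1 => ?_
  · rw [A.row_pow_otherTip (i := 0) (by rwa [zero_add]), pow_zero, Equiv.Perm.one_apply,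
      L.crossBigon_of_not_isBigon c.2.2]
  · rw [A.row_pow_otherTip (i := a - j) (by rwa [Nat.sub_add_cancel h1.le]),
      L.isBigon_crossBigon]
    exact hb _ (by omega) (by omega)

theorem otherTip_ne (c : A.Tip) : A.otherTip c ≠ c := by
  intro heq
  obtain ⟨a, ha, he, hb⟩ := A.exists_otherTip_eq_row_pow c
  -- The row would be its own reversal, so its middle crossing or bigon would be reversed in place.
  rcases Nat.even_or_odd' a with ⟨b, rfl | rfl⟩
  · have hmid := A.row_pow_otherTip (two_mul b ▸ he)
    have hbigon := hb b (by omega) (by omega)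
    rw [heq, L.crossBigon_of_isBigon hbigon] at hmid
    exact hbigon.2 hmid.symm
  · have hmid := A.row_pow_otherTip (i := b) (j := b + 1) (by rwa [two_mul] at he)
    rw [heq, pow_succ', Equiv.Perm.mul_apply, L.row_apply] at hmid
    exact L.two_ne _ hmid

theorem face_σ_otherTip (c : A.Tip) : L.face (L.σ (A.otherTip c).1) = L.face (L.σ⁻¹ c.1) := by
  obtain ⟨a, ha, he, hb⟩ := A.exists_otherTip_eq_row_pow c
  rw [he]
  exact (L.face_row_pow c.2.2 hb ha le_rfl).1

omit [Finite D] in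
theorem iterate_nextInRow_eq_row_pow (c : A.Tip) {k : ℕ}
    (hk : ∀ i ≤ k, L.IsBigon (L.nextInRow^[i] (L.σ (L.σ c.1)))) {i : ℕ} (hi : i ≤ k + 1) :
    L.nextInRow^[i] (L.σ (L.σ c.1)) = (L.row ^ (i + 1)) c.1 := by
  induction i with
  | zero =>
    rw [zero_add, pow_one, L.row_apply, L.crossBigon_of_not_isBigon c.2.2,
      Function.iterate_zero_apply]
  | succ i ih =>
    have hb := hk i (by omega)
    rw [ih (by omega)] at hb
    rw [Function.iterate_succ_apply', ih (by omega), pow_succ' _ (i + 1),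
      Equiv.Perm.mul_apply, L.row_apply, L.crossBigon_of_isBigon hb, nextInRow]

theorem otherTip_eq_of_bigonRow {c c' : A.Tip} {d : D} (hd : L.SameVertex d c'.1)
    (h : L.BigonRow (L.σ (L.σ c.1)) d) : A.otherTip c = c' := by
  obtain ⟨k, hk, hkd⟩ := h
  have hbigon := L.bigon_face (hk k le_rfl)
  have hc' : c'.1 = L.nextInRow^[k + 1] (L.σ (L.σ c.1)) := by
    rw [Function.iterate_succ_apply']
    exact (A.eq_of_sameVertex (A.bigon_mem _ hbigon) c'.2.1 (hkd.trans hd)).resolve_left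
      fun h => c'.2.2 (h ▸ hbigon)
  rw [A.iterate_nextInRow_eq_row_pow c hk le_rfl] at hc'
  refine A.otherTip_eq (by omega) hc' fun j h0 h1 => ?_
  obtain ⟨i, rfl⟩ := Nat.exists_eq_add_of_le' h0
  rw [← A.iterate_nextInRow_eq_row_pow c hk (by omega)]
  exact hk i (by omega)

theorem tip_eq_of_face_eq (hp : L.IsPrime) (hw : L.IsTwistReduced) (ht : L.TwoRegions)
    {c c' : A.Tip} (h : L.face (L.σ c.1) = L.face (L.σ c'.1))
    (h' : L.face (L.σ⁻¹ c.1) = L.face (L.σ⁻¹ c'.1)) : c = c' := by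
  by_cases hv : L.SameVertex c.1 c'.1
  · rcases A.eq_of_sameVertex c.2.1 c'.2.1 hv with hc | hc
    · exact Subtype.ext hc.symm
    · rw [hc, ← L.σ_inv] at h
      exact absurd h (hp.face_σ_ne_face_σ_inv ht _)
  have hopp : L.SameVertex (L.σ (L.σ c'.1)) c'.1 := (L.sameVertex_σ_σ c'.1).symm
  rcases hw c.1 (L.σ (L.σ c'.1)) (fun h => hv (h.trans hopp))
    (L.face_eq_iff.mp (by rw [h', L.σ_inv c'.1]))
    (L.face_eq_iff.mp (by rw [h, L.σ_inv_σ])) with ⟨k, hk, -⟩ | hrow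
  · exact absurd (hk 0 (Nat.zero_le _)) c.2.2
  · have hother := A.face_σ_otherTip c
    rw [A.otherTip_eq_of_bigonRow hopp hrow, ← h] at hother
    exact absurd hother (hp.face_σ_ne_face_σ_inv ht _)

theorem opposite_circ (c : A.Tip) : A.opposite (c, .circ) = (A.otherTip c, .circ) := rfl

theorem opposite_strand (q : A.Shaded) (h : q.2 ≠ .circ) :
    A.opposite q = A.locate (L.α (A.dartOf q)) (external_α (A.external_dartOf q)) := by
  obtain ⟨c, _ | _ | _⟩ := q
  · exact absurd rfl h
  · rfl
  · rfl

theorem opposite_snd_eq_circ_iff (q : A.Shaded) : (A.opposite q).2 = .circ ↔ q.2 = .circ := by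
  induction q using A.shaded_cases with
  | circ c => exact iff_of_true rfl rfl
  | strand q h =>
    rw [A.opposite_strand q h]
    exact iff_of_false (A.locate_ne_circ _ _) h

theorem dartOf_opposite (q : A.Shaded) (h : q.2 ≠ .circ) :
    A.dartOf (A.opposite q) = L.α (A.dartOf q) := by
  rw [A.opposite_strand q h, dartOf_locate]

theorem opposite_opposite (q : A.Shaded) : A.opposite (A.opposite q) = q := by
  induction q using A.shaded_cases with
  | circ c => rw [opposite_circ, opposite_circ, otherTip_otherTip]
  | strand q h =>
    have h' := mt (A.opposite_snd_eq_circ_iff q).mp h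
    have h'' := mt (A.opposite_snd_eq_circ_iff (A.opposite q)).mp h'
    exact A.eq_of_dartOf_eq h'' h
      (by rw [dartOf_opposite _ _ h', dartOf_opposite _ _ h, L.α_invol])

theorem white_opposite (q : A.Shaded) : A.white (A.opposite q) = A.white (A.next q) := by
  induction q using A.shaded_cases with
  | circ c =>
    rw [opposite_circ, white_next_circ]
    exact A.face_σ_otherTip c
  | strand q h =>
    rw [white_strand _ _ (mt (A.opposite_snd_eq_circ_iff q).mp h), dartOf_opposite _ _ h,
      L.α_invol, white_next_strand _ _ h]

theorem white_next_circ_ne {c : A.Tip} {q : A.Shaded} (hq : q.2 ≠ .circ)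
    (h : A.white (c, .circ) = A.white q) :
    A.white (A.next (c, .circ)) ≠ A.white (A.next q) := by
  intro h'
  rw [white_strand _ _ hq] at h
  rw [white_next_strand _ _ hq, white_next_circ] at h'
  exact L.face_α_ne_face_σ h'.symm h.symm

theorem eq_of_white_eq (hp : L.IsPrime) (hw : L.IsTwistReduced) (ht : L.TwoRegions)
    {q q' : A.Shaded} (h : A.white q = A.white q')
    (h' : A.white (A.next q) = A.white (A.next q')) : q = q' := by
  induction q using A.shaded_cases with
  | circ c =>
    induction q' using A.shaded_cases with
    | circ c' =>
      rw [white_next_circ, white_next_circ] at h'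
      rw [A.tip_eq_of_face_eq hp hw ht h h']
    | strand q' hq' => exact absurd h' (A.white_next_circ_ne hq' h)
  | strand q hq =>
    induction q' using A.shaded_cases with
    | circ c' => exact absurd h'.symm (A.white_next_circ_ne hq h.symm)
    | strand q' hq' =>
      rw [white_strand _ _ hq, white_strand _ _ hq'] at h
      rw [white_next_strand _ _ hq, white_next_strand _ _ hq'] at h'
      exact A.eq_of_dartOf_eq hq hq' (hp.eq_of_face_eq h' h)

end Direction

end LinkDiagram

/-! ### Ideal digons and triangles -/

/-- The incidence rules between the shaded triangles and the white faces of an ideal polyhedron.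
Elements of `S` are corners of shaded triangles, `next` and `prev` rotate a triangle, `opp` passes
to the other shaded corner at the same ideal vertex, and `w` is the white face that comes next at
this vertex. The dart `(q, false)` of the polyhedron stands for the shaded corner `q`, and
`(q, true)` for the white corner that follows it at the same ideal vertex. -/
structure Incidence {S F : Type*} (next prev opp : S → S) (w : S → F) : Prop where
  next_prev : ∀ q, next (prev q) = q
  next_next : ∀ q, next (next q) = prev q
  opp_opp : ∀ q, opp (opp q) = q
  w_opp : ∀ q, w (opp q) = w (next q)
  w_ne : ∀ q, w q ≠ w (next q)
  w_inj : ∀ q r, w q = w r → w (next q) = w (next r) → q = r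
  /-- Two triangles that share two vertices cut a bigon off the white face between them. -/
  no_bigon : ∀ q r, opp (prev q) = r → opp q ≠ prev r

namespace Incidence

variable {S F : Type*} {next prev opp : S → S} {w : S → F}

section Segments

variable (next prev opp w)

/-- The pairs of corners, as darts, that a segment in a boundary face may join. -/
def VertexSeg (x y : S × Bool) : Prop := (y.1 = x.1 ∨ y.1 = opp x.1) ∧ y ≠ x

/-- The pairs of corners, or of edges, that a segment in an interior face may join. -/
def FaceSeg (x y : S × Bool) : Prop :=
  (∃ q r, x = (q, false) ∧ y = (r, false) ∧ (r = next q ∨ r = prev q)) ∨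
  (∃ q r, x = (q, true) ∧ y = (r, true) ∧ w q = w r ∧ q ≠ r)

/-- The corners `y` and edges `e` that a segment in an interior face may join. -/
def CornerEdgeSeg (y e : S × Bool) : Prop :=
  (∃ q, y = (q, false) ∧ e = (next q, false)) ∨
  (∃ q r, y = (q, true) ∧ e = (r, true) ∧ w q = w r ∧ q ≠ r ∧ q ≠ opp (prev r))

/-- The boundary of a disk without edges that meets two ideal vertices: its two boundary segments
run from `x` to `y` and from `z` to `v`. -/
structure IdealDigon (x y z v : S × Bool) : Prop where
  segment₁ : VertexSeg opp x y
  side₁ : FaceSeg next prev w y z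
  segment₂ : VertexSeg opp z v
  side₂ : FaceSeg next prev w v x

/-- The boundary of a disk without edges that meets three ideal vertices: its boundary segments
run from `x` to `y`, from `z` to `v` and from `r` to `s`. -/
structure IdealTriangle (x y z v r s : S × Bool) : Prop where
  segment₁ : VertexSeg opp x y
  side₁ : FaceSeg next prev w y z
  segment₂ : VertexSeg opp z v
  side₂ : FaceSeg next prev w v r
  segment₃ : VertexSeg opp r s
  side₃ : FaceSeg next prev w s x

/-- The other dart of an edge. -/
def flipEdge (e : S × Bool) : S × Bool :=
  if e.2 then (prev e.1, false) else (next e.1, true)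

/-- The next dart around an ideal vertex. -/
def rot (x : S × Bool) : S × Bool := if x.2 then (opp x.1, false) else (x.1, true)

/-- The previous dart around an ideal vertex. -/
def rotInv (x : S × Bool) : S × Bool := if x.2 then (x.1, false) else (opp x.1, true)

/-- The next corner of a face. -/
def nextCorner (x : S × Bool) : S × Bool :=
  if x.2 then (opp (prev x.1), true) else (next x.1, false)

/-- The previous corner of a face. -/
def prevCorner (x : S × Bool) : S × Bool :=
  if x.2 then (next (opp x.1), true) else (prev x.1, false)

end Segments

theorem prev_next (T : Incidence next prev opp w) (q : S) : prev (next q) = q := by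
  rw [← T.next_next (next q), T.next_next q, T.next_prev]

theorem prev_prev (T : Incidence next prev opp w) (q : S) : prev (prev q) = next q := by
  rw [← T.next_next (prev q), T.next_prev]

theorem eq_of_w_opp_eq (T : Incidence next prev opp w) {q r : S} (h : w q = w r)
    (h' : w (opp q) = w (next r)) : q = r :=
  T.w_inj _ _ h (by rw [← T.w_opp, h'])

theorem opp_next_ne_prev_opp (T : Incidence next prev opp w) (q : S) :
    opp (next q) ≠ prev (opp q) :=
  T.no_bigon (next q) (opp q) (by rw [T.prev_next])

theorem w_prev_opp_ne (T : Incidence next prev opp w) (q : S) :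
    w (prev (opp q)) ≠ w (prev q) := fun h =>
  T.opp_next_ne_prev_opp q <|
    T.eq_of_w_opp_eq (by rw [T.w_opp, T.next_next, h]) (by rw [T.opp_opp, T.next_prev, T.w_opp])

theorem flipEdge_flipEdge (T : Incidence next prev opp w) (e : S × Bool) :
    flipEdge next prev (flipEdge next prev e) = e := by
  obtain ⟨q, _ | _⟩ := e <;> simp [flipEdge, T.next_prev, T.prev_next]

theorem nextCorner_ne_prevCorner (T : Incidence next prev opp w) (x : S × Bool) :
    nextCorner next prev opp x ≠ prevCorner next prev opp x := by
  obtain ⟨q, _ | _⟩ := x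
  · intro h
    refine T.w_ne (next q) ?_
    rw [T.next_next, show next q = prev q from congrArg Prod.fst h]
  · intro h
    refine T.opp_next_ne_prev_opp (opp q) ?_
    rw [show next (opp q) = opp (prev q) from (congrArg Prod.fst h).symm, T.opp_opp, T.opp_opp]

theorem rot_rotInv (T : Incidence next prev opp w) (x : S × Bool) :
    rot opp (rotInv opp x) = x := by
  obtain ⟨q, _ | _⟩ := x <;> simp [rot, rotInv, T.opp_opp]

theorem rotInv_rot (T : Incidence next prev opp w) (x : S × Bool) :
    rotInv opp (rot opp x) = x := by
  obtain ⟨q, _ | _⟩ := x <;> simp [rot, rotInv, T.opp_opp]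

theorem VertexSeg.cases {x y : S × Bool} (h : VertexSeg opp x y) :
    y = (opp x.1, x.2) ∨ y = (x.1, !x.2) ∨ y = (opp x.1, !x.2) := by
  rcases Bool.eq_or_eq_not y.2 x.2 with h2 | h2
  · exact .inl (Prod.ext (h.1.resolve_left fun h1 => h.2 (Prod.ext h1 h2)) h2)
  · exact .inr (h.1.imp (Prod.ext · h2) (Prod.ext · h2))

theorem VertexSeg.symm (T : Incidence next prev opp w) {x y : S × Bool} (h : VertexSeg opp x y) :
    VertexSeg opp y x := by
  refine ⟨h.1.imp Eq.symm fun h1 => ?_, h.2.symm⟩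
  rw [h1, T.opp_opp]

theorem FaceSeg.snd_eq {x y : S × Bool} (h : FaceSeg next prev w x y) : y.2 = x.2 := by
  rcases h with ⟨q, r, rfl, rfl, -⟩ | ⟨q, r, rfl, rfl, -⟩ <;> rfl

theorem FaceSeg.symm (T : Incidence next prev opp w) {x y : S × Bool}
    (h : FaceSeg next prev w x y) : FaceSeg next prev w y x := by
  rcases h with ⟨q, r, rfl, rfl, rfl | rfl⟩ | ⟨q, r, rfl, rfl, hw, hne⟩
  · exact .inl ⟨_, _, rfl, rfl, .inr (T.prev_next q).symm⟩
  · exact .inl ⟨_, _, rfl, rfl, .inl (T.next_prev q).symm⟩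
  · exact .inr ⟨_, _, rfl, rfl, hw.symm, hne.symm⟩

section Disks

variable {x y z v r s e e' : S × Bool}

theorem no_disk_vertex (T : Incidence next prev opp w) (h1 : VertexSeg opp x y)
    (h2 : FaceSeg next prev w y x) : False := by
  obtain ⟨hv, hne⟩ := h1
  obtain ⟨next_prev, next_next, opp_opp, w_opp, w_ne, w_inj, no_bigon⟩ := T
  rcases h2 with ⟨_, _, rfl, rfl, h⟩ | ⟨_, _, rfl, rfl, h, h'⟩ <;> grind

theorem no_disk_vertex_edge (T : Incidence next prev opp w) (h1 : VertexSeg opp x y)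
    (h2 : CornerEdgeSeg next prev opp w y e)
    (h3 : CornerEdgeSeg next prev opp w x (flipEdge next prev e)) : False := by
  obtain ⟨_, hne⟩ := h1
  unfold flipEdge at h3
  have := T.prev_next
  obtain ⟨next_prev, next_next, opp_opp, w_opp, w_ne, w_inj, -⟩ := T
  rcases h2 with ⟨q, rfl, rfl⟩ | ⟨q, r, rfl, rfl, h4, -, -⟩ <;>
  rcases h3 with ⟨q', rfl, h7⟩ | ⟨q', r', rfl, h7, h8, -, h10⟩ <;>
  simp at h7 <;> grind

theorem no_disk_vertex_edge_edge (T : Incidence next prev opp w)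
    (h1 : VertexSeg opp x y) (h2 : CornerEdgeSeg next prev opp w y e)
    (h3 : FaceSeg next prev w (flipEdge next prev e) e')
    (h4 : CornerEdgeSeg next prev opp w x (flipEdge next prev e')) : False := by
  obtain ⟨hv, hne⟩ := h1
  unfold flipEdge at h3 h4
  have := T.w_prev_opp_ne
  have := T.prev_next
  have := T.prev_prev
  obtain ⟨next_prev, next_next, opp_opp, w_opp, -, w_inj, -⟩ := T
  rcases h2 with ⟨q, rfl, rfl⟩ | ⟨q, r, rfl, rfl, h5, h6, h7⟩ <;>
  rcases h3 with ⟨s, t, h8, rfl, h10⟩ | ⟨s, t, h8, rfl, h10, h11⟩ <;>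
  simp only [reduceIte, Prod.mk.injEq, Bool.false_eq_true, and_true, and_false, reduceCtorEq]
    at h8 h4 <;>
  rcases h4 with ⟨q', rfl, h12⟩ | ⟨q', r', rfl, h12, h13, -, -⟩ <;> simp at h12 <;> grind

theorem no_disk_vertex_edge_vertex (T : Incidence next prev opp w)
    (h1 : VertexSeg opp x y) (h2 : CornerEdgeSeg next prev opp w y e)
    (h3 : CornerEdgeSeg next prev opp w z (flipEdge next prev e))
    (h4 : VertexSeg opp z v) (h5 : FaceSeg next prev w v x) : False := by
  obtain ⟨hv, hne⟩ := h1
  obtain ⟨hv', hne'⟩ := h4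
  unfold flipEdge at h3
  have := T.w_prev_opp_ne
  have := T.prev_next
  have := T.prev_prev
  obtain ⟨next_prev, next_next, opp_opp, w_opp, w_ne, w_inj, no_bigon⟩ := T
  rcases h2 with ⟨q, rfl, rfl⟩ | ⟨q, r, rfl, rfl, h6, h7, h8⟩ <;>
  rcases h3 with ⟨q', rfl, h9⟩ | ⟨q', r', rfl, h9, h10, h11, h12⟩ <;> simp at h9 <;>
  rcases h5 with ⟨s, t, rfl, rfl, h13⟩ | ⟨s, t, rfl, rfl, h13, -⟩ <;>
  rcases hv with h | h <;> rcases hv' with h' | h' <;> grind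

theorem no_disk_vertex_vertex_edge (T : Incidence next prev opp w)
    (h1 : VertexSeg opp x y) (h2 : FaceSeg next prev w y z) (h3 : VertexSeg opp z v)
    (h4 : CornerEdgeSeg next prev opp w v e)
    (h5 : CornerEdgeSeg next prev opp w x (flipEdge next prev e)) : False :=
  T.no_disk_vertex_edge_vertex (h1.symm T) h5 (by rwa [T.flipEdge_flipEdge]) (h3.symm T)
    (h2.symm T)

theorem IdealDigon.cases (T : Incidence next prev opp w) (h : IdealDigon next prev opp w x y z v) :
    (y = rot opp x ∧ v = prevCorner next prev opp x ∧ z = nextCorner next prev opp y) ∨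
    (y = rotInv opp x ∧ v = nextCorner next prev opp x ∧ z = prevCorner next prev opp y) := by
  obtain ⟨h1, h2, h3, h4⟩ := h
  obtain ⟨hv, hne⟩ := h1
  obtain ⟨hv', hne'⟩ := h3
  have := @T.eq_of_w_opp_eq
  have := T.prev_next
  have := T.prev_prev
  obtain ⟨next_prev, next_next, opp_opp, w_opp, w_ne, -, no_bigon⟩ := T
  unfold rot rotInv nextCorner prevCorner
  rcases h2 with ⟨q, r, rfl, rfl, h6⟩ | ⟨q, r, rfl, rfl, h6, h7⟩ <;>
  rcases h4 with ⟨s, t, rfl, rfl, h8⟩ | ⟨s, t, rfl, rfl, h8, -⟩ <;>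
  rcases hv with h | h <;> rcases hv' with h' | h' <;> simp only at h h' <;> simp <;> grind

theorem eq_of_straight_shaded (T : Incidence next prev opp w) {q q' q'' : S}
    (h1 : FaceSeg next prev w (opp q, false) (q', false)) (h2 : VertexSeg opp (q', false) v)
    (h3 : FaceSeg next prev w v r) (h4 : VertexSeg opp r (q'', false))
    (h5 : FaceSeg next prev w (q'', false) (q, false)) :
    (q'' = next q → q' = prev (opp q)) ∧ (q'' = prev q → q' = next (opp q)) := by
  have := T.w_prev_opp_ne
  have := T.prev_next
  have := T.prev_prev
  have h4 := h4.symm T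
  obtain ⟨next_prev, next_next, opp_opp, w_opp, w_ne, w_inj, -⟩ := T
  simp only [FaceSeg] at h1 h5
  rcases h2.cases with rfl | rfl | rfl <;> rcases h4.cases with rfl | rfl | rfl <;>
  simp [FaceSeg] at h3 <;> grind

theorem eq_of_straight_white (T : Incidence next prev opp w) {q q' q'' : S}
    (h1 : FaceSeg next prev w (opp q, true) (q', true)) (h2 : VertexSeg opp (q', true) v)
    (h3 : FaceSeg next prev w v r) (h4 : VertexSeg opp r (q'', true))
    (h5 : FaceSeg next prev w (q'', true) (q, true)) :
    (q'' = opp (prev q) → q' = next q) ∧ (q'' = next (opp q) → q' = opp (prev (opp q))) := by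
  have := T.w_prev_opp_ne
  have := T.prev_next
  have := T.prev_prev
  have h4 := h4.symm T
  obtain ⟨next_prev, next_next, opp_opp, w_opp, w_ne, w_inj, no_bigon⟩ := T
  simp only [FaceSeg] at h1 h5
  rcases h2.cases with rfl | rfl | rfl <;> rcases h4.cases with rfl | rfl | rfl <;>
  simp [FaceSeg] at h3 <;> grind

theorem eq_or_eq_of_rot_shaded (T : Incidence next prev opp w) {q q' q'' : S}
    (h1 : FaceSeg next prev w (q, true) (q', true)) (h2 : VertexSeg opp (q', true) v)
    (h3 : FaceSeg next prev w v r) (h4 : VertexSeg opp r (q'', false))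
    (h5 : FaceSeg next prev w (q'', false) (q, false)) :
    q'' = prev q ∨ q' = opp (prev q) := by
  have := T.w_prev_opp_ne
  have := T.prev_next
  have := T.prev_prev
  have h4 := h4.symm T
  obtain ⟨next_prev, next_next, opp_opp, w_opp, w_ne, w_inj, -⟩ := T
  simp only [FaceSeg] at h1 h5
  rcases h2.cases with rfl | rfl | rfl <;> rcases h4.cases with rfl | rfl | rfl <;>
  simp [FaceSeg] at h3 <;> grind

theorem eq_or_eq_of_rot_white (T : Incidence next prev opp w) {q q' q'' : S}
    (h1 : FaceSeg next prev w (opp q, false) (q', false)) (h2 : VertexSeg opp (q', false) v)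
    (h3 : FaceSeg next prev w v r) (h4 : VertexSeg opp r (q'', true))
    (h5 : FaceSeg next prev w (q'', true) (q, true)) :
    q'' = next (opp q) ∨ q' = next (opp q) := by
  have := T.w_prev_opp_ne
  have := T.prev_next
  have := T.prev_prev
  have h4 := h4.symm T
  obtain ⟨next_prev, next_next, opp_opp, w_opp, w_ne, w_inj, -⟩ := T
  simp only [FaceSeg] at h1 h5
  rcases h2.cases with rfl | rfl | rfl <;> rcases h4.cases with rfl | rfl | rfl <;>
  simp [FaceSeg] at h3 <;> grind

theorem IdealTriangle.reverse (T : Incidence next prev opp w)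
    (h : IdealTriangle next prev opp w x y z v r s) :
    IdealTriangle next prev opp w y x s r v z :=
  ⟨h.segment₁.symm T, h.side₃.symm T, h.segment₃.symm T, h.side₂.symm T, h.segment₂.symm T,
    h.side₁.symm T⟩

theorem IdealTriangle.eq_of_straight (T : Incidence next prev opp w)
    (h : IdealTriangle next prev opp w x y z v r s) (hy : y = (opp x.1, x.2)) :
    (s = nextCorner next prev opp x → z = prevCorner next prev opp y) ∧
    (s = prevCorner next prev opp x → z = nextCorner next prev opp y) := by
  subst hy
  obtain ⟨-, h1, h2, h3, h4, h5⟩ := h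
  obtain ⟨q, b⟩ := x
  obtain ⟨q', b'⟩ := z
  obtain ⟨q'', b''⟩ := s
  obtain rfl : b' = b := h1.snd_eq
  obtain rfl : b' = b'' := h5.snd_eq
  cases b'
  · simpa [nextCorner, prevCorner] using T.eq_of_straight_shaded h1 h2 h3 h4 h5
  · simpa [nextCorner, prevCorner, T.opp_opp] using T.eq_of_straight_white h1 h2 h3 h4 h5

theorem IdealTriangle.eq_or_eq_of_rot (T : Incidence next prev opp w)
    (h : IdealTriangle next prev opp w x y z v r s) (hy : y = rot opp x) :
    s = prevCorner next prev opp x ∨ z = nextCorner next prev opp y := by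
  subst hy
  obtain ⟨-, h1, h2, h3, h4, h5⟩ := h
  obtain ⟨q, b⟩ := x
  obtain ⟨q', b'⟩ := z
  obtain ⟨q'', b''⟩ := s
  obtain rfl : b = b'' := h5.snd_eq
  obtain rfl : b' = (rot opp (q, b)).2 := h1.snd_eq
  cases b
  · simpa [nextCorner, prevCorner, rot] using T.eq_or_eq_of_rot_shaded h1 h2 h3 h4 h5
  · simpa [nextCorner, prevCorner, rot] using T.eq_or_eq_of_rot_white h1 h2 h3 h4 h5

end Disks

end Incidence

theorem Pos.eq_or (p p' : Pos) : p' = p ∨ p' = p.next ∨ p' = p.prev := by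
  cases p <;> cases p' <;> simp [Pos.next, Pos.prev]

namespace LinkDiagram.Direction

open Incidence

variable {D : Type*} {L : LinkDiagram D} (A : L.Direction)

theorem next_prev (q : A.Shaded) : A.next (A.prev q) = q := by
  obtain ⟨c, _ | _ | _⟩ := q <;> rfl

theorem next_next (q : A.Shaded) : A.next (A.next q) = A.prev q := by
  obtain ⟨c, _ | _ | _⟩ := q <;> rfl

theorem eq_of_tip_eq {q q' : A.Shaded} (h : q.1 = q'.1) :
    q' = q ∨ q' = A.next q ∨ q' = A.prev q := by
  obtain ⟨c, p⟩ := q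
  obtain ⟨c', p'⟩ := q'
  obtain rfl : c = c' := h
  exact (Pos.eq_or p p').imp (congrArg _) (Or.imp (congrArg _) (congrArg _))

variable [Finite D]

theorem opposite_snd_ne_fst {c c' : A.Tip} (hc : A.opposite (c, .circ) = (c', .circ))
    (hf : A.opposite (c, .fst) = (c', .snd)) : A.opposite (c, .snd) ≠ (c', .fst) := by
  intro hs
  have hfst : L.σ c'.1 = L.α c.1 := by
    simpa only [hf, dartOf] using A.dartOf_opposite (c, .fst) (by simp)
  have hsnd : c'.1 = L.α (L.σ c.1) := by
    simpa only [hs, dartOf] using A.dartOf_opposite (c, .snd) (by simp)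
  have hcc' : L.φ c.1 = c'.1 := by
    change L.σ⁻¹ (L.α c.1) = c'.1
    rw [← hfst, σ_inv_σ]
  have hc'c : L.φ c'.1 = c.1 := by rw [hsnd, L.φ_α, σ_inv_σ]
  refine c.2.2 ⟨by rw [hcc', hc'c], fun h => A.otherTip_ne c ?_⟩
  have hother : A.otherTip c = c' := congrArg Prod.fst hc
  rw [hother, Subtype.ext (hcc'.symm.trans h)]

theorem opposite_ne_prev (hp : L.IsPrime) (hw : L.IsTwistReduced) (ht : L.TwoRegions)
    {q q' : A.Shaded} (h : A.opposite (A.prev q) = q') : A.opposite q ≠ A.prev q' := by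
  intro h'
  have h'' : A.opposite (A.next q) = A.next q' := by
    refine A.eq_of_white_eq hp hw ht ?_ ?_
    · rw [white_opposite, next_next, ← A.white_opposite q', ← h, opposite_opposite]
    · rw [← white_opposite, opposite_opposite, next_next, ← A.white_opposite q, h']
  have hcirc := A.opposite_snd_eq_circ_iff q
  have hcirc' := A.opposite_snd_eq_circ_iff (A.prev q)
  rw [h'] at hcirc
  rw [h] at hcirc'
  obtain ⟨c, p⟩ := q
  obtain ⟨c', p'⟩ := q'
  cases p <;> cases p' <;> simp [prev, Pos.prev] at hcirc hcirc'
  · exact A.opposite_snd_ne_fst h' h'' h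
  · exact A.opposite_snd_ne_fst h h' h''
  · exact A.opposite_snd_ne_fst h'' h h'

theorem incidence (hp : L.IsPrime) (hw : L.IsTwistReduced) (ht : L.TwoRegions) :
    Incidence A.next A.prev A.opposite A.white where
  next_prev := A.next_prev
  next_next := A.next_next
  opp_opp := A.opposite_opposite
  w_opp := A.white_opposite
  w_ne := A.white_ne_white_next hp ht
  w_inj _ _ := A.eq_of_white_eq hp hw ht
  no_bigon _ _ := A.opposite_ne_prev hp hw ht

theorem poly_σ_true (q : A.Shaded) : A.poly.σ (q, true) = (A.opposite q, false) := rfl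

theorem poly_σ_inv_false (q : A.Shaded) : A.poly.σ⁻¹ (q, false) = (A.opposite q, true) := by
  rw [Equiv.Perm.inv_eq_iff_eq, poly_σ_true, opposite_opposite]

theorem poly_α_eq (e : A.Dart) : A.poly.α e = flipEdge A.next A.prev e := by
  obtain ⟨q, _ | _⟩ := e <;> rfl

theorem poly_φ_false (q : A.Shaded) : A.poly.φ (q, false) = (A.next q, false) := rfl

theorem poly_φ_true (q : A.Shaded) : A.poly.φ (q, true) = (A.opposite (A.prev q), true) :=
  A.poly_σ_inv_false _

/-- The face of the polyhedron at a corner: a shaded triangle, labelled by its tip, or a white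
face. -/
def faceLabel (x : A.Dart) : A.Tip ⊕ L.Face :=
  if x.2 then .inr (A.white x.1) else .inl x.1.1

theorem faceLabel_poly_φ (x : A.Dart) : A.faceLabel (A.poly.φ x) = A.faceLabel x := by
  obtain ⟨q, _ | _⟩ := x
  · rfl
  · rw [poly_φ_true]
    simp only [faceLabel, if_true, white_opposite, next_prev]

theorem sameFace_cases {x y : A.Dart} (h : A.poly.SameFace x y) :
    (∃ q r, x = (q, false) ∧ y = (r, false) ∧ (r = q ∨ r = A.next q ∨ r = A.prev q)) ∨
    (∃ q r, x = (q, true) ∧ y = (r, true) ∧ A.white q = A.white r) := by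
  have hlabel := eq_of_sameCycle A.faceLabel_poly_φ h
  obtain ⟨q, _ | _⟩ := x <;> obtain ⟨r, _ | _⟩ := y <;>
    simp only [faceLabel, if_true, Bool.false_eq_true, if_false, Sum.inl.injEq, Sum.inr.injEq,
      reduceCtorEq] at hlabel
  · exact .inl ⟨q, r, rfl, rfl, A.eq_of_tip_eq hlabel⟩
  · exact .inr ⟨q, r, rfl, rfl, hlabel⟩

theorem fst_eq_or_of_sameVertex {x y : A.Dart} (h : A.poly.SameVertex x y) :
    y.1 = x.1 ∨ y.1 = A.opposite x.1 := by
  let pair : A.Dart → Set A.Shaded := fun z => {z.1, A.opposite z.1}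
  have hpair : ∀ z, pair (A.poly.σ z) = pair z := by
    rintro ⟨q, _ | _⟩
    · rfl
    · simp only [pair, poly_σ_true, opposite_opposite]
      exact Set.pair_comm _ _
  have hy : y.1 ∈ pair y := Set.mem_insert _ _
  rwa [← eq_of_sameCycle hpair h] at hy

theorem vertexSeg {x y : A.Dart} (h : A.poly.IsSegment (.bdry x) (.bdry y)) :
    VertexSeg A.opposite x y :=
  ⟨A.fst_eq_or_of_sameVertex h.1, fun e => h.2.1 (congrArg _ e)⟩

theorem faceSeg_of_sameFace {x y : A.Dart} (h : A.poly.SameFace x y) (hne : y ≠ x) :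
    FaceSeg A.next A.prev A.white x y := by
  rcases A.sameFace_cases h with ⟨q, r, rfl, rfl, hr⟩ | ⟨q, r, rfl, rfl, hw⟩
  · exact .inl ⟨q, r, rfl, rfl, hr.resolve_left fun hr => hne (by rw [hr])⟩
  · exact .inr ⟨q, r, rfl, rfl, hw, fun hq => hne (by rw [hq])⟩

theorem faceSeg_corner {x y : A.Dart} (h : A.poly.IsSegment (.corner x) (.corner y)) :
    FaceSeg A.next A.prev A.white x y :=
  A.faceSeg_of_sameFace h.1 fun e => h.2.1 (congrArg _ e)

theorem faceSeg_edge {x y : A.Dart} (h : A.poly.IsSegment (.edge x) (.edge y)) :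
    FaceSeg A.next A.prev A.white x y :=
  A.faceSeg_of_sameFace h.1 fun e => h.2.1 (congrArg _ e)

theorem cornerEdgeSeg_of_sameFace {e y : A.Dart} (hf : A.poly.SameFace e y)
    (h : ¬ A.poly.Adjacent (.edge e) (.corner y)) :
    CornerEdgeSeg A.next A.prev A.opposite A.white y e := by
  obtain ⟨hy, -, -, hφ : y ≠ A.poly.φ e⟩ := not_or.mp h |>.imp_right fun h =>
    not_or.mp h |>.imp_right not_or.mp
  rcases A.sameFace_cases hf with ⟨q, r, rfl, rfl, rfl | rfl | rfl⟩ | ⟨q, r, rfl, rfl, hw⟩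
  · exact absurd rfl hy
  · exact absurd (A.poly_φ_false q).symm hφ
  · exact .inl ⟨_, rfl, by rw [next_prev]⟩
  · rw [poly_φ_true] at hφ
    exact .inr ⟨r, q, rfl, rfl, hw.symm, fun hr => hy (by rw [hr]), fun hr => hφ (by rw [hr])⟩

theorem cornerEdgeSeg {y e : A.Dart} (h : A.poly.IsSegment (.corner y) (.edge e)) :
    CornerEdgeSeg A.next A.prev A.opposite A.white y e :=
  A.cornerEdgeSeg_of_sameFace (Equiv.Perm.SameCycle.symm h.1) h.2.2.2.2

theorem edgeCornerSeg {e y : A.Dart} (h : A.poly.IsSegment (.edge e) (.corner y)) :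
    CornerEdgeSeg A.next A.prev A.opposite A.white y e :=
  A.cornerEdgeSeg_of_sameFace h.1 h.2.2.2.1

end LinkDiagram.Direction

/-! ### Admissible disks -/

namespace CombMap

variable {X : Type*} (M : CombMap X)

theorem Follows.bdry_of_corner {M : CombMap X} {z : X} {t : Option (Side X)}
    (h : M.Follows (some (.corner z)) t) :
    ∃ v, t = some (.bdry v) ∧ M.IsSegment (.bdry z) (.bdry v) := by
  rcases t with _ | (v | v | v)
  · exact h.elim
  · exact h.1.elim
  · exact h.1.elim
  · exact ⟨v, rfl, h⟩

theorem Follows.of_interior {M : CombMap X} {s : Side X} (hs : (M.flip s).Interior)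
    {t : Option (Side X)} (h : M.Follows (some s) t) :
    t = none ∨ (∃ e, t = some (.edge e) ∧ M.IsSegment (M.flip s) (.edge e)) ∨
      (∃ z, t = some (.corner z) ∧ M.IsSegment (M.flip s) (.corner z)) := by
  rcases t with _ | (e | z | v)
  · exact .inl rfl
  · exact .inr (.inl ⟨e, rfl, h⟩)
  · exact .inr (.inr ⟨z, rfl, h⟩)
  · obtain ⟨hface, -⟩ := h
    rcases s with s | s | s
    · exact hface.elim
    · exact hs.elim
    · exact hface.elim

/-- The combinatorial area of an admissible disk is `π / 2` times the sum of the costs of its steps,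
plus `π / 2` for every boundary segment, minus `2 * π`. -/
def cost : Option (Side X) → ℕ
  | some (.edge _) => 1
  | some (.corner _) => 1
  | some (.bdry _) => 0
  | none => 6

namespace AdmDisk

variable {M} (Δ : M.AdmDisk)

/-- The cyclic sequence of the steps of `∂D`, beginning with the step `p`. -/
def steps (p : Fin (Δ.k + 1)) : List (Option (Side X)) :=
  (List.range (Δ.k + 1)).map fun j => Δ.step (p + Fin.ofNat (Δ.k + 1) j)

theorem steps_eq_cons (p : Fin (Δ.k + 1)) (h : Δ.step p ≠ Δ.step (p + 1)) :
    ∃ l, Δ.steps p = Δ.step p :: Δ.step (p + 1) :: l := by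
  have hk : Δ.k ≠ 0 := fun hk => by
    have : Subsingleton (Fin (Δ.k + 1)) := by rw [hk]; exact inferInstanceAs (Subsingleton (Fin 1))
    exact h (congrArg Δ.step (Subsingleton.elim _ _))
  obtain ⟨m, hm⟩ := Nat.exists_eq_succ_of_ne_zero hk
  have hrange : List.range (Δ.k + 1) = 0 :: 1 :: List.range' 2 m := by
    rw [hm, List.range_eq_range']; rfl
  refine ⟨(List.range' 2 m).map fun j => Δ.step (p + Fin.ofNat (Δ.k + 1) j), ?_⟩
  rw [steps, hrange, List.map_cons, List.map_cons]
  congr 2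
  simp

theorem steps_concat (p : Fin (Δ.k + 1)) : Δ.steps p ++ [Δ.step p] =
    (List.range (Δ.k + 2)).map fun j => Δ.step (p + Fin.ofNat (Δ.k + 1) j) := by
  have hperiod : Fin.ofNat (Δ.k + 1) (Δ.k + 1) = 0 := by ext; simp
  rw [List.range_succ (n := Δ.k + 1), List.map_append, List.map_singleton, hperiod, add_zero, steps]

theorem isChain_steps (p : Fin (Δ.k + 1)) : (Δ.steps p ++ [Δ.step p]).IsChain M.Follows := by
  rw [steps_concat, List.isChain_map, List.isChain_range_succ]
  intro j _
  have hsucc : Fin.ofNat (Δ.k + 1) (j + 1) = Fin.ofNat (Δ.k + 1) j + 1 := by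
    ext; simp [Fin.val_add]
  rw [hsucc, ← add_assoc]
  exact Δ.follows _

theorem sum_map_steps (p : Fin (Δ.k + 1)) (f : Option (Side X) → ℕ) :
    ((Δ.steps p).map f).sum = ∑ i, f (Δ.step i) := by
  rw [steps, List.map_map]
  change ∑ j ∈ Finset.range (Δ.k + 1), f (Δ.step (p + Fin.ofNat (Δ.k + 1) j)) = _
  rw [← Fin.sum_univ_eq_sum_range (fun j => f (Δ.step (p + Fin.ofNat (Δ.k + 1) j))),
    ← Equiv.sum_comp (Equiv.addLeft p) (fun i => f (Δ.step i))]
  refine Finset.sum_congr rfl fun i _ => ?_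
  simp

theorem card_filter_step (p : Fin (Δ.k + 1)) (P : Option (Side X) → Prop) [DecidablePred P] :
    (Finset.univ.filter fun i => P (Δ.step i)).card
      = ((Δ.steps p).map fun s => if P s then 1 else 0).sum := by
  rw [sum_map_steps, Finset.card_filter]

theorem sum_cost (p : Fin (Δ.k + 1)) :
    ((Δ.steps p).map cost).sum = Δ.numEdges + Δ.numBdry + 6 * Δ.numFree := by
  classical
  rw [sum_map_steps, numEdges, numBdry, numFree, Finset.card_filter, Finset.card_filter,
    Finset.card_filter, Finset.mul_sum, ← Finset.sum_add_distrib, ← Finset.sum_add_distrib]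
  refine Finset.sum_congr rfl fun i _ => ?_
  rcases Δ.step i with _ | (x | x | x) <;> simp [cost]

theorem numBdry_pos {p : Fin (Δ.k + 1)} {x : X} (h : Δ.step p = some (.corner x)) :
    0 < Δ.numBdry := by
  classical
  exact Finset.card_pos.mpr ⟨p, Finset.mem_filter.mpr ⟨Finset.mem_univ _, x, h⟩⟩

theorem le_relLength (hb : 0 < Δ.numBdry)
    (h : 4 ≤ Δ.numEdges + Δ.numBdry + 6 * Δ.numFree) : Real.pi / 2 ≤ Δ.relLength := by
  rw [relLength, area, le_div_iff₀ (by exact_mod_cast hb)]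
  have h' : (4 : ℝ) ≤ Δ.numEdges + Δ.numBdry + 6 * Δ.numFree := by exact_mod_cast h
  nlinarith [Real.pi_pos]

theorem after_eq {p : Fin (Δ.k + 1)} {a b c : Option (Side X)} {l : List (Option (Side X))}
    (h : Δ.steps p ++ [Δ.step p] = a :: b :: c :: l) : Δ.after p = c := by
  rw [steps_concat] at h
  have hget := congrArg (·[2]?) h
  have hk : 2 < Δ.k + 2 := by
    have := congrArg List.length h
    simp only [List.length_map, List.length_range, List.length_cons] at this
    omega
  have htwo : p + Fin.ofNat (Δ.k + 1) 2 = p + 1 + 1 := by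
    rw [add_assoc]; congr 1; ext; simp [Fin.val_add]
  rw [after]
  simpa only [List.getElem?_map, List.getElem?_range hk, Option.map_some, htwo,
    List.getElem?_cons_succ, List.getElem?_cons_zero, Option.some.injEq] using hget

theorem before_eq {p : Fin (Δ.k + 1)} {a : Option (Side X)} {l : List (Option (Side X))}
    (h : Δ.steps p = l ++ [a]) : Δ.before p = a.map M.flip := by
  rw [steps, List.range_succ, List.map_append, List.map_singleton] at h
  have hlast : Fin.ofNat (Δ.k + 1) Δ.k = -1 := by
    rw [eq_neg_iff_add_eq_zero]; ext; simp
  have ha := List.singleton_inj.mp (List.append_inj' h rfl).2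
  rw [before, ← ha, hlast, sub_eq_add_neg]

end AdmDisk

theorem cases_of_isChain {s : Side X} {x : X} {l : List (Option (Side X))} {n : ℕ}
    (h : List.IsChain M.Follows (some s :: (l ++ [some (.corner x)])))
    (hs : (M.flip s).Interior) (hl : (l.map cost).sum ≤ n) (hn : n < 6) :
    (l = [] ∧ M.IsSegment (M.flip s) (.corner x)) ∨
    (∃ e l', l = some (.edge e) :: l' ∧ M.IsSegment (M.flip s) (.edge e) ∧
      (l'.map cost).sum + 1 ≤ n ∧
      List.IsChain M.Follows (some (.edge e) :: (l' ++ [some (.corner x)]))) ∨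
    (∃ z v l', l = some (.corner z) :: some (.bdry v) :: l' ∧ M.IsSegment (M.flip s) (.corner z) ∧
      M.IsSegment (.bdry z) (.bdry v) ∧ (l'.map cost).sum + 1 ≤ n ∧
      List.IsChain M.Follows (some (.bdry v) :: (l' ++ [some (.corner x)]))) := by
  rcases l with _ | ⟨t, l⟩
  · exact .inl ⟨rfl, (List.isChain_cons_cons.mp h).1⟩
  rw [List.cons_append, List.isChain_cons_cons] at h
  obtain ⟨hst, htl⟩ := h
  rw [List.map_cons, List.sum_cons] at hl
  rcases hst.of_interior hs with rfl | ⟨e, rfl, hseg⟩ | ⟨z, rfl, hseg⟩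
  · rw [cost] at hl
    omega
  · rw [cost] at hl
    exact .inr (.inl ⟨e, l, rfl, hseg, by omega, htl⟩)
  · rcases l with _ | ⟨t, l⟩
    · obtain ⟨v, hv, -⟩ := (List.isChain_cons_cons.mp htl).1.bdry_of_corner
      cases hv
    rw [List.cons_append, List.isChain_cons_cons] at htl
    obtain ⟨v, rfl, hzv⟩ := htl.1.bdry_of_corner
    rw [List.map_cons, List.sum_cons, cost, cost] at hl
    exact .inr (.inr ⟨z, v, l, rfl, hseg, hzv, by omega, htl.2⟩)

end CombMap

namespace LinkDiagram.Direction

open CombMap Incidence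

variable {D : Type*} [Finite D] {L : LinkDiagram D} (A : L.Direction)

theorem not_isChain_edge (T : Incidence A.next A.prev A.opposite A.white) {x y e : A.Dart}
    (hxy : VertexSeg A.opposite x y) (hye : CornerEdgeSeg A.next A.prev A.opposite A.white y e)
    {l : List (Option (Side A.Dart))} (hl : (l.map cost).sum ≤ 1) :
    ¬ List.IsChain A.poly.Follows (some (.edge e) :: (l ++ [some (.corner x)])) := by
  intro h
  rcases A.poly.cases_of_isChain h trivial hl (by norm_num) with
    ⟨-, hs⟩ | ⟨e', l', -, hs, hl', h'⟩ | ⟨z, v, l', -, hs, hzv, hl', h'⟩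
  · exact T.no_disk_vertex_edge hxy hye (A.poly_α_eq e ▸ A.edgeCornerSeg hs)
  · rcases A.poly.cases_of_isChain (n := 0) h' trivial (by omega) (by norm_num) with
      ⟨-, hs'⟩ | ⟨_, _, -, -, hlt, -⟩ | ⟨_, _, _, -, -, -, hlt, -⟩
    · exact T.no_disk_vertex_edge_edge hxy hye (A.poly_α_eq e ▸ A.faceSeg_edge hs)
        (A.poly_α_eq e' ▸ A.edgeCornerSeg hs')
    · omega
    · omega
  · rcases A.poly.cases_of_isChain (n := 0) h' trivial (by omega) (by norm_num) with
      ⟨-, hs'⟩ | ⟨_, _, -, -, hlt, -⟩ | ⟨_, _, _, -, -, -, hlt, -⟩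
    · exact T.no_disk_vertex_edge_vertex hxy hye (A.poly_α_eq e ▸ A.edgeCornerSeg hs)
        (A.vertexSeg hzv) (A.faceSeg_corner hs')
    · omega
    · omega

/-- The bound on the cost allows at most three boundary segments and edges in total. -/
theorem isIdealDigon_or_isIdealTriangle (T : Incidence A.next A.prev A.opposite A.white)
    {x y : A.Dart} {l : List (Option (Side A.Dart))} (hl : (l.map cost).sum ≤ 2)
    (h : List.IsChain A.poly.Follows
      (some (.corner x) :: some (.bdry y) :: (l ++ [some (.corner x)]))) :
    (∃ z v, l = [some (.corner z), some (.bdry v)] ∧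
      IdealDigon A.next A.prev A.opposite A.white x y z v) ∨
    (∃ z v r s, l = [some (.corner z), some (.bdry v), some (.corner r), some (.bdry s)] ∧
      IdealTriangle A.next A.prev A.opposite A.white x y z v r s) := by
  rw [List.isChain_cons_cons] at h
  have hxy : VertexSeg A.opposite x y := A.vertexSeg h.1
  rcases A.poly.cases_of_isChain h.2 trivial hl (by norm_num) with
    ⟨-, hs⟩ | ⟨e, l', -, hs, hl', h'⟩ | ⟨z, v, l', rfl, hyz, hzv, hl', h'⟩
  · exact (T.no_disk_vertex hxy (A.faceSeg_corner hs)).elim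
  · exact (A.not_isChain_edge T hxy (A.cornerEdgeSeg hs) (by omega) h').elim
  rcases A.poly.cases_of_isChain (n := 1) h' trivial (by omega) (by norm_num) with
    ⟨rfl, hvx⟩ | ⟨e, l'', -, hve, hl'', h''⟩ | ⟨r, s, l'', rfl, hvr, hrs, hl'', h''⟩
  · exact .inl ⟨z, v, rfl, hxy, A.faceSeg_corner hyz, A.vertexSeg hzv, A.faceSeg_corner hvx⟩
  · rcases A.poly.cases_of_isChain (n := 0) h'' trivial (by omega) (by norm_num) with
      ⟨-, hs⟩ | ⟨_, _, -, -, hlt, -⟩ | ⟨_, _, _, -, -, -, hlt, -⟩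
    · exact (T.no_disk_vertex_vertex_edge hxy (A.faceSeg_corner hyz) (A.vertexSeg hzv)
        (A.cornerEdgeSeg hve) (A.poly_α_eq e ▸ A.edgeCornerSeg hs)).elim
    · omega
    · omega
  · rcases A.poly.cases_of_isChain (n := 0) h'' trivial (by omega) (by norm_num) with
      ⟨rfl, hsx⟩ | ⟨_, _, -, -, hlt, -⟩ | ⟨_, _, _, -, -, -, hlt, -⟩
    · exact .inr ⟨z, v, r, s, rfl, hxy, A.faceSeg_corner hyz, A.vertexSeg hzv,
        A.faceSeg_corner hvr, A.vertexSeg hrs, A.faceSeg_corner hsx⟩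
    · omega
    · omega

theorem steps_cases (T : Incidence A.next A.prev A.opposite A.white) (Δ : A.poly.AdmDisk)
    {p : Fin (Δ.k + 1)} {x y : A.Dart} (hx : Δ.step p = some (.corner x))
    (hy : Δ.step (p + 1) = some (.bdry y)) (hcost : ((Δ.steps p).map cost).sum ≤ 3) :
    (∃ z v, Δ.steps p = [some (.corner x), some (.bdry y), some (.corner z), some (.bdry v)] ∧
      IdealDigon A.next A.prev A.opposite A.white x y z v) ∨
    (∃ z v r s, Δ.steps p = [some (.corner x), some (.bdry y), some (.corner z), some (.bdry v),
        some (.corner r), some (.bdry s)] ∧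
      IdealTriangle A.next A.prev A.opposite A.white x y z v r s) := by
  obtain ⟨l, hl⟩ := Δ.steps_eq_cons p (by rw [hx, hy]; simp)
  rw [hx, hy] at hl
  rw [hl, List.map_cons, List.map_cons, List.sum_cons, List.sum_cons, cost, cost] at hcost
  have hchain := Δ.isChain_steps p
  rw [hl, hx, List.cons_append, List.cons_append] at hchain
  rw [hl]
  rcases A.isIdealDigon_or_isIdealTriangle T (by omega) hchain with
    ⟨z, v, rfl, h⟩ | ⟨z, v, r, s, rfl, h⟩
  · exact .inl ⟨z, v, rfl, h⟩
  · exact .inr ⟨z, v, r, s, rfl, h⟩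

theorem disk_cases (T : Incidence A.next A.prev A.opposite A.white) (Δ : A.poly.AdmDisk)
    (p : Fin (Δ.k + 1)) {x y : A.Dart} (hx : Δ.step p = some (.corner x))
    (hy : Δ.step (p + 1) = some (.bdry y)) :
    Real.pi / 2 ≤ Δ.relLength ∨
    (Δ.relLength = 0 ∧ ∃ z v, Δ.before p = some (.corner v) ∧ Δ.after p = some (.corner z) ∧
      IdealDigon A.next A.prev A.opposite A.white x y z v) ∨
    (Δ.relLength = Real.pi / 3 ∧ ∃ z v r s, Δ.before p = some (.corner s) ∧
      Δ.after p = some (.corner z) ∧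
      IdealTriangle A.next A.prev A.opposite A.white x y z v r s) := by
  classical
  have hsum := Δ.sum_cost p
  rcases le_or_gt 4 ((Δ.steps p).map cost).sum with h4 | h4
  · exact .inl (Δ.le_relLength (Δ.numBdry_pos hx) (hsum ▸ h4))
  right
  have hfree : Δ.numFree = _ := Δ.card_filter_step p (· = none)
  have hedges : Δ.numEdges = _ := Δ.card_filter_step p (fun s => ∃ x, s = some (.edge x))
  rw [AdmDisk.relLength, AdmDisk.area]
  rcases A.steps_cases T Δ hx hy (by omega) with ⟨z, v, hsteps, h⟩ | ⟨z, v, r, s, hsteps, h⟩ <;>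
    rw [hsteps] at hsum hfree hedges <;>
    simp only [List.map_cons, List.map_nil, List.sum_cons, List.sum_nil, cost, reduceCtorEq,
      exists_false, Option.some.injEq, if_false] at hsum hfree hedges
  · have hbdry : Δ.numBdry = 2 := by omega
    refine .inl ⟨?_, z, v, Δ.before_eq (l := [_, _, _]) hsteps,
      Δ.after_eq (congrArg (· ++ _) hsteps), h⟩
    rw [hfree, hedges, hbdry]
    norm_num
    ring
  · have hbdry : Δ.numBdry = 3 := by omega
    refine .inr ⟨?_, z, v, r, s, Δ.before_eq (l := [_, _, _, _, _]) hsteps,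
      Δ.after_eq (congrArg (· ++ _) hsteps), h⟩
    rw [hfree, hedges, hbdry]
    norm_num
    ring

end LinkDiagram.Direction

/-! ### Boundary tori -/

theorem Pos.mirror_mirror (p : Pos) : p.mirror.mirror = p := by cases p <;> rfl

theorem Pos.mirror_next (p : Pos) : p.next.mirror = p.mirror.prev := by cases p <;> rfl

theorem Pos.mirror_prev (p : Pos) : p.prev.mirror = p.mirror.next := by cases p <;> rfl

namespace LinkDiagram

variable {D : Type*} {L : LinkDiagram D}

theorem SameRegion.crossings_eq {d d' : D} (h : L.SameRegion d d') :
    L.crossings d = L.crossings d' := by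
  unfold crossings
  congr 2
  ext x
  exact ⟨fun h' => (h.symm).trans _ _ _ h', fun h' => Relation.EqvGen.trans _ _ _ h h'⟩

theorem sameRegion_σ (d : D) : L.SameRegion d (L.σ d) := .rel _ _ (.inl rfl)

theorem sameRegion_crossBigon (d : D) : L.SameRegion d (L.crossBigon d) := by
  by_cases hb : L.IsBigon d
  · rw [L.crossBigon_of_isBigon hb]
    refine Relation.EqvGen.trans _ (L.α d) _ (.rel _ _ (.inr ⟨hb, rfl⟩)) ?_
    rw [L.α_eq]
    exact (sameRegion_σ _).symm
  · rw [L.crossBigon_of_not_isBigon hb]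
    exact .refl _

theorem sameRegion_row (d : D) : L.SameRegion d (L.row d) :=
  (sameRegion_crossBigon d).trans _ _ _ ((sameRegion_σ _).trans _ _ _ (sameRegion_σ _))

theorem sameRegion_row_pow (d : D) (k : ℕ) : L.SameRegion d ((L.row ^ k) d) := by
  induction k with
  | zero => exact .refl _
  | succ k ih => rw [pow_succ']; exact ih.trans _ _ _ (sameRegion_row _)

namespace Direction

variable [Finite D] (A : L.Direction)

theorem crossings_otherTip (c : A.Tip) : L.crossings (A.otherTip c).1 = L.crossings c.1 := by
  obtain ⟨a, -, he, -⟩ := A.exists_otherTip_eq_row_pow c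
  rw [he]
  exact (sameRegion_row_pow _ _).crossings_eq.symm

theorem halfTwist_otherTip (c : A.Tip) : A.HalfTwist (A.otherTip c) ↔ A.HalfTwist c := by
  rw [HalfTwist, HalfTwist, crossings_otherTip]

/-- The gluing of shaded triangles, on corners. -/
def glueShaded (q : A.Shaded) : A.Shaded :=
  open Classical in (A.otherTip q.1, if A.HalfTwist q.1 then q.2 else q.2.mirror)

theorem glueShaded_glueShaded (q : A.Shaded) : A.glueShaded (A.glueShaded q) = q := by
  by_cases h : A.HalfTwist q.1
  · simp [glueShaded, h, halfTwist_otherTip, otherTip_otherTip]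
  · simp [glueShaded, h, halfTwist_otherTip, otherTip_otherTip, Pos.mirror_mirror]

theorem glueShaded_next_of_halfTwist {q : A.Shaded} (h : A.HalfTwist q.1) :
    A.glueShaded (A.next q) = A.next (A.glueShaded q) := by
  simp [glueShaded, next, h]

theorem glueShaded_next_of_not_halfTwist {q : A.Shaded} (h : ¬ A.HalfTwist q.1) :
    A.glueShaded (A.next q) = A.prev (A.glueShaded q) := by
  simp [glueShaded, next, prev, h, Pos.mirror_next]

theorem glueShaded_prev_of_halfTwist {q : A.Shaded} (h : A.HalfTwist q.1) :
    A.glueShaded (A.prev q) = A.prev (A.glueShaded q) := by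
  simp [glueShaded, prev, h]

theorem glueShaded_prev_of_not_halfTwist {q : A.Shaded} (h : ¬ A.HalfTwist q.1) :
    A.glueShaded (A.prev q) = A.next (A.glueShaded q) := by
  simp [glueShaded, next, prev, h, Pos.mirror_prev]

theorem glue_true (q : A.Shaded) (l : Bool) : A.glue ((q, true), l) = ((q, true), !l) := rfl

open Classical in
theorem glue_false (q : A.Shaded) (l : Bool) : A.glue ((q, false), l) =
    ((A.glueShaded q, false), if A.HalfTwist q.1 then !l else l) := by
  obtain ⟨c, p⟩ := q
  by_cases h : A.HalfTwist c <;> simp [glue, glueShaded, h]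

/-- The gluing of interior faces, on corners. -/
def glueCorner (x : A.Dart) : A.Dart := if x.2 then x else (A.glueShaded x.1, false)

theorem glueCorner_glueCorner (x : A.Dart) : A.glueCorner (A.glueCorner x) = x := by
  obtain ⟨q, _ | _⟩ := x <;> simp [glueCorner, glueShaded_glueShaded]

theorem glueSide_corner (x : A.Dart) : A.glueSide (.corner x) = .corner (A.glueCorner x) := by
  obtain ⟨⟨c, p⟩, _ | _⟩ := x
  · by_cases h : A.HalfTwist c <;> simp [glueSide, glueCorner, glueShaded, h]
  · rfl

theorem map_glueSide_eq_corner_iff (β : Option (Side A.Dart)) (x : A.Dart) :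
    β.map A.glueSide = some (.corner (A.glueCorner x)) ↔ β = some (.corner x) := by
  constructor
  · intro h
    rcases β with _ | (⟨⟨c, p⟩, _ | _⟩ | y | ⟨⟨c, p⟩, _ | _⟩)
    · cases h
    · by_cases ht : A.HalfTwist c <;> simp [glueSide, ht] at h
    · cases h
    · rw [Option.map_some, glueSide_corner, Option.some.injEq, Side.corner.injEq] at h
      rw [← A.glueCorner_glueCorner y, h, glueCorner_glueCorner]
    · by_cases ht : A.HalfTwist c <;> simp [glueSide, ht] at h
    · cases h
  · rintro rfl
    rw [Option.map_some, glueSide_corner]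

theorem poly_σ_eq (x : A.Dart) : A.poly.σ x = Incidence.rot A.opposite x := by
  obtain ⟨q, _ | _⟩ := x <;> rfl

theorem poly_σ_inv_eq (x : A.Dart) : A.poly.σ⁻¹ x = Incidence.rotInv A.opposite x := by
  obtain ⟨q, _ | _⟩ := x
  · exact A.poly_σ_inv_false q
  · rfl

theorem unitStep_add_two : ∀ e : ZMod 4, unitStep (e + 2) = -unitStep e := by decide

/-- A set of ideal vertices that lie on a common boundary torus, with a choice, at every vertex, of
one of its two shaded corners: entering the boundary rectangle there is going upwards. -/
structure Framing where
  on : A.Shaded → Prop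
  fw : A.Shaded → Bool
  on_opp : ∀ q, on q → on (A.opposite q)
  on_glue : ∀ q, on q → on (A.glueShaded q)
  fw_opp : ∀ q, on q → fw (A.opposite q) = !fw q
  fw_glue : ∀ q, on q → fw (A.glueShaded q) = !fw q

namespace Framing

open Incidence

variable {A} (R : A.Framing)

theorem on_opp_iff (q : A.Shaded) : R.on (A.opposite q) ↔ R.on q :=
  ⟨fun h => by simpa only [A.opposite_opposite] using R.on_opp _ h, R.on_opp q⟩

theorem on_glue_iff (q : A.Shaded) : R.on (A.glueShaded q) ↔ R.on q :=
  ⟨fun h => by simpa only [A.glueShaded_glueShaded] using R.on_glue _ h, R.on_glue q⟩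

theorem on_iff_of_sameTorus {z x : A.Dart × Bool} (h : A.SameTorus z x) :
    R.on z.1.1 ↔ R.on x.1.1 := by
  induction h with
  | rel x y h =>
    obtain ⟨⟨q, _ | _⟩, l⟩ := x
    · rcases h with rfl | rfl
      · rfl
      · rw [A.glue_false]; exact (R.on_glue_iff q).symm
    · rcases h with rfl | rfl
      · exact (R.on_opp_iff q).symm
      · rfl
  | refl => rfl
  | symm _ _ _ ih => exact ih.symm
  | trans _ _ _ _ _ ih₁ ih₂ => exact ih₁.trans ih₂

theorem on_of_vertexSeg {x y : A.Dart} (h : VertexSeg A.opposite x y) (hx : R.on x.1) :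
    R.on y.1 := by
  rcases h.1 with h | h
  · rwa [h]
  · rw [h]; exact R.on_opp _ hx

theorem on_enter {z : A.Dart × Bool} {γ : A.Curve} (hz : R.on z.1.1) (ht : A.OnTorus z γ)
    (i : Fin (γ.m + 1)) : R.on (γ.seg i).enter.1 :=
  (R.on_iff_of_sameTorus (ht i)).mp hz

theorem on_exit {z : A.Dart × Bool} {γ : A.Curve} (hz : R.on z.1.1) (hs : A.IsSimplicial γ)
    (ht : A.OnTorus z γ) (i : Fin (γ.m + 1)) : R.on (γ.seg i).exit.1 :=
  R.on_of_vertexSeg (A.vertexSeg (hs i).1) (R.on_enter hz ht i)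

/-- The direction in which a curve enters a boundary rectangle through the side `x`, numbered as in
`unitStep`. -/
def dir (x : A.Dart) (l : Bool) : ZMod 4 :=
  if x.2 then (if R.fw x.1 = l then 1 else 3) else (if R.fw x.1 then 0 else 2)

theorem dir_opposite {x : A.Dart} (hx : R.on x.1) (l : Bool) :
    R.dir (A.opposite x.1, x.2) l = R.dir x l + 2 := by
  obtain ⟨q, b⟩ := x
  simp only [dir, R.fw_opp q hx]
  cases b <;> cases R.fw q <;> cases l <;> decide

theorem dir_rot {x : A.Dart} (hx : R.on x.1) (l : Bool) :
    R.dir (rot A.opposite x) l = R.dir x l + if l then 1 else -1 := by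
  obtain ⟨q, _ | _⟩ := x <;>
    simp only [dir, rot, R.fw_opp q hx, Bool.false_eq_true, if_false, if_true] <;>
    cases R.fw q <;> cases l <;> decide

theorem dir_rotInv {x : A.Dart} (hx : R.on x.1) (l : Bool) :
    R.dir (rotInv A.opposite x) l = R.dir x l - if l then 1 else -1 := by
  obtain ⟨q, _ | _⟩ := x <;>
    simp only [dir, rotInv, R.fw_opp q hx, Bool.false_eq_true, if_false, if_true] <;>
    cases R.fw q <;> cases l <;> decide

theorem dir_glue {y x : A.Dart} {l l' : Bool} (hy : R.on y.1) (h : A.glue (y, l) = (x, l')) :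
    R.dir x l' = R.dir y l + 2 := by
  classical
  obtain ⟨q, _ | _⟩ := y
  · rw [A.glue_false] at h
    obtain ⟨rfl, -⟩ := Prod.mk.inj h
    simp only [dir, R.fw_glue q hy, Bool.false_eq_true, if_false]
    cases R.fw q <;> decide
  · rw [A.glue_true] at h
    obtain ⟨rfl, rfl⟩ := Prod.mk.inj h
    simp only [dir, if_true]
    cases R.fw q <;> cases l <;> decide

theorem turn_eq {g : A.Seg} (hg : R.on g.enter.1)
    (h : A.poly.IsSegment (.bdry g.enter) (.bdry g.exit)) :
    A.turn g = R.dir g.exit g.level + 2 - R.dir g.enter g.level := by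
  have hne : A.opposite g.enter.1 ≠ g.enter.1 := fun h => by simpa [h] using R.fw_opp _ hg
  have hopp := R.dir_opposite hg g.level
  have hrot := R.dir_rot hg g.level
  have hrotInv := R.dir_rotInv hg g.level
  have hcases : g.exit = (A.opposite g.enter.1, g.enter.2) ∨
      g.exit = rot A.opposite g.enter ∨ g.exit = rotInv A.opposite g.enter := by
    have := (A.vertexSeg h).cases
    cases hb : g.enter.2 <;> simp only [rot, rotInv, hb] at this ⊢ <;> tauto
  rw [Direction.turn, poly_σ_eq, poly_σ_inv_eq]
  rcases hcases with hy | hy | hy <;> rw [hy]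
  · rw [hopp, if_neg, if_neg, zero_mul]
    · generalize R.dir g.enter g.level = e
      revert e
      decide
    · cases hb : g.enter.2 <;> simp [rotInv, hb]
    · cases hb : g.enter.2 <;> simp [rot, hb]
  · rw [hrot, if_pos rfl]
    generalize R.dir g.enter g.level = e
    cases g.level <;> revert e <;> decide
  · rw [hrotInv, if_neg, if_pos rfl]
    · generalize R.dir g.enter g.level = e
      cases g.level <;> revert e <;> decide
    · cases hb : g.enter.2 <;> simp [rot, rotInv, hb, hne, hne.symm]

/-- The outward normal at the side `x` of a boundary rectangle. -/
def out (x : A.Dart) (l : Bool) : ℤ × ℤ := unitStep (R.dir x l + 2)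

theorem out_true (q : A.Shaded) (l : Bool) :
    R.out (q, true) l = if R.fw q = l then (-1, 0) else (1, 0) := by
  simp only [out, dir]
  cases R.fw q <;> cases l <;> rfl

theorem out_false (q : A.Shaded) (l : Bool) :
    R.out (q, false) l = if R.fw q then (0, -1) else (0, 1) := by
  simp only [out, dir]
  cases R.fw q <;> rfl

/-- The displacement of a closed curve, in terms of the framing instead of the beginning of the
curve. -/
def total (γ : A.Curve) : ℤ × ℤ := ∑ i, R.out (γ.seg i).exit (γ.seg i).level

variable {z : A.Dart × Bool} {γ : A.Curve}

theorem sum_turn_eq (hz : R.on z.1.1) (hs : A.IsSimplicial γ) (ht : A.OnTorus z γ)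
    (i : Fin (γ.m + 1)) : ∑ j ∈ Finset.univ.filter (· ≤ i), A.turn (γ.seg j)
      = R.dir (γ.seg i).exit (γ.seg i).level + 2 - R.dir (γ.seg 0).enter (γ.seg 0).level := by
  induction i using Fin.induction with
  | zero =>
    have hfilter : (Finset.univ.filter (· ≤ (0 : Fin (γ.m + 1)))) = {0} := by
      ext j; simp
    rw [hfilter, Finset.sum_singleton, R.turn_eq (R.on_enter hz ht 0) (hs 0).1]
  | succ i ih =>
    have hfilter : (Finset.univ.filter (· ≤ i.succ))
        = insert i.succ (Finset.univ.filter (· ≤ i.castSucc)) := by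
      ext j
      simp only [Finset.mem_filter, Finset.mem_univ, true_and, Finset.mem_insert, Fin.le_def,
        Fin.ext_iff, Fin.val_succ, Fin.val_castSucc]
      omega
    have hglue := R.dir_glue (R.on_exit hz hs ht i.castSucc) (hs i.castSucc).2
    rw [Fin.coeSucc_eq_succ] at hglue
    rw [hfilter, Finset.sum_insert (by simp [Fin.le_def]), ih,
      R.turn_eq (R.on_enter hz ht _) (hs _).1, hglue]
    ring

theorem startDir_eq_or (γ : A.Curve) :
    A.startDir γ = R.dir (γ.seg 0).enter (γ.seg 0).level ∨
      A.startDir γ = R.dir (γ.seg 0).enter (γ.seg 0).level + 2 := by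
  rw [startDir, dir]
  split_ifs <;> decide

theorem disp_eq_total (hz : R.on z.1.1) (hs : A.IsSimplicial γ) (ht : A.OnTorus z γ)
    (h : A.startDir γ = R.dir (γ.seg 0).enter (γ.seg 0).level) : A.disp γ = R.total γ := by
  refine Finset.sum_congr rfl fun i _ => ?_
  rw [R.sum_turn_eq hz hs ht, h, out]
  congr 1; ring

theorem disp_eq_neg_total (hz : R.on z.1.1) (hs : A.IsSimplicial γ) (ht : A.OnTorus z γ)
    (h : A.startDir γ = R.dir (γ.seg 0).enter (γ.seg 0).level + 2) :
    A.disp γ = -R.total γ := by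
  rw [total, ← Finset.sum_neg_distrib]
  refine Finset.sum_congr rfl fun i _ => ?_
  rw [R.sum_turn_eq hz hs ht, h, out, ← unitStep_add_two]
  congr 1; ring

theorem disp_eq_or (hz : R.on z.1.1) (hs : A.IsSimplicial γ) (ht : A.OnTorus z γ) :
    A.disp γ = R.total γ ∨ A.disp γ = -R.total γ :=
  (R.startDir_eq_or γ).imp (R.disp_eq_total hz hs ht) (R.disp_eq_neg_total hz hs ht)

end Framing

end Direction

end LinkDiagram

/-! ### Tracked points -/

namespace LinkDiagram.Direction

open Incidence

variable {D : Type*} {L : LinkDiagram D}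

theorem next_ne_prev (A : L.Direction) (q : A.Shaded) : A.next q ≠ A.prev q := by
  obtain ⟨c, _ | _ | _⟩ := q <;> simp [next, prev, Pos.next, Pos.prev]

variable [Finite D] (A : L.Direction)

/-- Whether a disk that crosses the side `x` of a boundary rectangle runs, in the adjacent face,
straight to the next ideal vertex (`1`), straight to the previous one (`-1`), or elsewhere (`0`);
`β` is the other end of its segment in this face. -/
def heading (x : A.Dart) (β : Option (Side A.Dart)) : ℤ :=
  open Classical in
  if β = some (.corner (nextCorner A.next A.prev A.opposite x)) then 1
  else if β = some (.corner (prevCorner A.next A.prev A.opposite x)) then -1 else 0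

theorem abs_heading_le (x : A.Dart) (β : Option (Side A.Dart)) : |A.heading x β| ≤ 1 := by
  rw [heading]
  split_ifs <;> decide

theorem heading_nextCorner (x : A.Dart) :
    A.heading x (some (.corner (nextCorner A.next A.prev A.opposite x))) = 1 :=
  if_pos rfl

variable {A}

theorem heading_prevCorner (T : Incidence A.next A.prev A.opposite A.white) (x : A.Dart) :
    A.heading x (some (.corner (prevCorner A.next A.prev A.opposite x))) = -1 := by
  rw [heading, if_neg (by simpa using (T.nextCorner_ne_prevCorner x).symm), if_pos rfl]

theorem heading_glue_true (q : A.Shaded) (β : Option (Side A.Dart)) :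
    A.heading (q, true) (β.map A.glueSide) = A.heading (q, true) β := by
  simp only [heading]
  congr 1
  · exact propext (A.map_glueSide_eq_corner_iff β (nextCorner A.next A.prev A.opposite (q, true)))
  · congr 1
    exact propext (A.map_glueSide_eq_corner_iff β (prevCorner A.next A.prev A.opposite (q, true)))

theorem map_glueSide_eq_shaded_iff (β : Option (Side A.Dart)) (q : A.Shaded) :
    β.map A.glueSide = some (.corner (A.glueShaded q, false)) ↔ β = some (.corner (q, false)) :=
  A.map_glueSide_eq_corner_iff β (q, false)

theorem heading_glue_of_halfTwist {q : A.Shaded} (h : A.HalfTwist q.1)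
    (β : Option (Side A.Dart)) :
    A.heading (A.glueShaded q, false) (β.map A.glueSide) = A.heading (q, false) β := by
  classical
  simp only [heading, nextCorner, prevCorner, Bool.false_eq_true, if_false,
    ← A.glueShaded_next_of_halfTwist h, ← A.glueShaded_prev_of_halfTwist h,
    map_glueSide_eq_shaded_iff]

theorem heading_glue_of_not_halfTwist {q : A.Shaded} (h : ¬ A.HalfTwist q.1)
    (β : Option (Side A.Dart)) :
    A.heading (A.glueShaded q, false) (β.map A.glueSide) = -A.heading (q, false) β := by
  classical
  have hne := A.next_ne_prev q
  simp only [heading, nextCorner, prevCorner, Bool.false_eq_true, if_false,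
    ← A.glueShaded_next_of_not_halfTwist h, ← A.glueShaded_prev_of_not_halfTwist h,
    map_glueSide_eq_shaded_iff]
  split_ifs <;> simp_all

theorem heading_of_straight (T : Incidence A.next A.prev A.opposite A.white)
    {x y z v r s : A.Dart} (h : IdealTriangle A.next A.prev A.opposite A.white x y z v r s)
    (hy : y = (A.opposite x.1, x.2)) :
    A.heading y (some (.corner z)) = -A.heading x (some (.corner s)) := by
  have hx : x = (A.opposite y.1, y.2) := by rw [hy, A.opposite_opposite]
  obtain ⟨h₁, h₂⟩ := h.eq_of_straight T hy
  obtain ⟨h₃, h₄⟩ := (h.reverse T).eq_of_straight T hx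
  by_cases hs : s = nextCorner A.next A.prev A.opposite x
  · rw [h₁ hs, hs, heading_nextCorner, heading_prevCorner T]
  by_cases hs' : s = prevCorner A.next A.prev A.opposite x
  · rw [h₂ hs', hs', heading_nextCorner, heading_prevCorner T, neg_neg]
  simp [heading, hs, hs', mt h₃ hs', mt h₄ hs]

namespace Framing

variable (R : A.Framing)

theorem on_rot {x : A.Dart} (hx : R.on x.1) : R.on (rot A.opposite x).1 := by
  obtain ⟨q, _ | _⟩ := x
  · exact hx
  · exact R.on_opp q hx

theorem out_opposite {x : A.Dart} (hx : R.on x.1) (l : Bool) :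
    R.out (A.opposite x.1, x.2) l = -R.out x l := by
  rw [out, R.dir_opposite hx, unitStep_add_two, out]

theorem out_rotInv {x : A.Dart} (hx : R.on x.1) (l : Bool) :
    R.out (rotInv A.opposite x) l = -R.out (rot A.opposite x) l := by
  rw [out, out, ← unitStep_add_two, R.dir_rotInv hx, R.dir_rot hx]
  congr 1
  generalize R.dir x l = e
  cases l <;> revert e <;> decide

theorem out_glue {y x : A.Dart} {l l' : Bool} (hy : R.on y.1) (h : A.glue (y, l) = (x, l')) :
    R.out x l' = -R.out y l := by
  rw [out, R.dir_glue hy h, unitStep_add_two, out]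

/-- Twice the position, relative to the centre of a boundary rectangle, of the point tracked when a
curve crosses the side `x`: the end of this side towards the ideal vertex to which the disk runs
through the adjacent face, or else the midpoint of the side. -/
def offset (x : A.Dart) (β : Option (Side A.Dart)) (l : Bool) : ℤ × ℤ :=
  R.out x l + A.heading x β • R.out (rotInv A.opposite x) l

theorem heading_smul_out_glue {y x : A.Dart} {l l' : Bool} (hy : R.on y.1)
    (h : A.glue (y, l) = (x, l')) (β : Option (Side A.Dart)) :
    A.heading x (β.map A.glueSide) • R.out (rotInv A.opposite x) l' =
      A.heading y β • R.out (rotInv A.opposite y) l := by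
  classical
  obtain ⟨q, _ | _⟩ := y
  · have hfw : R.fw (A.opposite (A.glueShaded q)) = !R.fw (A.opposite q) := by
      rw [R.fw_opp _ (R.on_glue q hy), R.fw_glue q hy, R.fw_opp q hy]
    rw [A.glue_false] at h
    obtain ⟨rfl, rfl⟩ := Prod.mk.inj h
    simp only [rotInv, Bool.false_eq_true, if_false, out_true, hfw]
    by_cases ht : A.HalfTwist q.1
    · rw [heading_glue_of_halfTwist ht, if_pos ht]
      cases R.fw (A.opposite q) <;> cases l <;> rfl
    · rw [heading_glue_of_not_halfTwist ht, if_neg ht]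
      cases R.fw (A.opposite q) <;> cases l <;> simp
  · rw [A.glue_true] at h
    obtain ⟨rfl, rfl⟩ := Prod.mk.inj h
    rw [heading_glue_true]
    rfl

theorem offset_glue {y x : A.Dart} {l l' : Bool} (hy : R.on y.1) (h : A.glue (y, l) = (x, l'))
    (β : Option (Side A.Dart)) :
    R.offset x (β.map A.glueSide) l' = R.offset y β l - 2 • R.out y l := by
  rw [offset, offset, R.out_glue hy h, R.heading_smul_out_glue hy h, two_smul]
  abel

theorem abs_out_add_abs_out_rotInv_le {x : A.Dart} (hx : R.on x.1) (l : Bool) :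
    |(R.out x l).1| + |(R.out (rotInv A.opposite x) l).1| ≤ 1 ∧
      |(R.out x l).2| + |(R.out (rotInv A.opposite x) l).2| ≤ 1 := by
  rw [out, out, R.dir_rotInv hx]
  generalize R.dir x l = e
  cases l <;> revert e <;> decide

theorem abs_offset_le {x : A.Dart} (hx : R.on x.1) (β : Option (Side A.Dart)) (l : Bool) :
    |(R.offset x β l).1| ≤ 1 ∧ |(R.offset x β l).2| ≤ 1 := by
  obtain ⟨h₁, h₂⟩ := R.abs_out_add_abs_out_rotInv_le hx l
  have hle (n : ℤ) : |A.heading x β * n| ≤ |n| := by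
    rw [abs_mul]
    exact mul_le_of_le_one_left (abs_nonneg n) (A.abs_heading_le x β)
  exact ⟨(abs_add_le _ _).trans ((add_le_add_right (hle _) _).trans h₁),
    (abs_add_le _ _).trans ((add_le_add_right (hle _) _).trans h₂)⟩

theorem offset_eq_of_idealDigon (T : Incidence A.next A.prev A.opposite A.white)
    {x y z v : A.Dart} (h : IdealDigon A.next A.prev A.opposite A.white x y z v) (hx : R.on x.1)
    (hy : R.on y.1) (l : Bool) :
    R.offset y (some (.corner z)) l = R.offset x (some (.corner v)) l := by
  rcases h.cases T with ⟨hyx, rfl, rfl⟩ | ⟨hyx, rfl, rfl⟩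
  · rw [offset, offset, heading_nextCorner, heading_prevCorner T, R.out_rotInv hx, hyx,
      T.rotInv_rot]
    module
  · have hxy : x = rot A.opposite y := by rw [hyx, T.rot_rotInv]
    rw [offset, offset, heading_nextCorner, heading_prevCorner T, R.out_rotInv hy, ← hyx, ← hxy]
    module

theorem weight_smul_out_le {n : ℤ} (hn : |n| ≤ 2) (x : A.Dart) (l : Bool) :
    2 * |(n • R.out x l).1| + |(n • R.out x l).2| ≤ 4 := by
  have hunit : ∀ e, 2 * |(unitStep e).1| + |(unitStep e).2| ≤ 2 := by decide
  have := hunit (R.dir x l + 2)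
  rw [Prod.smul_fst, Prod.smul_snd, smul_eq_mul, smul_eq_mul, abs_mul, abs_mul, out]
  nlinarith [abs_nonneg n]

theorem weight_offset_sub_le_of_rot (T : Incidence A.next A.prev A.opposite A.white)
    {x y z v r s : A.Dart} (h : IdealTriangle A.next A.prev A.opposite A.white x y z v r s)
    (hyx : y = rot A.opposite x) (hx : R.on x.1) (l : Bool) :
    2 * |(R.offset y (some (.corner z)) l - R.offset x (some (.corner s)) l).1| +
      |(R.offset y (some (.corner z)) l - R.offset x (some (.corner s)) l).2| ≤ 4 := by
  have hout : R.out (rotInv A.opposite x) l = -R.out y l := by rw [R.out_rotInv hx, hyx]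
  have hrot : rotInv A.opposite y = x := by rw [hyx, T.rotInv_rot]
  have hz := abs_le.mp (A.abs_heading_le y (some (.corner z)))
  have hs := abs_le.mp (A.abs_heading_le x (some (.corner s)))
  rcases h.eq_or_eq_of_rot T hyx with rfl | rfl
  · have hdiff : R.offset y (some (.corner z)) l -
        R.offset x (some (.corner (prevCorner A.next A.prev A.opposite x))) l =
        (A.heading y (some (.corner z)) - 1) • R.out x l := by
      rw [offset, offset, heading_prevCorner T, hout, hrot]
      module
    rw [hdiff]
    exact R.weight_smul_out_le (abs_le.mpr ⟨by linarith, by linarith⟩) x l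
  · have hdiff : R.offset y (some (.corner (nextCorner A.next A.prev A.opposite y))) l -
        R.offset x (some (.corner s)) l =
        (1 + A.heading x (some (.corner s))) • R.out y l := by
      rw [offset, offset, heading_nextCorner, hout, hrot]
      module
    rw [hdiff]
    exact R.weight_smul_out_le (abs_le.mpr ⟨by linarith, by linarith⟩) y l

theorem weight_offset_sub_le_of_straight (T : Incidence A.next A.prev A.opposite A.white)
    {x y z v r s : A.Dart} (h : IdealTriangle A.next A.prev A.opposite A.white x y z v r s)
    (hyx : y = (A.opposite x.1, x.2)) (hx : R.on x.1) (l : Bool) :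
    2 * |(R.offset y (some (.corner z)) l - R.offset x (some (.corner s)) l).1| +
      |(R.offset y (some (.corner z)) l - R.offset x (some (.corner s)) l).2| ≤ 4 := by
  have hy : R.on y.1 := hyx ▸ R.on_opp _ hx
  have hrot : rot A.opposite y = (A.opposite (rot A.opposite x).1, (rot A.opposite x).2) := by
    rw [hyx]
    obtain ⟨q, _ | _⟩ := x <;> rfl
  have hdiff : R.offset y (some (.corner z)) l - R.offset x (some (.corner s)) l =
      (-2 : ℤ) • R.out x l := by
    rw [offset, offset, heading_of_straight T h hyx, R.out_rotInv hy, hrot,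
      R.out_opposite (R.on_rot hx), R.out_rotInv hx, hyx, R.out_opposite hx]
    module
  rw [hdiff]
  exact R.weight_smul_out_le (by norm_num) x l

theorem weight_offset_sub_le (T : Incidence A.next A.prev A.opposite A.white)
    {x y z v r s : A.Dart} (h : IdealTriangle A.next A.prev A.opposite A.white x y z v r s)
    (hx : R.on x.1) (hy : R.on y.1) (l : Bool) :
    2 * |(R.offset y (some (.corner z)) l - R.offset x (some (.corner s)) l).1| +
      |(R.offset y (some (.corner z)) l - R.offset x (some (.corner s)) l).2| ≤ 4 := by
  have hcases : y = (A.opposite x.1, x.2) ∨ y = rot A.opposite x ∨ y = rotInv A.opposite x := by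
    have := h.segment₁.cases
    cases hb : x.2 <;> simp only [rot, rotInv, hb] at this ⊢ <;> tauto
  rcases hcases with hyx | hyx | hyx
  · exact R.weight_offset_sub_le_of_straight T h hyx hx l
  · exact R.weight_offset_sub_le_of_rot T h hyx hx l
  · have hxy : x = rot A.opposite y := by rw [hyx, T.rot_rotInv]
    have := R.weight_offset_sub_le_of_rot T (h.reverse T) hxy hy l
    rwa [← neg_sub, Prod.fst_neg, Prod.snd_neg, abs_neg, abs_neg]

theorem offset_sub_le_relLength (T : Incidence A.next A.prev A.opposite A.white)
    (Δ : A.poly.AdmDisk) (p : Fin (Δ.k + 1)) {x y : A.Dart} (hx : R.on x.1) (hy : R.on y.1)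
    (hx' : Δ.step p = some (.corner x)) (hy' : Δ.step (p + 1) = some (.bdry y)) (l : Bool) :
    (2 * |((R.offset y (Δ.after p) l - R.offset x (Δ.before p) l).1 : ℝ)| +
      |((R.offset y (Δ.after p) l - R.offset x (Δ.before p) l).2 : ℝ)|) * (Real.pi / 12)
        ≤ Δ.relLength ∧
    |((R.offset y (Δ.after p) l - R.offset x (Δ.before p) l).2 : ℝ)| * (Real.pi / 6)
        ≤ Δ.relLength := by
  have hpi := Real.pi_pos
  obtain ⟨hx₁, hx₂⟩ := R.abs_offset_le hx (Δ.before p) l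
  obtain ⟨hy₁, hy₂⟩ := R.abs_offset_le hy (Δ.after p) l
  have h₁ : |(R.offset y (Δ.after p) l - R.offset x (Δ.before p) l).1| ≤ 2 :=
    (abs_sub _ _).trans (by linarith)
  have h₂ : |(R.offset y (Δ.after p) l - R.offset x (Δ.before p) l).2| ≤ 2 :=
    (abs_sub _ _).trans (by linarith)
  rcases A.disk_cases T Δ p hx' hy' with h | ⟨h, z, v, hb, ha, hdigon⟩ |
    ⟨h, z, v, r, s, hb, ha, htriangle⟩
  · generalize R.offset y (Δ.after p) l - R.offset x (Δ.before p) l = w at *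
    have h₁' : |(w.1 : ℝ)| ≤ 2 := by exact_mod_cast h₁
    have h₂' : |(w.2 : ℝ)| ≤ 2 := by exact_mod_cast h₂
    constructor <;> nlinarith
  · rw [hb, ha, R.offset_eq_of_idealDigon T hdigon hx hy, h]
    simp
  · have h₃ := R.weight_offset_sub_le T htriangle hx hy l
    rw [← hb, ← ha] at h₃
    generalize R.offset y (Δ.after p) l - R.offset x (Δ.before p) l = w at *
    have h₂' : |(w.2 : ℝ)| ≤ 2 := by exact_mod_cast h₂
    have h₃' : 2 * |(w.1 : ℝ)| + |(w.2 : ℝ)| ≤ 4 := by exact_mod_cast h₃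
    rw [h]
    constructor <;> nlinarith

variable {z : A.Dart × Bool} {γ : A.Curve} (H : A.InwardExtension γ)

/-- Twice the motion of the tracked point across the boundary rectangle of the `i`-th segment. -/
def drift (i : Fin (γ.m + 1)) : ℤ × ℤ :=
  R.offset (γ.seg i).exit ((H.disk i).after (H.pos i)) (γ.seg i).level -
    R.offset (γ.seg i).enter ((H.disk i).before (H.pos i)) (γ.seg i).level

theorem sum_drift (hz : R.on z.1.1) (hs : A.IsSimplicial γ) (ht : A.OnTorus z γ) :
    ∑ i, R.drift H i = 2 • R.total γ := by
  set b : Fin (γ.m + 1) → ℤ × ℤ := fun i =>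
    R.offset (γ.seg i).enter ((H.disk i).before (H.pos i)) (γ.seg i).level with hb
  have hdrift : ∀ i, R.drift H i
      = 2 • R.out (γ.seg i).exit (γ.seg i).level + (b (i + 1) - b i) := by
    intro i
    have hglue := R.offset_glue (R.on_exit hz hs ht i) (hs i).2 ((H.disk i).after (H.pos i))
    rw [← H.agree i] at hglue
    simp only [drift, hb, hglue]
    abel
  have hshift : ∑ i, b (i + 1) = ∑ i, b i := Equiv.sum_comp (Equiv.addRight 1) b
  rw [Finset.sum_congr rfl fun i _ => hdrift i, Finset.sum_add_distrib, Finset.sum_sub_distrib,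
    hshift, sub_self, add_zero, total, Finset.smul_sum]

theorem two_mul_abs_total_le (hz : R.on z.1.1) (hs : A.IsSimplicial γ) (ht : A.OnTorus z γ) :
    2 * |((R.total γ).1 : ℝ)| ≤ ∑ i, |((R.drift H i).1 : ℝ)| ∧
      2 * |((R.total γ).2 : ℝ)| ≤ ∑ i, |((R.drift H i).2 : ℝ)| := by
  have hsum := R.sum_drift H hz hs ht
  have h₁ : (∑ i, (R.drift H i).1 : ℤ) = 2 * (R.total γ).1 := by
    simpa [Prod.fst_sum] using congrArg Prod.fst hsum
  have h₂ : (∑ i, (R.drift H i).2 : ℤ) = 2 * (R.total γ).2 := by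
    simpa [Prod.snd_sum] using congrArg Prod.snd hsum
  have habs (n : ℤ) : 2 * |(n : ℝ)| = |((2 * n : ℤ) : ℝ)| := by push_cast; rw [abs_mul, abs_two]
  rw [habs, habs, ← h₁, ← h₂, Int.cast_sum, Int.cast_sum]
  exact ⟨Finset.abs_sum_le_sum_abs _ _, Finset.abs_sum_le_sum_abs _ _⟩

theorem total_le_sum_relLength (T : Incidence A.next A.prev A.opposite A.white)
    (hz : R.on z.1.1) (hs : A.IsSimplicial γ) (ht : A.OnTorus z γ) :
    |((R.total γ).1 : ℝ)| * (Real.pi / 3) + |((R.total γ).2 : ℝ)| * (Real.pi / 6)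
      ≤ ∑ i, (H.disk i).relLength ∧
    |((R.total γ).2 : ℝ)| * (Real.pi / 3) ≤ ∑ i, (H.disk i).relLength := by
  have hpi := Real.pi_pos
  obtain ⟨h₁, h₂⟩ := R.two_mul_abs_total_le H hz hs ht
  have hle := fun i => R.offset_sub_le_relLength T (H.disk i) (H.pos i) (R.on_enter hz ht i)
    (R.on_exit hz hs ht i) (H.enter i) (H.exit i) (γ.seg i).level
  have hweight := Finset.sum_le_sum fun i (_ : i ∈ Finset.univ) => (hle i).1
  have hheight := Finset.sum_le_sum fun i (_ : i ∈ Finset.univ) => (hle i).2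
  rw [← Finset.sum_mul] at hweight hheight
  rw [Finset.sum_add_distrib, ← Finset.mul_sum] at hweight
  simp only [drift] at h₁ h₂
  exact ⟨le_trans (by nlinarith) hweight, le_trans (by nlinarith) hheight⟩

end Framing

end LinkDiagram.Direction

/-! ### Combinatorial lengths of curves -/

namespace LinkDiagram.Direction

variable {D : Type*} {L : LinkDiagram D} [Finite D] (A : L.Direction)

theorem poly_sameVertex {x y : A.Dart} (h : y.1 = x.1 ∨ y.1 = A.opposite x.1) :
    A.poly.SameVertex x y := by
  have hσ (x : A.Dart) : A.poly.SameVertex x (A.poly.σ x) :=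
    Equiv.Perm.sameCycle_apply_right.mpr (.refl _ _)
  have hfalse : ∀ x : A.Dart, A.poly.SameVertex (x.1, false) x := by
    rintro ⟨q, _ | _⟩
    · exact .refl _ _
    · exact hσ (q, false)
  have hopp (q : A.Shaded) : A.poly.SameVertex (q, false) (A.opposite q, false) :=
    (hσ (q, false)).trans (hσ (q, true))
  rcases h with h | h
  · exact (hfalse x).symm.trans (h ▸ hfalse y)
  · exact ((hfalse x).symm.trans (hopp x.1)).trans (h ▸ hfalse y)

theorem isSegment_bdry {x y : A.Dart} (h : y.1 = x.1 ∨ y.1 = A.opposite x.1) (hne : y ≠ x) :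
    A.poly.IsSegment (.bdry x) (.bdry y) :=
  ⟨A.poly_sameVertex h, by simpa using hne, by simp [CombMap.flip], id, id⟩

variable {A} in
theorem sameTorus_of_sameVertex {x y : A.Dart} (h : A.poly.SameVertex x y) (l : Bool) :
    A.SameTorus (x, l) (y, l) :=
  Quotient.exact (s := Relation.EqvGen.setoid _) (eq_of_sameCycle
    (f := fun x => (Quotient.mk (Relation.EqvGen.setoid _) (x, l)))
    (fun _ => Quotient.sound (.symm _ _ (.rel _ _ (.inl rfl)))) h)

theorem sameTorus_glue (x : A.Dart × Bool) : A.SameTorus x (A.glue x) := .rel _ _ (.inr rfl)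

variable {A} in
theorem IsSimplicial.onTorus {γ : A.Curve} (hs : A.IsSimplicial γ) {z : A.Dart × Bool}
    (hz : A.SameTorus z ((γ.seg 0).enter, (γ.seg 0).level)) : A.OnTorus z γ := by
  intro i
  induction i using Fin.induction with
  | zero => exact hz
  | succ i ih =>
    have hglue := A.sameTorus_glue ((γ.seg i.castSucc).exit, (γ.seg i.castSucc).level)
    rw [(hs i.castSucc).2, Fin.coeSucc_eq_succ] at hglue
    exact (ih.trans _ _ _ (sameTorus_of_sameVertex (hs i.castSucc).1.1 _)).trans _ _ _ hglue

theorem isSimplicial_pair {g h : A.Seg} (hg : A.poly.IsSegment (.bdry g.enter) (.bdry g.exit))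
    (hh : A.poly.IsSegment (.bdry h.enter) (.bdry h.exit))
    (hgh : A.glue (g.exit, g.level) = (h.enter, h.level))
    (hhg : A.glue (h.exit, h.level) = (g.enter, g.level)) : A.IsSimplicial ⟨1, ![g, h]⟩ := by
  refine Fin.forall_fin_two.mpr ⟨⟨hg, hgh⟩, ⟨hh, ?_⟩⟩
  simp only [show (1 : Fin (1 + 1)) + 1 = 0 by decide]
  exact hhg

/-- A disk that cuts off a boundary segment by an arc through the interior. -/
def freeDisk (x y : A.Dart) (h : A.poly.IsSegment (.bdry x) (.bdry y)) : A.poly.AdmDisk where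
  k := 2
  step := ![some (.corner x), some (.bdry y), none]
  follows i := by
    fin_cases i
    · exact h
    · trivial
    · trivial

/-- An inward extension by disks with arcs through the interior. -/
def freeExtension (γ : A.Curve) (hs : A.IsSimplicial γ) : A.InwardExtension γ where
  disk i := A.freeDisk _ _ (hs i).1
  pos _ := (0 : Fin 3)
  enter _ := rfl
  exit _ := rfl
  agree _ := rfl

theorem le_curveLength {γ : A.Curve} (hs : A.IsSimplicial γ) {r : ℝ}
    (h : ∀ H : A.InwardExtension γ, r ≤ ∑ i, (H.disk i).relLength) : r ≤ A.curveLength γ := by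
  refine le_csInf ⟨_, A.freeExtension γ hs, rfl⟩ ?_
  rintro _ ⟨H, rfl⟩
  exact h H

variable {A} in
theorem Framing.le_curveLength (R : A.Framing)
    (T : Incidence A.next A.prev A.opposite A.white) {z : A.Dart × Bool} (hz : R.on z.1.1)
    {γ : A.Curve} (hs : A.IsSimplicial γ) (ht : A.OnTorus z γ) :
    |((A.disp γ).1 : ℝ)| * (Real.pi / 3) + |((A.disp γ).2 : ℝ)| * (Real.pi / 6)
      ≤ A.curveLength γ ∧
    |((A.disp γ).2 : ℝ)| * (Real.pi / 3) ≤ A.curveLength γ := by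
  have habs : |((A.disp γ).1 : ℝ)| = |((R.total γ).1 : ℝ)| ∧
      |((A.disp γ).2 : ℝ)| = |((R.total γ).2 : ℝ)| := by
    rcases R.disp_eq_or hz hs ht with h | h <;> simp [h]
  rw [habs.1, habs.2]
  exact ⟨A.le_curveLength hs fun H => (R.total_le_sum_relLength H T hz hs ht).1,
    A.le_curveLength hs fun H => (R.total_le_sum_relLength H T hz hs ht).2⟩

/-! ### Crossing circles -/

theorem glueShaded_circ (t : A.Tip) : A.glueShaded (t, .circ) = (A.otherTip t, .circ) := by
  unfold glueShaded
  split_ifs <;> rfl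

open Classical in
theorem glue_circ_false (t : A.Tip) (l : Bool) : A.glue (((t, .circ), false), l) =
    (((A.otherTip t, .circ), false), if A.HalfTwist t then !l else l) := by
  rw [glue_false, glueShaded_circ]

open Classical in
/-- The framing of the torus of a crossing circle. -/
def circleFraming (c : A.Tip) : A.Framing where
  on q := q.2 = .circ ∧ (q.1 = c ∨ q.1 = A.otherTip c)
  fw q := decide (q.1 = c)
  on_opp := by
    rintro ⟨t, _⟩ ⟨rfl, rfl | rfl⟩ <;> simp [opposite_circ, otherTip_otherTip]
  on_glue := by
    rintro ⟨t, _⟩ ⟨rfl, rfl | rfl⟩ <;> simp [glueShaded_circ, otherTip_otherTip]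
  fw_opp := by
    rintro ⟨t, _⟩ ⟨rfl, rfl | rfl⟩ <;> simp [opposite_circ, otherTip_otherTip, otherTip_ne]
  fw_glue := by
    rintro ⟨t, _⟩ ⟨rfl, rfl | rfl⟩ <;> simp [glueShaded_circ, otherTip_otherTip, otherTip_ne]

variable (c : A.Tip)

theorem circleFraming_on : (A.circleFraming c).on (c, .circ) := ⟨rfl, .inl rfl⟩

theorem circleFraming_fw : (A.circleFraming c).fw (c, .circ) = true := by simp [circleFraming]

theorem circleFraming_fw_otherTip :
    (A.circleFraming c).fw (A.otherTip c, .circ) = false := by simp [circleFraming, otherTip_ne]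

variable {c}

theorem isSegment_circ {t u : A.Tip} {b b' : Bool} (ht : t = c ∨ t = A.otherTip c)
    (hu : u = c ∨ u = A.otherTip c) (hne : (t, b) ≠ (u, b')) :
    A.poly.IsSegment (.bdry ((t, .circ), b)) (.bdry ((u, .circ), b')) := by
  refine A.isSegment_bdry ?_ (by simpa [eq_comm] using hne)
  rw [opposite_circ]
  rcases ht with rfl | rfl <;> rcases hu with rfl | rfl <;> simp [otherTip_otherTip]

theorem circleTorus_sameTorus_otherTip (l : Bool) :
    A.SameTorus (A.circleTorus c) (((A.otherTip c, .circ), false), l) := by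
  have hvertex : A.poly.SameVertex ((c, .circ), true) ((A.otherTip c, .circ), false) :=
    A.poly_sameVertex (.inr rfl)
  cases l
  · exact (A.sameTorus_glue _).trans _ _ _ (sameTorus_of_sameVertex hvertex false)
  · exact sameTorus_of_sameVertex hvertex true

theorem disp_circleLongitude : A.disp (A.circleLongitude c) = (2, 0) := by
  have hne := A.otherTip_ne c
  have hs : A.IsSimplicial (A.circleLongitude c) :=
    A.isSimplicial_pair (A.isSegment_circ (.inl rfl) (.inr rfl) (by simpa using hne.symm))
      (A.isSegment_circ (.inr rfl) (.inl rfl) (by simpa using hne)) rfl rfl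
  have hdir : A.startDir (A.circleLongitude c) = (A.circleFraming c).dir
      ((A.circleLongitude c).seg 0).enter ((A.circleLongitude c).seg 0).level := by
    simp [startDir, circleLongitude, Framing.dir, circleFraming_fw]
  rw [(A.circleFraming c).disp_eq_total (A.circleFraming_on c) hs (hs.onTorus (.refl _)) hdir]
  change ∑ i : Fin 2, _ = _
  rw [Fin.sum_univ_two]
  simp [circleLongitude, Framing.out_true, circleFraming_fw, circleFraming_fw_otherTip]

theorem disp_eq_neg_total_circleFraming {γ : A.Curve} (hs : A.IsSimplicial γ)
    (h₀ : (γ.seg 0).enter = ((A.otherTip c, .circ), false)) :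
    A.disp γ = -(A.circleFraming c).total γ := by
  have hdir : A.startDir γ
      = (A.circleFraming c).dir (γ.seg 0).enter (γ.seg 0).level + 2 := by
    rw [startDir, Framing.dir, h₀]
    simp only [circleFraming_fw_otherTip, Bool.false_eq_true, if_false]
    decide
  exact (A.circleFraming c).disp_eq_neg_total (A.circleFraming_on c) hs
    (hs.onTorus (h₀ ▸ A.circleTorus_sameTorus_otherTip _)) hdir

theorem disp_circleMeridian : A.disp (A.circleMeridian c) = (A.residue c, 1) := by
  have hopp (b b' : Bool) :
      A.poly.IsSegment (.bdry ((A.otherTip c, .circ), b)) (.bdry ((c, .circ), b')) :=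
    A.isSegment_circ (.inr rfl) (.inl rfl) (by simp [otherTip_ne])
  have hself (t : A.Tip) (b : Bool) :
      A.poly.IsSegment (.bdry ((t, .circ), b)) (.bdry ((t, .circ), !b)) :=
    A.isSegment_circ (.inl rfl) (.inl rfl) (by simp)
  unfold circleMeridian residue
  split_ifs with htwist hover
  · rw [A.disp_eq_neg_total_circleFraming (c := c) _ rfl]
    · change -∑ i : Fin 2, _ = _
      rw [Fin.sum_univ_two]
      simp [Framing.out_true, Framing.out_false, circleFraming_fw]
    · exact A.isSimplicial_pair (hopp _ _) (hself _ _) rfl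
        ((A.glue_circ_false c _).trans (by simp [htwist]))
  · rw [A.disp_eq_neg_total_circleFraming (c := c) _ rfl]
    · change -∑ i : Fin 2, _ = _
      rw [Fin.sum_univ_two]
      simp [Framing.out_true, Framing.out_false, circleFraming_fw, circleFraming_fw_otherTip]
    · exact A.isSimplicial_pair (hself _ _) (hopp _ _) rfl
        ((A.glue_circ_false c _).trans (by simp [htwist]))
  · rw [A.disp_eq_neg_total_circleFraming (c := c) _ rfl]
    · change -∑ i : Fin 1, _ = _
      simp [Framing.out_false, circleFraming_fw]
    · intro i
      obtain rfl : i = 0 := Subsingleton.elim (α := Fin 1) _ _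
      exact ⟨hopp _ _, (A.glue_circ_false c _).trans (by simp [htwist])⟩

theorem circleSlope_eq (q : ℤ) : A.circleSlope c q = (A.residue c + 2 * q, 1) := by
  simp [circleSlope, disp_circleMeridian, disp_circleLongitude, mul_comm]

/-- The end of the twist region that is reached from `t` after passing it `i` times. -/
def tipAt (t : A.Tip) (i : ℕ) : A.Tip := if Even i then t else A.otherTip t

theorem tipAt_succ (t : A.Tip) (i : ℕ) : A.tipAt t (i + 1) = A.otherTip (A.tipAt t i) := by
  by_cases h : Even i <;> simp [tipAt, h, Nat.even_add_one, otherTip_otherTip]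

variable {t : A.Tip} (ht : t = c ∨ t = A.otherTip c)

include ht in
theorem tipAt_eq_or (i : ℕ) : A.tipAt t i = c ∨ A.tipAt t i = A.otherTip c := by
  unfold tipAt
  rcases ht with rfl | rfl <;> split_ifs <;> simp [otherTip_otherTip]

/-- A curve that represents a surgery slope on a crossing circle: it runs along the circle `m`
times through one of the polyhedra, and passes once through the crossing disk. -/
def circleCurve (c t : A.Tip) (m : ℕ) : A.Curve where
  m := m
  seg i :=
    { level := decide (Even i.1)
      enter := Fin.cases ((A.otherTip c, .circ), false) (fun j => ((A.tipAt t j, .circ), true)) i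
      exit := Fin.lastCases ((c, .circ), false) (fun j => ((A.tipAt t j, .circ), true)) i }

include ht in
theorem isSegment_circleCurve (m : ℕ) (i : Fin (m + 1)) : A.poly.IsSegment
    (.bdry ((A.circleCurve c t m).seg i).enter) (.bdry ((A.circleCurve c t m).seg i).exit) := by
  have hexit : ((A.circleCurve c t m).seg i).exit = ((c, .circ), false) ∨
      ((A.circleCurve c t m).seg i).exit = ((A.tipAt t i, .circ), true) := by
    induction i using Fin.lastCases <;> simp [circleCurve]
  induction i using Fin.cases with
  | zero =>
    rcases hexit with hexit | hexit <;> rw [hexit]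
    · exact A.isSegment_circ (.inr rfl) (.inl rfl) (by simp [otherTip_ne])
    · exact A.isSegment_circ (.inr rfl) (A.tipAt_eq_or ht _) (by simp)
  | succ j =>
    rcases hexit with hexit | hexit <;> rw [hexit]
    · exact A.isSegment_circ (A.tipAt_eq_or ht _) (.inl rfl) (by simp)
    · refine A.isSegment_circ (A.tipAt_eq_or ht _) (A.tipAt_eq_or ht _) ?_
      simp [tipAt_succ, (A.otherTip_ne _).symm]

theorem glue_circleCurve {m : ℕ} (hm : Odd m ↔ A.HalfTwist c) (t : A.Tip) (i : Fin (m + 1)) :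
    A.glue (((A.circleCurve c t m).seg i).exit, ((A.circleCurve c t m).seg i).level)
      = (((A.circleCurve c t m).seg (i + 1 : Fin (m + 1))).enter,
        ((A.circleCurve c t m).seg (i + 1 : Fin (m + 1))).level) := by
  induction i using Fin.lastCases with
  | last =>
    rw [Fin.last_add_one]
    simp only [circleCurve, Fin.lastCases_last, Fin.cases_zero, glue_circ_false, Fin.val_last]
    by_cases h : A.HalfTwist c
    · simp [h, hm.mpr h]
    · simp [h, Nat.not_odd_iff_even.mp (mt hm.mp h)]
  | cast j =>
    rw [Fin.coeSucc_eq_succ]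
    simp [circleCurve, glue_true, Nat.even_add_one, -Nat.not_even_iff_odd]

variable {m : ℕ} (hm : Odd m ↔ A.HalfTwist c)

include ht hm in
theorem isSimplicial_circleCurve : A.IsSimplicial (A.circleCurve c t m) :=
  fun i => ⟨A.isSegment_circleCurve ht m i, A.glue_circleCurve hm t i⟩

open Classical in
include ht hm in
theorem disp_circleCurve :
    A.disp (A.circleCurve c t m) = (if t = c then (m : ℤ) else -m, 1) := by
  have hout (i : Fin m) : (A.circleFraming c).out ((A.circleCurve c t m).seg i.castSucc).exit
      ((A.circleCurve c t m).seg i.castSucc).level = if t = c then (-1, 0) else (1, 0) := by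
    rcases ht with rfl | rfl <;> by_cases hi : Even i.1 <;>
      simp [circleCurve, Framing.out_true, tipAt, hi, circleFraming, otherTip_ne,
        otherTip_otherTip]
  rw [A.disp_eq_neg_total_circleFraming (A.isSimplicial_circleCurve ht hm) rfl]
  change -∑ i : Fin (m + 1), _ = _
  rw [Fin.sum_univ_castSucc, Finset.sum_congr rfl fun i _ => hout i]
  split_ifs <;> simp [circleCurve, Framing.out_false, circleFraming_fw]

variable (c) in
theorem exists_disp_eq_circleSlope (q : ℤ) : ∃ γ, A.IsSimplicial γ ∧
    A.OnTorus (A.circleTorus c) γ ∧ A.disp γ = A.circleSlope c q := by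
  set N := A.residue c + 2 * q with hN
  have hm : Odd N.natAbs ↔ A.HalfTwist c := by
    rw [Int.natAbs_odd, hN, residue]
    split_ifs with htwist hover <;> simp only [htwist, iff_true, iff_false]
    · exact ⟨q - 1, by ring⟩
    · exact ⟨q, by ring⟩
    · rw [Int.not_odd_iff_even]
      exact ⟨q, by ring⟩
  have hcurve {t : A.Tip} (ht : t = c ∨ t = A.otherTip c) :=
    A.isSimplicial_circleCurve ht hm
  rw [circleSlope_eq, ← hN]
  rcases le_total 0 N with h | h
  · refine ⟨_, hcurve (.inl rfl), (hcurve (.inl rfl)).onTorus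
      (A.circleTorus_sameTorus_otherTip _), ?_⟩
    rw [A.disp_circleCurve (.inl rfl) hm, if_pos rfl, Int.natAbs_of_nonneg h]
  · refine ⟨_, hcurve (.inr rfl), (hcurve (.inr rfl)).onTorus
      (A.circleTorus_sameTorus_otherTip _), ?_⟩
    rw [A.disp_circleCurve (.inr rfl) hm, if_neg (A.otherTip_ne c), Int.ofNat_natAbs_of_nonpos h,
      neg_neg]

theorem lt_slopeLength_circleSlope (T : Incidence A.next A.prev A.opposite A.white) (c : A.Tip)
    (q : ℤ) : (A.crossingsAfter c q : ℝ) * Real.pi / 3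
      < A.slopeLength (A.circleTorus c) (A.circleSlope c q) := by
  have hpi := Real.pi_pos
  obtain ⟨γ, hs, ht, hdisp⟩ := A.exists_disp_eq_circleSlope c q
  refine lt_of_lt_of_le (b := A.crossingsAfter c q * (Real.pi / 3) + Real.pi / 6) (by linarith)
    (le_csInf ⟨_, γ, hs, ht, ⟨1, one_ne_zero, by rw [hdisp, one_smul]⟩, rfl⟩ ?_)
  rintro _ ⟨γ, hs, ht, ⟨k, hk, hdisp⟩, rfl⟩
  have hlength := ((A.circleFraming c).le_curveLength T (A.circleFraming_on c) hs ht).1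
  rw [circleSlope_eq] at hdisp
  have hk : (1 : ℝ) ≤ |(k : ℝ)| := by exact_mod_cast Int.one_le_abs hk
  have hfst : |((A.disp γ).1 : ℝ)| = |(k : ℝ)| * A.crossingsAfter c q := by
    rw [hdisp, crossingsAfter, Nat.cast_natAbs, Int.cast_abs, ← abs_mul]
    simp
  have hsnd : ((A.disp γ).2 : ℝ) = k := by rw [hdisp]; simp
  rw [hfst, hsnd] at hlength
  have hnonneg : (0 : ℝ) ≤ A.crossingsAfter c q * (Real.pi / 3) := by positivity
  nlinarith

end LinkDiagram.Direction

namespace LinkDiagram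

/-! ### The crossings of a twist region -/

section

variable {D : Type*} {L : LinkDiagram D}

theorem SameRegion.mem_iff {S : Set D} (hσ : ∀ d, L.σ d ∈ S ↔ d ∈ S)
    (hφ : ∀ d, L.IsBigon d → d ∈ S → L.φ d ∈ S) {x y : D} (h : L.SameRegion x y) :
    x ∈ S ↔ y ∈ S := by
  induction h with
  | rel x y h =>
    rcases h with rfl | ⟨hb, rfl⟩
    · exact (hσ x).symm
    · rw [L.α_eq, hσ]
      exact ⟨hφ x hb, fun h => hb.1 ▸ hφ _ (L.bigon_face hb) h⟩
  | refl => rfl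
  | symm _ _ _ ih => exact ih.symm
  | trans _ _ _ _ _ ih₁ ih₂ => exact ih₁.trans ih₂

variable (L) in
/-- The darts at the first `a` crossings that one passes along the row from the corner `c`; the
crossing of `c` itself is the first of them if `c` is not on a bigon. -/
def rowCrossings (c : D) (a : ℕ) : Set D :=
  {d | ∃ j, 0 < j ∧ j ≤ a ∧ L.SameVertex d ((L.row ^ j) c)}

theorem σ_mem_rowCrossings {c : D} {a : ℕ} (d : D) :
    L.σ d ∈ L.rowCrossings c a ↔ d ∈ L.rowCrossings c a := by
  simp only [rowCrossings, Set.mem_ofPred_eq, CombMap.SameVertex, Equiv.Perm.sameCycle_apply_left]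

theorem crossBigon_row_pow_mem_rowCrossings {c : D} {a j : ℕ} (hj : j < a) :
    L.crossBigon ((L.row ^ j) c) ∈ L.rowCrossings c a := by
  refine ⟨j + 1, j.succ_pos, hj, ?_⟩
  rw [pow_succ', Equiv.Perm.mul_apply, L.row_apply]
  exact L.sameVertex_σ_σ _

end

namespace Direction

variable {D : Type*} {L : LinkDiagram D} [Finite D] (A : L.Direction) {c : A.Tip} {a : ℕ}

theorem φ_mem_rowCrossings (he : (A.otherTip c).1 = (L.row ^ a) c.1) {d : D} (hd : L.IsBigon d)
    (h : d ∈ L.rowCrossings c.1 a) : L.φ d ∈ L.rowCrossings c.1 a := by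
  obtain ⟨j, hj, hja, hv⟩ := h
  rw [← L.crossBigon_of_isBigon hd]
  rcases A.eq_of_sameVertex (A.row_pow_mem c.2.1 j) (A.bigon_mem d hd) hv.symm with rfl | hopp
  · refine crossBigon_row_pow_mem_rowCrossings (hja.lt_of_ne ?_)
    rintro rfl
    exact (A.otherTip c).2.2 (he ▸ hd)
  · obtain ⟨j, rfl⟩ := Nat.exists_eq_succ_of_ne_zero hj.ne'
    rw [Nat.succ_eq_add_one, pow_succ', Equiv.Perm.mul_apply, L.row_apply, L.four] at hopp
    rw [hopp, L.crossBigon_involutive]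
    refine ⟨j, Nat.pos_of_ne_zero ?_, by omega, Equiv.Perm.SameCycle.refl _ _⟩
    rintro rfl
    exact c.2.2 (L.isBigon_crossBigon.mp (hopp ▸ hd))

theorem sameRegion_iff_mem_rowCrossings (ha : 0 < a)
    (he : (A.otherTip c).1 = (L.row ^ a) c.1) (d : D) :
    L.SameRegion c.1 d ↔ d ∈ L.rowCrossings c.1 a := by
  constructor
  · intro h
    refine (h.mem_iff σ_mem_rowCrossings fun _ => A.φ_mem_rowCrossings he).mp ?_
    have hmem := crossBigon_row_pow_mem_rowCrossings (L := L) (c := c.1) ha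
    rwa [pow_zero, Equiv.Perm.one_apply, L.crossBigon_of_not_isBigon c.2.2] at hmem
  · rintro ⟨j, -, -, hv⟩
    exact (sameRegion_row_pow c.1 j).trans _ _ _ (L.sameRegion_of_sameVertex hv.symm)

theorem row_pow_ne_self (he : (A.otherTip c).1 = (L.row ^ a) c.1)
    (hb : ∀ j, 0 < j → j < a → L.IsBigon ((L.row ^ j) c.1)) {n : ℕ} (hn : 0 < n)
    (hna : n < 2 * a) : (L.row ^ n) c.1 ≠ c.1 := by
  intro h
  rcases lt_trichotomy n a with hlt | rfl | hgt
  · exact c.2.2 (h ▸ hb n hn hlt)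
  · exact A.otherTip_ne c (Subtype.ext (he.trans h))
  · obtain ⟨j, rfl⟩ := Nat.exists_eq_add_of_le hgt.le
    have hback := A.row_pow_otherTip (i := a - j) (j := j) (by rwa [Nat.sub_add_cancel (by omega)])
    rw [he, ← Equiv.Perm.mul_apply, ← pow_add, add_comm, h] at hback
    exact c.2.2 (hback ▸ L.isBigon_crossBigon.mpr (hb _ (by omega) (by omega)))

theorem not_sameVertex_row_pow (he : (A.otherTip c).1 = (L.row ^ a) c.1)
    (hb : ∀ j, 0 < j → j < a → L.IsBigon ((L.row ^ j) c.1)) {i j : ℕ} (hi : 0 < i) (hij : i < j)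
    (hja : j ≤ a) : ¬ L.SameVertex ((L.row ^ i) c.1) ((L.row ^ j) c.1) := by
  intro hv
  rcases A.eq_of_sameVertex (A.row_pow_mem c.2.1 _) (A.row_pow_mem c.2.1 _) hv with h | h
  · obtain ⟨k, rfl⟩ := Nat.exists_eq_add_of_lt hij
    refine A.row_pow_ne_self he hb k.succ_pos (by omega) ((L.row ^ i).injective ?_)
    rw [← Equiv.Perm.mul_apply, ← pow_add]
    exact h
  · obtain ⟨i, rfl⟩ := Nat.exists_eq_succ_of_ne_zero hi.ne'
    rw [Nat.succ_eq_add_one, pow_succ' _ i, Equiv.Perm.mul_apply, L.row_apply, L.four] at h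
    have hback := L.row_pow_crossBigon_row_pow i c.1
    rw [← h, L.crossBigon_of_not_isBigon c.2.2, ← Equiv.Perm.mul_apply, ← pow_add] at hback
    exact A.row_pow_ne_self he hb (by omega) (by omega) hback

theorem crossings_eq_of_otherTip_eq (ha : 0 < a) (he : (A.otherTip c).1 = (L.row ^ a) c.1)
    (hb : ∀ j, 0 < j → j < a → L.IsBigon ((L.row ^ j) c.1)) : L.crossings c.1 = a := by
  have himage : Quotient.mk (Equiv.Perm.SameCycle.setoid L.σ) '' {d | L.SameRegion c.1 d} =
      (fun j => Quotient.mk _ ((L.row ^ j) c.1)) '' (Finset.Icc 1 a : Set ℕ) := by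
    ext v
    constructor
    · rintro ⟨d, hd, rfl⟩
      obtain ⟨j, hj, hja, hv⟩ := (A.sameRegion_iff_mem_rowCrossings ha he d).mp hd
      exact ⟨j, by simpa using ⟨hj, hja⟩, Quotient.sound hv.symm⟩
    · rintro ⟨j, -, rfl⟩
      exact ⟨_, sameRegion_row_pow c.1 j, rfl⟩
  have hinj : Set.InjOn (fun j => Quotient.mk (Equiv.Perm.SameCycle.setoid L.σ) ((L.row ^ j) c.1))
      (Finset.Icc 1 a : Set ℕ) := by
    intro i hi j hj h
    simp only [Finset.coe_Icc, Set.mem_Icc] at hi hj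
    have hv : L.SameVertex ((L.row ^ i) c.1) ((L.row ^ j) c.1) := Quotient.exact h
    rcases lt_trichotomy i j with hij | hij | hij
    · exact absurd hv (A.not_sameVertex_row_pow he hb (by omega) hij (by omega))
    · exact hij
    · exact absurd hv.symm (A.not_sameVertex_row_pow he hb (by omega) hij (by omega))
  rw [crossings, himage, hinj.ncard_image, Set.ncard_coe_finset, Nat.card_Icc, Nat.add_sub_cancel]

end Direction

end LinkDiagram

/-! ### Strands of the link -/

theorem map_perm_zpow_apply {X Y : Type*} {f : X → Y} {g : Equiv.Perm X} {h : Equiv.Perm Y}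
    (hf : ∀ x, f (g x) = h (f x)) (k : ℤ) (x : X) : f ((g ^ k) x) = (h ^ k) (f x) := by
  induction k generalizing x with
  | zero => rfl
  | succ k ih => rw [zpow_add_one, zpow_add_one, Equiv.Perm.mul_apply, Equiv.Perm.mul_apply, ih, hf]
  | pred k ih =>
    rw [zpow_sub_one, zpow_sub_one, Equiv.Perm.mul_apply, Equiv.Perm.mul_apply, ih]
    congr 1
    rw [Equiv.Perm.eq_inv_iff_eq, ← hf, ← Equiv.Perm.mul_apply, mul_inv_cancel,
      Equiv.Perm.one_apply]

theorem Pos.mirror_ne_circ {p : Pos} (h : p ≠ .circ) : p.mirror ≠ .circ := by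
  cases p <;> simp_all [mirror]

namespace LinkDiagram

section

variable {D : Type*} (L : LinkDiagram D)

/-- The dart of the strand that passes the corner `x` of a row of bigons on the given side. The
value at `circ` is junk. -/
def strandAt (x : D) : Pos → D
  | .circ => x
  | .fst => x
  | .snd => L.σ x

variable {L}

theorem walk_strandAt {x : D} (h : L.IsBigon x) {p : Pos} (hp : p ≠ .circ) :
    L.walk (L.strandAt x p) = L.strandAt (L.row x) p.mirror := by
  rw [L.row_apply, L.crossBigon_of_isBigon h]
  cases p
  · exact absurd rfl hp
  · change L.σ (L.σ (L.α x)) = _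
    rw [L.α_eq]; rfl
  · change L.σ (L.σ (L.α (L.σ x))) = _
    rw [L.α_σ_eq_of_φ_φ h.1]; rfl

theorem not_external_strandAt {x : D} (h : L.IsBigon x) (p : Pos) :
    ¬ L.External (L.strandAt x p) := by
  cases p
  · exact fun he => he.1 h
  · exact fun he => he.1 h
  · intro he
    have hα : ¬ L.IsBigon (L.α (L.σ x)) := he.2
    rw [L.α_σ_eq_of_φ_φ h.1] at hα
    exact hα (L.bigon_face h)

theorem α_walk (d : D) : L.α (L.walk d) = L.walk⁻¹ (L.α d) := by
  rw [Equiv.Perm.eq_inv_iff_eq]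
  simp [walk, L.α_invol, L.four]

theorem α_walk_zpow (k : ℤ) (d : D) : L.α ((L.walk ^ k) d) = (L.walk ^ (-k)) (L.α d) := by
  rw [zpow_neg, ← inv_zpow]
  exact map_perm_zpow_apply α_walk k d

variable (L) in
theorem not_sameCycle_walk_α (d : D) : ¬ L.walk.SameCycle d (L.α d) := by
  rintro ⟨k, hk⟩
  have hα : ∀ j : ℤ, L.α ((L.walk ^ j) d) = (L.walk ^ (k - j)) d := fun j => by
    rw [α_walk_zpow, ← hk, ← Equiv.Perm.mul_apply, ← zpow_add, neg_add_eq_sub]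
  rcases Int.even_or_odd' k with ⟨j, rfl | rfl⟩
  · have hfix := hα j
    rw [two_mul, add_sub_cancel_right] at hfix
    exact L.α_ne _ hfix
  · have hfix := hα j
    rw [show 2 * j + 1 - j = 1 + j by ring, zpow_add, zpow_one, Equiv.Perm.mul_apply] at hfix
    exact L.two_ne _ hfix.symm

theorem sameCycle_walk_α {d d' : D} (h : L.walk.SameCycle d d') :
    L.walk.SameCycle (L.α d) (L.α d') := by
  obtain ⟨k, rfl⟩ := h
  exact ⟨-k, (α_walk_zpow k d).symm⟩

theorem visits_eq_of_sameCycle {d d' : D} (h : L.walk.SameCycle d d') :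
    L.visits d = L.visits d' := by
  unfold visits
  congr 1
  ext x
  exact and_congr_left fun _ => ⟨h.symm.trans, h.trans⟩

end

namespace Direction

variable {D : Type*} {L : LinkDiagram D} (A : L.Direction)

theorem dartOf_eq_strandAt (q : A.Shaded) : A.dartOf q = L.strandAt q.1.1 q.2 := by
  obtain ⟨c, _ | _ | _⟩ := q <;> rfl

theorem walk_pow_α_dartOf {q : A.Shaded} (h : q.2 ≠ .circ) {a : ℕ}
    (hb : ∀ j, 0 < j → j < a → L.IsBigon ((L.row ^ j) q.1.1)) {j : ℕ} (hj : 0 < j) (hja : j ≤ a) :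
    (L.walk ^ j) (L.α (A.dartOf q)) =
      L.strandAt ((L.row ^ j) q.1.1) (Pos.mirror^[j + 1] q.2) := by
  have hmirror (k : ℕ) : Pos.mirror^[k] q.2 ≠ .circ := by
    induction k with
    | zero => exact h
    | succ k ih => rw [Function.iterate_succ_apply']; exact Pos.mirror_ne_circ ih
  induction j, hj using Nat.le_induction with
  | base =>
    obtain ⟨c, p⟩ := q
    rw [pow_one, pow_one, L.row_apply, L.crossBigon_of_not_isBigon c.2.2, dartOf_eq_strandAt]
    change L.σ (L.σ (L.α (L.α _))) = _
    rw [L.α_invol]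
    cases p <;> rfl
  | succ j hj ih =>
    rw [pow_succ', Equiv.Perm.mul_apply, ih (by omega), walk_strandAt (hb j hj hja) (hmirror _),
      ← Function.iterate_succ_apply' Pos.mirror, pow_succ', Equiv.Perm.mul_apply]

variable [Finite D]

theorem glueShaded_snd_ne_circ {q : A.Shaded} (h : q.2 ≠ .circ) : (A.glueShaded q).2 ≠ .circ := by
  unfold glueShaded
  split_ifs
  · exact h
  · exact Pos.mirror_ne_circ h

theorem strandAt_otherTip {q : A.Shaded} : L.strandAt (A.otherTip q.1).1
    (Pos.mirror^[L.crossings q.1.1 + 1] q.2) = A.dartOf (A.glueShaded q) := by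
  have hmirror : Function.Involutive Pos.mirror := Pos.mirror_mirror
  rw [dartOf_eq_strandAt]
  by_cases h : Odd (L.crossings q.1.1)
  · rw [hmirror.iterate_even h.add_one]
    simp [glueShaded, HalfTwist, h]
  · rw [hmirror.iterate_odd (Nat.not_odd_iff_even.mp h).add_one]
    simp [glueShaded, HalfTwist, h]

theorem exists_walk_pow_eq_glueShaded {q : A.Shaded} (h : q.2 ≠ .circ) : ∃ a, 0 < a ∧
    (L.walk ^ a) (L.α (A.dartOf q)) = A.dartOf (A.glueShaded q) ∧
    ∀ j, 0 < j → j < a → ¬ L.External ((L.walk ^ j) (L.α (A.dartOf q))) := by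
  obtain ⟨a, ha, he, hb⟩ := A.exists_otherTip_eq_row_pow q.1
  refine ⟨a, ha, ?_, fun j hj hja => ?_⟩
  · rw [A.walk_pow_α_dartOf h hb ha le_rfl, ← he, ← strandAt_otherTip,
      A.crossings_eq_of_otherTip_eq ha he hb]
  · rw [A.walk_pow_α_dartOf h hb hj hja.le]
    exact not_external_strandAt (hb j hj hja) _

theorem sameCycle_walk_glueShaded {q : A.Shaded} (h : q.2 ≠ .circ) :
    L.walk.SameCycle (L.α (A.dartOf q)) (A.dartOf (A.glueShaded q)) := by
  obtain ⟨a, -, ha, -⟩ := A.exists_walk_pow_eq_glueShaded h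
  exact ⟨a, by rwa [zpow_natCast]⟩

open Classical in
/-- The framing of the torus of the component of the link through the dart `d`: upwards is the
direction of the walk from `d`. -/
def strandFraming (d : D) : A.Framing where
  on q := q.2 ≠ .circ ∧
    (L.walk.SameCycle d (A.dartOf q) ∨ L.walk.SameCycle d (L.α (A.dartOf q)))
  fw q := decide (L.walk.SameCycle d (A.dartOf q))
  on_opp := by
    rintro q ⟨h, h'⟩
    refine ⟨mt (A.opposite_snd_eq_circ_iff q).mp h, ?_⟩
    rw [A.dartOf_opposite q h, L.α_invol]
    exact h'.symm
  on_glue := by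
    rintro q ⟨h, h'⟩
    have hglue := A.sameCycle_walk_glueShaded h
    refine ⟨A.glueShaded_snd_ne_circ h, h'.symm.imp (·.trans hglue) fun h' => ?_⟩
    exact h'.trans (L.α_invol (A.dartOf q) ▸ sameCycle_walk_α hglue)
  fw_opp := by
    rintro q ⟨h, h'⟩
    rw [A.dartOf_opposite q h]
    by_cases hq : L.walk.SameCycle d (A.dartOf q)
    · have hα : ¬ L.walk.SameCycle d (L.α (A.dartOf q)) :=
        fun hα => L.not_sameCycle_walk_α _ (hq.symm.trans hα)
      simp [hq, hα]
    · simp [hq, h'.resolve_left hq]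
  fw_glue := by
    rintro q ⟨h, h'⟩
    have hglue := A.sameCycle_walk_glueShaded h
    by_cases hq : L.walk.SameCycle d (A.dartOf q)
    · have hg : ¬ L.walk.SameCycle d (A.dartOf (A.glueShaded q)) :=
        fun hg => L.not_sameCycle_walk_α _ ((hq.symm.trans hg).trans hglue.symm)
      simp [hq, hg]
    · simp [hq, (h'.resolve_left hq).trans hglue]

end Direction

end LinkDiagram

/-! ### Displacement along a strand -/

namespace LinkDiagram

namespace Direction

variable {D : Type*} {L : LinkDiagram D} (A : L.Direction)

/-- The exchange of the two polyhedra. -/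
def swap : Equiv.Perm (A.Shaded × Bool) :=
  (Equiv.refl A.Shaded).prodCongr Equiv.boolNot

theorem swap_apply (s : A.Shaded × Bool) : A.swap s = (s.1, !s.2) := rfl

variable [Finite D]

/-- The corner that follows `q` along its strand, on the next edge of the diagram that is on no
bigon. -/
def nextOnStrand : Equiv.Perm A.Shaded where
  toFun q := A.glueShaded (A.opposite q)
  invFun q := A.opposite (A.glueShaded q)
  left_inv q := by simp only [A.glueShaded_glueShaded, A.opposite_opposite]
  right_inv q := by simp only [A.opposite_opposite, A.glueShaded_glueShaded]

theorem halfTwist_glueShaded (q : A.Shaded) :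
    A.HalfTwist (A.glueShaded q).1 ↔ A.HalfTwist q.1 :=
  A.halfTwist_otherTip q.1

open Classical in
/-- `nextOnStrand`, together with the change of polyhedra: the level is `true` in one of the two
polyhedra, and a half twist exchanges them. -/
def advance : Equiv.Perm (A.Shaded × Bool) where
  toFun s := (A.nextOnStrand s.1, if A.HalfTwist (A.opposite s.1).1 then !s.2 else s.2)
  invFun s := (A.nextOnStrand.symm s.1, if A.HalfTwist s.1.1 then !s.2 else s.2)
  left_inv := by
    rintro ⟨q, l⟩
    simp only [nextOnStrand, Equiv.coe_fn_mk, Equiv.coe_fn_symm_mk, A.glueShaded_glueShaded,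
      A.opposite_opposite, A.halfTwist_glueShaded]
    split_ifs <;> simp
  right_inv := by
    rintro ⟨q, l⟩
    simp only [nextOnStrand, Equiv.coe_fn_mk, Equiv.coe_fn_symm_mk, A.glueShaded_glueShaded,
      A.opposite_opposite, A.halfTwist_glueShaded]
    split_ifs <;> simp

open Classical in
theorem advance_opposite (q : A.Shaded) (l : Bool) :
    A.advance (A.opposite q, l) = (A.glueShaded q, if A.HalfTwist q.1 then !l else l) := by
  simp only [advance, nextOnStrand, Equiv.coe_fn_mk]
  rw [A.opposite_opposite]

theorem commute_advance_swap : Commute A.advance A.swap := by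
  ext1 s
  simp only [advance, swap_apply, Equiv.Perm.mul_apply, Equiv.coe_fn_mk]
  split_ifs <;> rfl

/-- The change of corner and level on moving `v.1` rectangles around a strand and `v.2` rectangles
along it. -/
def shift (v : ℤ × ℤ) : Equiv.Perm (A.Shaded × Bool) := A.advance ^ v.2 * A.swap ^ v.1

theorem shift_add (v w : ℤ × ℤ) : A.shift (v + w) = A.shift v * A.shift w := by
  have hcomm := (A.commute_advance_swap.zpow_zpow w.2 v.1).eq
  rw [shift, shift, shift, Prod.snd_add, Prod.fst_add, zpow_add, zpow_add, mul_assoc, mul_assoc,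
    ← mul_assoc (A.swap ^ v.1), ← hcomm, mul_assoc]

theorem shift_apply_fst (v : ℤ × ℤ) (s : A.Shaded × Bool) :
    (A.shift v s).1 = (A.nextOnStrand ^ v.2) s.1 := by
  have hswap := map_perm_zpow_apply (f := Prod.fst) (g := A.swap) (h := 1) (fun _ => rfl) v.1 s
  rw [shift, Equiv.Perm.mul_apply,
    map_perm_zpow_apply (f := Prod.fst) (h := A.nextOnStrand) (fun _ => rfl), hswap, one_zpow,
    Equiv.Perm.one_apply]

variable {A} in
theorem even_fst_of_shift_eq {v : ℤ × ℤ} {s : A.Shaded × Bool} (h : A.shift v s = s)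
    (hv : v.2 = 0) : Even v.1 := by
  have hsq : A.swap ^ (2 : ℤ) = 1 := by
    ext1 s
    rw [zpow_ofNat, pow_two]
    simp [swap_apply]
  rw [shift, hv, zpow_zero, one_mul] at h
  rcases Int.even_or_odd' v.1 with ⟨j, hj | hj⟩
  · exact hj ▸ even_two_mul j
  · rw [hj, zpow_add, zpow_mul, hsq, one_zpow, one_mul, zpow_one] at h
    exact absurd (congrArg Prod.snd h) (Bool.not_ne_self _)

namespace Framing

variable {A} (R : A.Framing)

/-- Of the two corners at an ideal vertex, the one through which the strand enters when followed
upwards. -/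
def corner (q : A.Shaded) : A.Shaded := if R.fw q then q else A.opposite q

theorem corner_opposite {q : A.Shaded} (h : R.on q) : R.corner (A.opposite q) = R.corner q := by
  unfold corner
  rw [R.fw_opp q h]
  cases R.fw q <;> simp [A.opposite_opposite]

theorem corner_glue {y x : A.Dart} {l l' : Bool} (hy : R.on y.1) (h : A.glue (y, l) = (x, l')) :
    (R.corner x.1, l') = A.shift (R.out y l) (R.corner y.1, l) := by
  obtain ⟨q, _ | _⟩ := y
  · rw [A.glue_false] at h
    obtain ⟨rfl, rfl⟩ := Prod.mk.inj h
    rw [out_false]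
    cases hq : R.fw q
    · simp [shift, corner, hq, R.fw_glue q hy, A.advance_opposite]
    · simp [shift, corner, hq, R.fw_glue q hy, advance, nextOnStrand]
  · rw [A.glue_true] at h
    obtain ⟨rfl, rfl⟩ := Prod.mk.inj h
    rw [out_true]
    split_ifs <;> simp [shift, swap]

theorem shift_total {z : A.Dart × Bool} {γ : A.Curve} (hz : R.on z.1.1) (hs : A.IsSimplicial γ)
    (ht : A.OnTorus z γ) : A.shift (R.total γ) (R.corner (γ.seg 0).enter.1, (γ.seg 0).level)
      = (R.corner (γ.seg 0).enter.1, (γ.seg 0).level) := by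
  let s (i : Fin (γ.m + 1)) : A.Shaded × Bool := (R.corner (γ.seg i).enter.1, (γ.seg i).level)
  let o (i : Fin (γ.m + 1)) : ℤ × ℤ := R.out (γ.seg i).exit (γ.seg i).level
  have hstep (i) : s (i + 1) = A.shift (o i) (s i) := by
    have hcorner : R.corner (γ.seg i).exit.1 = R.corner (γ.seg i).enter.1 := by
      rcases (A.vertexSeg (hs i).1).1 with h | h
      · rw [h]
      · rw [h, R.corner_opposite (R.on_enter hz ht i)]
    exact (R.corner_glue (R.on_exit hz hs ht i) (hs i).2).trans (by rw [hcorner])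
  have hsum (i : Fin (γ.m + 1)) : s (i + 1) = A.shift (∑ j ∈ Finset.Iic i, o j) (s 0) := by
    induction i using Fin.induction with
    | zero => simpa [← bot_eq_zero] using hstep 0
    | succ i ih =>
      rw [Fin.coeSucc_eq_succ] at ih
      have hIic : Finset.Iic i.succ = insert i.succ (Finset.Iic i.castSucc) := by
        ext j; simp [Fin.le_def, Fin.ext_iff]; omega
      rw [hstep, ih, hIic, Finset.sum_insert (by simp [Fin.le_def]), shift_add,
        Equiv.Perm.mul_apply]
  have hlast := hsum (Fin.last γ.m)
  rw [Fin.last_add_one, show Finset.Iic (Fin.last γ.m) = Finset.univ from Finset.Iic_top] at hlast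
  exact hlast.symm

end Framing

theorem exists_walk_pow_eq_nextOnStrand {q : A.Shaded} (h : q.2 ≠ .circ) : ∃ a, 0 < a ∧
    (L.walk ^ a) (A.dartOf q) = A.dartOf (A.nextOnStrand q) ∧
    ∀ j, 0 < j → j < a → ¬ L.External ((L.walk ^ j) (A.dartOf q)) := by
  have hwalk := A.exists_walk_pow_eq_glueShaded (mt (A.opposite_snd_eq_circ_iff q).mp h)
  rwa [A.dartOf_opposite q h, L.α_invol] at hwalk

theorem nextOnStrand_snd_ne_circ {q : A.Shaded} (h : q.2 ≠ .circ) : (A.nextOnStrand q).2 ≠ .circ :=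
  A.glueShaded_snd_ne_circ (mt (A.opposite_snd_eq_circ_iff q).mp h)

theorem exists_nextOnStrand_pow {q : A.Shaded} (h : q.2 ≠ .circ) {m : ℕ}
    (he : L.External ((L.walk ^ m) (A.dartOf q))) :
    ∃ k : ℕ, (L.walk ^ m) (A.dartOf q) = A.dartOf ((A.nextOnStrand ^ k) q) := by
  induction m using Nat.strong_induction_on generalizing q with
  | _ m ih =>
    rcases Nat.eq_zero_or_pos m with rfl | hm
    · exact ⟨0, rfl⟩
    obtain ⟨a, ha, hnext, hmin⟩ := A.exists_walk_pow_eq_nextOnStrand h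
    have ham : a ≤ m := not_lt.mp fun hlt => hmin m hm hlt he
    rw [← Nat.sub_add_cancel ham, pow_add, Equiv.Perm.mul_apply, hnext] at he ⊢
    obtain ⟨k, hk⟩ := ih (m - a) (by omega) (A.nextOnStrand_snd_ne_circ h) he
    exact ⟨k + 1, by rw [hk, pow_succ, Equiv.Perm.mul_apply]⟩

theorem visits_le_natAbs {q : A.Shaded} (h : q.2 ≠ .circ) {n : ℤ} (hn : n ≠ 0)
    (hq : (A.nextOnStrand ^ n) q = q) : L.visits (A.dartOf q) ≤ n.natAbs := by
  have hper : Function.IsPeriodicPt A.nextOnStrand n.natAbs q := by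
    rw [Function.IsPeriodicPt, ← Equiv.Perm.coe_pow]
    change (A.nextOnStrand ^ n.natAbs) q = q
    rcases Int.natAbs_eq n with h | h
    · rwa [← zpow_natCast, ← h]
    · rw [h, zpow_neg, Equiv.Perm.inv_eq_iff_eq] at hq
      rw [← zpow_natCast, ← hq]
  have hsub : {d | L.walk.SameCycle (A.dartOf q) d ∧ L.External d} ⊆
      (fun k => A.dartOf ((A.nextOnStrand ^ k) q)) '' (Finset.range n.natAbs : Set ℕ) := by
    rintro d ⟨hd, he⟩
    obtain ⟨m, -, -, rfl⟩ := hd.exists_pow_eq''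
    obtain ⟨k, hk⟩ := A.exists_nextOnStrand_pow h he
    refine ⟨k % n.natAbs, by simpa using Nat.mod_lt _ (Int.natAbs_pos.mpr hn), ?_⟩
    simp only [hk, Equiv.Perm.coe_pow, hper.iterate_mod_apply]
  calc L.visits (A.dartOf q)
    _ ≤ _ := Set.ncard_le_ncard hsub ((Finset.finite_toSet _).image _)
    _ ≤ (Finset.range n.natAbs : Set ℕ).ncard := Set.ncard_image_le (Finset.finite_toSet _)
    _ = n.natAbs := by rw [Set.ncard_coe_finset, Finset.card_range]

section

variable {d : D}

theorem fw_strandFraming {q : A.Shaded} :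
    (A.strandFraming d).fw q = true ↔ L.walk.SameCycle d (A.dartOf q) := by
  simp [strandFraming]

variable (hd : L.External d)

theorem strandFraming_on : (A.strandFraming d).on (A.locate d hd) :=
  ⟨A.locate_ne_circ d hd, .inl (by rw [A.dartOf_locate])⟩

theorem fw_strandFraming_locate : (A.strandFraming d).fw (A.locate d hd) = true :=
  A.fw_strandFraming.mpr (by rw [A.dartOf_locate])

theorem fw_strandFraming_opposite_locate :
    (A.strandFraming d).fw (A.opposite (A.locate d hd)) = false := by
  rw [(A.strandFraming d).fw_opp _ (A.strandFraming_on hd), A.fw_strandFraming_locate hd]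
  rfl

theorem isSimplicial_strandMeridian : A.IsSimplicial (A.strandMeridian d hd) := by
  have hne : A.opposite (A.locate d hd) ≠ A.locate d hd := fun h => by
    have hfw := A.fw_strandFraming_opposite_locate hd
    rw [h, A.fw_strandFraming_locate hd] at hfw
    cases hfw
  exact A.isSimplicial_pair (A.isSegment_bdry (.inr rfl) (by simpa using hne))
    (A.isSegment_bdry (.inr (A.opposite_opposite _).symm) (by simpa using hne.symm)) rfl rfl

theorem onTorus_strandMeridian : A.OnTorus (A.strandTorus d hd) (A.strandMeridian d hd) :=
  (A.isSimplicial_strandMeridian hd).onTorus (.refl _)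

theorem disp_strandMeridian : A.disp (A.strandMeridian d hd) = (2, 0) := by
  have hfw := A.fw_strandFraming_locate hd
  have hfw' := A.fw_strandFraming_opposite_locate hd
  rw [(A.strandFraming d).disp_eq_total (A.strandFraming_on hd)
    (A.isSimplicial_strandMeridian hd) (A.onTorus_strandMeridian hd)
    (by simp [startDir, strandMeridian, Framing.dir, hfw])]
  change ∑ i : Fin 2, _ = _
  rw [Fin.sum_univ_two]
  simp [strandMeridian, Framing.out_true, hfw, hfw']

variable {A hd} {γ : A.Curve} (hs : A.IsSimplicial γ) (ht : A.OnTorus (A.strandTorus d hd) γ)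
include hs ht

theorem even_fst_disp_of_strandTorus (h : (A.disp γ).2 = 0) : Even (A.disp γ).1 := by
  have hz := A.strandFraming_on hd
  have hshift := (A.strandFraming d).shift_total hz hs ht
  rcases (A.strandFraming d).disp_eq_or hz hs ht with hd | hd <;> rw [hd] at h ⊢
  · exact even_fst_of_shift_eq hshift h
  · exact (even_fst_of_shift_eq hshift (neg_eq_zero.mp h)).neg

theorem visits_le_natAbs_snd_disp (h : (A.disp γ).2 ≠ 0) :
    L.visits d ≤ (A.disp γ).2.natAbs := by
  set R := A.strandFraming d
  have hz : R.on (A.locate d hd) := A.strandFraming_on hd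
  have hnat : (A.disp γ).2.natAbs = (R.total γ).2.natAbs := by
    rcases R.disp_eq_or hz hs ht with h | h <;> simp [h]
  have hon : R.on (γ.seg 0).enter.1 := R.on_enter hz ht 0
  have hcorner : R.on (R.corner (γ.seg 0).enter.1) ∧ R.fw (R.corner (γ.seg 0).enter.1) = true := by
    unfold Framing.corner
    split_ifs with hfw
    · exact ⟨hon, hfw⟩
    · exact ⟨R.on_opp _ hon, by simp [R.fw_opp _ hon, hfw]⟩
  have hcycle : L.walk.SameCycle d (A.dartOf (R.corner (γ.seg 0).enter.1)) :=
    A.fw_strandFraming.mp hcorner.2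
  rw [visits_eq_of_sameCycle hcycle, hnat]
  refine A.visits_le_natAbs hcorner.1.1 ?_ ?_
  · rwa [ne_eq, ← Int.natAbs_eq_zero, ← hnat, Int.natAbs_eq_zero]
  · rw [← A.shift_apply_fst _ (R.corner (γ.seg 0).enter.1, (γ.seg 0).level),
      R.shift_total hz hs ht]

end

section

variable {A} {d : D} {hd : L.External d} {x : ℤ × ℤ}

/-- An element of the lattice with no component along the strand is a multiple of the meridian. -/
theorem snd_ne_zero_of_isNontrivialSlope (hx : A.IsNontrivialSlope d hd x) : x.2 ≠ 0 := by
  obtain ⟨⟨⟨γ, hs, ht, hγ⟩, -, hprim⟩, hne, hne'⟩ := hx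
  intro hzero
  have heven : Even x.1 := by
    have heven := even_fst_disp_of_strandTorus hs ht
    rcases hγ with rfl | h
    · exact heven hzero
    · rw [h] at heven
      exact even_neg.mp (heven (neg_eq_zero.mpr hzero))
  obtain ⟨a, ha⟩ := heven
  have hmul : x = a • A.disp (A.strandMeridian d hd) := by
    rw [A.disp_strandMeridian hd]
    ext
    · simp [ha, mul_two]
    · simp [hzero]
  rcases hprim _ ⟨_, A.isSimplicial_strandMeridian hd, A.onTorus_strandMeridian hd, .inl rfl⟩ a
    hmul with rfl | rfl
  · exact hne (by rwa [one_smul] at hmul)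
  · exact hne' (by rwa [neg_smul, one_smul] at hmul)

theorem le_slopeLength_strand (T : Incidence A.next A.prev A.opposite A.white)
    (hx : A.IsNontrivialSlope d hd x) :
    (L.visits d : ℝ) * Real.pi / 3 ≤ A.slopeLength (A.strandTorus d hd) x := by
  obtain ⟨γ, hs, ht, hγ⟩ := hx.1.1
  refine le_csInf ?_ ?_
  · rcases hγ with h | h
    · exact ⟨_, γ, hs, ht, ⟨1, one_ne_zero, by rw [h, one_smul]⟩, rfl⟩
    · exact ⟨_, γ, hs, ht, ⟨-1, by norm_num, by rw [h, neg_smul, one_smul]⟩, rfl⟩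
  · rintro _ ⟨γ, hs, ht, ⟨k, hk, hγ⟩, rfl⟩
    have hsnd : (A.disp γ).2 ≠ 0 := by
      simp [hγ, hk, snd_ne_zero_of_isNontrivialSlope hx]
    have hvisits : (L.visits d : ℝ) ≤ |((A.disp γ).2 : ℝ)| := by
      rw [← Int.cast_abs, ← Nat.cast_natAbs]
      exact_mod_cast visits_le_natAbs_snd_disp hs ht hsnd
    calc (L.visits d : ℝ) * Real.pi / 3
      _ = L.visits d * (Real.pi / 3) := by ring
      _ ≤ |((A.disp γ).2 : ℝ)| * (Real.pi / 3) := by gcongr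
      _ ≤ A.curveLength γ :=
        ((A.strandFraming d).le_curveLength T (A.strandFraming_on hd) hs ht).2

end

end Direction

end LinkDiagram

end AugLink

end

theorem mainTheorem6 {D : Type*} [Finite D] (L : AugLink.LinkDiagram D)
    (hprime : L.IsPrime) (htwist : L.IsTwistReduced) (htwo : L.TwoRegions) (A : L.Direction) :
    (∀ (d : D) (hd : L.External d) (x : ℤ × ℤ), A.IsNontrivialSlope d hd x →
      (L.visits d : ℝ) * Real.pi / 3 ≤ A.slopeLength (A.strandTorus d hd) x) ∧
    (∀ (c : A.Tip) (q : ℤ),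
      (A.crossingsAfter c q : ℝ) * Real.pi / 3
        < A.slopeLength (A.circleTorus c) (A.circleSlope c q)) := by
  have T := A.incidence hprime htwist htwo
  exact ⟨fun d hd x hx => A.le_slopeLength_strand T hx, A.lt_slopeLength_circleSlope T⟩
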